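/- Let $n_1,n_2,n_3>1$ be integers and let $M=M_{n_1,n_2,n_3}=G/H$ be the flag manifold with $G=SO_{2(n_1+n_2+n_3)+1}$, $H=U_{n_1}\times U_{n_2}\times SO_{2n_3+1}$. Let $B$ be the Killing form of $\mathfrak g$, and let $\mathfrak g=\mathfrak h\oplus\mathfrak m_1\oplus\dots\oplus\mathfrak m_6$ be the isotropy decomposition, where $\mathfrak m_j$ corresponds to the T-root $\omega_j$ in the list $2\varepsilon_1,\ 2\varepsilon_2,\ \varepsilon_1-\varepsilon_2,\ \varepsilon_1+\varepsilon_2,\ \varepsilon_1,\ \varepsilon_2$; put $\mathfrak m=\bigoplus_j\mathfrak m_j$. Let $\Delta\subset\mathbb R^6$ be the Newton polytope of the scalar curvature of the invariant metrics $\sum_i t_i(-B|_{\mathfrak m_i})$, that is, the convex hull of the points $-e_i$ and of the points $e_i-e_j-e_k$ with $B(\mathfrak m_i,[\mathfrak m_j,\mathfrak m_k])\neq 0$. Let $\Gamma_1^{1,1},\Gamma_1^{1,2},\Gamma_1^{2,1},\Gamma_1^{2,2}$ be the faces of $\Delta$ on which the linear forms $$f_1^{1,1}=(4,2,2,4,3,1),\quad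 f_1^{1,2}=(4,2,4,2,3,1),\quad f_1^{2,1}=(2,4,2,4,1,3),\quad f_1^{2,2}=(2,4,4,2,1,3)$$ attain their maximum over $\Delta$. For $\Gamma$ one of these faces and $f$ its form, let $\mathfrak g_\Gamma$ be the graded Lie algebra associated with the filtration $F_a\mathfrak g=\mathfrak h\oplus\bigoplus_{f(j)\le a}\mathfrak m_j$ of $\mathfrak g$ (with $\mathfrak h$ placed in degree $0$), let $G_\Gamma\supset H$ be the Lie group with Lie algebra $\mathfrak g_\Gamma$ (realized by its adjoint representation), and let $M_\Gamma=G_\Gamma/H$ be the Inönü–Wigner contraction of $M$ by $\Gamma$. A tuple $(t_1,\dots,t_6)$ of nonzero reals denotes the $G_\Gamma$-invariant pseudo-Riemannian metric on $M_\Gamma$ which equals $\sum_i t_i(-B|_{\mathfrak m_i})$ on $T_{eH}M_\Gamma=\mathfrak m$. Suppose that $$2\,n_i(2n_3+1)=(n_j-1)^2\qquad\text{for }(i,j)=(1,2)\text{ or }(2,1).$$ Then $\Gamma_1^{i,1}$ and $\Gamma_1^{i,2}$ are parallelograms, the contractions of $M$ by these two faces are diffeomorphic to the Euclidean space $\mathbb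 R^{\dim\mathfrak m}$ by the map $X\mapsto \exp(X)H$, $X\in\mathfrak m$, and the following three-parameter families of real invariant metrics ($t_1,t_2,t_3\in\mathbb R_{>0}$) on them are Ricci-flat: $$\Gamma_1^{1,1}:\ \Bigl(t_1,t_2,t_3,\tfrac{(n_2-1)^2}{4n_1^2}t_2^2t_3,\ \tfrac{n_2-1}{2n_1}t_2t_3,\ -1\Bigr),\qquad \Gamma_1^{1,2}:\ \Bigl(t_1,t_2,t_3,\tfrac{4n_1^2}{(n_2-1)^2}t_2^{-2}t_3,\ \tfrac{2n_1}{n_2-1}t_2^{-1}t_3,\ -1\Bigr)$$ if $(i,j)=(1,2)$, and $$\Gamma_1^{2,1}:\ \Bigl(t_1,t_2,t_3,t_3^{-1},\ \tfrac{n_1-1}{2n_2}t_1t_3,\ -1\Bigr),\qquad \Gamma_1^{2,2}:\ \Bigl(t_1,t_2,t_3,t_3^{-1},\ \tfrac{n_1-1}{2n_2}t_1t_3^{-1},\ -1\Bigr)$$ if $(i,j)=(2,1)$. (These metrics are positive definite on $\mathfrak m_1,\dots,\mathfrak m_5$ and negative definite on $\mathfrak m_6$.) -/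

import Mathlib

open scoped ContDiff Kronecker

noncomputable section

/-! ### Pseudo-Riemannian metrics on a vector space and their Ricci curvature -/

namespace PseudoRiemannian

variable {E : Type*} [NormedAddCommGroup E] [NormedSpace ℝ E]

/-- A smooth field of nondegenerate symmetric bilinear forms on `E`. -/
structure IsMetric (g : E → E →L[ℝ] E →L[ℝ] ℝ) : Prop where
  smooth : ContDiff ℝ ∞ g
  symm : ∀ x u v, g x u v = g x v u
  nondegenerate : ∀ x u, (∀ v, g x u v = 0) → u = 0

/-- `Γ` is the Levi-Civita connection `∇_u V = D_u V + Γ(u, V)` of `g`: it is torsion-free and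
compatible with `g`. (For a metric `g` there is exactly one such `Γ`.) -/
structure IsLeviCivita (g : E → E →L[ℝ] E →L[ℝ] ℝ) (Γ : E → E →L[ℝ] E →L[ℝ] E) : Prop where
  smooth : ContDiff ℝ ∞ Γ
  torsionFree : ∀ x u v, Γ x u v = Γ x v u
  compatible : ∀ x w u v, fderiv ℝ g x w u v = g x (Γ x w u) v + g x u (Γ x w v)

/-- For fixed `v`, `w`, the linear map `u ↦ R(u, v) w`, where
`R(u, v) w = (D_u Γ)(v, w) - (D_v Γ)(u, w) + Γ(u, Γ(v, w)) - Γ(v, Γ(u, w))`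
is the curvature of the connection `Γ`. -/
def curvature (Γ : E → E →L[ℝ] E →L[ℝ] E) (x v w : E) : E →L[ℝ] E :=
  ((fderiv ℝ Γ x).flip v).flip w - (fderiv ℝ Γ x v).flip w
    + (Γ x).flip (Γ x v w) - (Γ x v).comp ((Γ x).flip w)

/-- The Ricci tensor `Ric(v, w) = tr (u ↦ R(u, v) w)` of the connection `Γ`. -/
def ricci (Γ : E → E →L[ℝ] E →L[ℝ] E) (x v w : E) : ℝ :=
  LinearMap.trace ℝ E (curvature Γ x v w : E →ₗ[ℝ] E)

/-- The metric `g` is Ricci-flat. -/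
def IsRicciFlat (g : E → E →L[ℝ] E →L[ℝ] ℝ) : Prop :=
  ∃ Γ : E → E →L[ℝ] E →L[ℝ] E, IsLeviCivita g Γ ∧ ∀ x v w, ricci Γ x v w = 0

end PseudoRiemannian

/-! ### The flag manifold `SO(2(n₁+n₂+n₃)+1) / U(n₁) × U(n₂) × SO(2n₃+1)` -/

namespace Flag

/-- Coordinates of `ℝ^(2(n₁+n₂+n₃)+1) = ℂ^n₁ ⊕ ℂ^n₂ ⊕ ℝ^(2n₃+1)`. -/
abbrev Idx (n₁ n₂ n₃ : ℕ) : Type := (Fin n₁ × Fin 2) ⊕ (Fin n₂ × Fin 2) ⊕ Fin (2 * n₃ + 1)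

/-- The Lie algebra `𝔤 = 𝔰𝔬(2(n₁+n₂+n₃)+1)`. -/
abbrev 𝔤 (n₁ n₂ n₃ : ℕ) : Type := LieAlgebra.Orthogonal.so (Idx n₁ n₂ n₃) ℝ

/-- The element `(a i, b i, 0)` of the Lie algebra of the centre `U(1) × U(1)` of
`H = U(n₁) × U(n₂) × SO(2n₃+1)`. -/
def central (n₁ n₂ n₃ : ℕ) (a b : ℝ) : Matrix (Idx n₁ n₂ n₃) (Idx n₁ n₂ n₃) ℝ :=
  Matrix.fromBlocks (a • ((1 : Matrix (Fin n₁) (Fin n₁) ℝ) ⊗ₖ !![0, -1; 1, 0])) 0 0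
    (Matrix.fromBlocks (b • ((1 : Matrix (Fin n₂) (Fin n₂) ℝ) ⊗ₖ !![0, -1; 1, 0])) 0 0 0)

/-- `𝔥 = 𝔲(n₁) ⊕ 𝔲(n₂) ⊕ 𝔰𝔬(2n₃+1)`, the centralizer in `𝔤` of the centre of `H`. -/
def 𝔥 (n₁ n₂ n₃ : ℕ) : Submodule ℝ (𝔤 n₁ n₂ n₃) where
  carrier := {X | ∀ a b : ℝ, ⁅central n₁ n₂ n₃ a b, X.1⁆ = 0}
  add_mem' {X Y} hX hY a b := by
    have h1 := hX a b
    have h2 := hY a b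
    rw [Ring.lie_def] at *
    calc _ = (central n₁ n₂ n₃ a b * X.1 - X.1 * central n₁ n₂ n₃ a b) +
          (central n₁ n₂ n₃ a b * Y.1 - Y.1 * central n₁ n₂ n₃ a b) := by
            rw [show (X + Y).1 = X.1 + Y.1 from rfl]; noncomm_ring
      _ = 0 := by rw [h1, h2, add_zero]
  zero_mem' a b := by simp [Ring.lie_def]
  smul_mem' r X hX a b := by
    have h1 := hX a b
    rw [Ring.lie_def] at *
    simp only [SetLike.val_smul, Matrix.mul_smul, Matrix.smul_mul, ← smul_sub]
    rw [h1, smul_zero]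

/-- The positive T-roots (type `BC₂`) in the standard basis `ε₁, ε₂`:
`2ε₁, 2ε₂, ε₁ - ε₂, ε₁ + ε₂, ε₁, ε₂`. -/
def tRoot : Fin 6 → ℝ × ℝ := ![(2, 0), (0, 2), (1, -1), (1, 1), (1, 0), (0, 1)]

/-- The isotropy summand `𝔪_j`: the real subspace of `𝔤` on whose complexification the centre of
`H` acts with the characters `± ω_j`, i.e. on which `(ad Z)² = - ω_j(Z)²`. -/
def 𝔪 (n₁ n₂ n₃ : ℕ) (j : Fin 6) : Submodule ℝ (𝔤 n₁ n₂ n₃) where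
  carrier := {X | ∀ a b : ℝ, ⁅central n₁ n₂ n₃ a b, ⁅central n₁ n₂ n₃ a b, X.1⁆⁆ =
    -((tRoot j).1 * a + (tRoot j).2 * b) ^ 2 • X.1}
  add_mem' {X Y} hX hY a b := by
    have h1 := hX a b
    have h2 := hY a b
    simp only [Ring.lie_def] at *
    rw [show (X + Y).1 = X.1 + Y.1 from rfl, smul_add, ← h1, ← h2]
    noncomm_ring
  zero_mem' a b := by simp [Ring.lie_def]
  smul_mem' r X hX a b := by
    have h1 := hX a b
    simp only [Ring.lie_def] at *
    rw [SetLike.val_smul, smul_comm, ← h1]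
    simp only [Matrix.mul_smul, Matrix.smul_mul, ← smul_sub]

/-- The isotropy module `𝔪 = 𝔪₁ ⊕ ... ⊕ 𝔪₆`. -/
def 𝔪sum (n₁ n₂ n₃ : ℕ) : Submodule ℝ (𝔤 n₁ n₂ n₃) := ⨆ j, 𝔪 n₁ n₂ n₃ j

/-! ### The Newton polytope of the scalar curvature -/

/-- The de Siebenthal triples: `B(𝔪_i, [𝔪_j, 𝔪_k]) ≠ 0`. -/
def IsTriple (n₁ n₂ n₃ : ℕ) (i j k : Fin 6) : Prop :=
  ∃ X ∈ 𝔪 n₁ n₂ n₃ i, ∃ Y ∈ 𝔪 n₁ n₂ n₃ j, ∃ Z ∈ 𝔪 n₁ n₂ n₃ k,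
    killingForm ℝ (𝔤 n₁ n₂ n₃) X ⁅Y, Z⁆ ≠ 0

/-- The Newton polytope `Δ` of the scalar curvature `s(t)`: the convex hull of the exponents `-e_i`
of `1 / t_i` and `e_i - e_j - e_k` of `t_i / (t_j t_k)`, for all triples with
`B(𝔪_i, [𝔪_j, 𝔪_k]) ≠ 0`. -/
def newtonPolytope (n₁ n₂ n₃ : ℕ) : Set (Fin 6 → ℝ) :=
  convexHull ℝ
    ({x | ∃ i, x = -Pi.single i 1} ∪
      {x | ∃ i j k, IsTriple n₁ n₂ n₃ i j k ∧
        x = Pi.single i 1 - Pi.single j 1 - Pi.single k 1})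

/-- The face of `Δ` with normal vector `f`: the set of points where `f` is maximal on `Δ`. -/
def face (n₁ n₂ n₃ : ℕ) (f : Fin 6 → ℤ) : Set (Fin 6 → ℝ) :=
  {x ∈ newtonPolytope n₁ n₂ n₃ |
    ∀ y ∈ newtonPolytope n₁ n₂ n₃, ∑ i, (f i : ℝ) * y i ≤ ∑ i, (f i : ℝ) * x i}

/-- A set is a (nondegenerate, two-dimensional) parallelogram. -/
def IsParallelogram (P : Set (Fin 6 → ℝ)) : Prop :=
  ∃ v v₁ v₂ : Fin 6 → ℝ, LinearIndependent ℝ ![v₁, v₂] ∧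
    P = convexHull ℝ {v, v + v₁, v + v₂, v + v₁ + v₂}

/-! ### Inönü-Wigner contractions -/

/-- The filtration `F_a 𝔤 = 𝔥 ⊕ ⨁_{f(j) ≤ a} 𝔪_j` of `𝔤`, with `𝔥` placed in degree `0`. -/
def filtration (n₁ n₂ n₃ : ℕ) (f : Fin 6 → ℤ) (a : ℤ) : Submodule ℝ (𝔤 n₁ n₂ n₃) :=
  (⨆ _ : 0 ≤ a, 𝔥 n₁ n₂ n₃) ⊔ ⨆ j, ⨆ _ : f j ≤ a, 𝔪 n₁ n₂ n₃ j

/-- The graded piece of degree `a`, as the complement of `⋃_{b < a} F_b 𝔤` in `F_a 𝔤` which is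
spanned by `𝔥` (if `a = 0`) and the `𝔪_j` with `f(j) = a`. -/
def gradedPiece (n₁ n₂ n₃ : ℕ) (f : Fin 6 → ℤ) (a : ℤ) : Submodule ℝ (𝔤 n₁ n₂ n₃) :=
  (⨆ _ : a = 0, 𝔥 n₁ n₂ n₃) ⊔ ⨆ j, ⨆ _ : f j = a, 𝔪 n₁ n₂ n₃ j

/-- `β` is the bracket of the contraction `𝔤_Γ = ⨁_a F_a 𝔤 / ⋃_{b < a} F_b 𝔤`, the graded Lie
algebra associated with the filtration, after the identification of `𝔤_Γ` with
`𝔤 = 𝔥 ⊕ 𝔪₁ ⊕ ... ⊕ 𝔪₆` as a vector space: for `X`, `Y` of degrees `a`, `b`, the value `β X Y` is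
the representative in degree `a + b` of the class of `[X, Y]` modulo `F_{a+b-1} 𝔤`. Since the graded
pieces span `𝔤` and are independent, there is at most one such `β`. -/
def IsContractedBracket (n₁ n₂ n₃ : ℕ) (f : Fin 6 → ℤ)
    (β : 𝔤 n₁ n₂ n₃ →ₗ[ℝ] 𝔤 n₁ n₂ n₃ →ₗ[ℝ] 𝔤 n₁ n₂ n₃) : Prop :=
  ∀ a b : ℤ, ∀ X ∈ gradedPiece n₁ n₂ n₃ f a, ∀ Y ∈ gradedPiece n₁ n₂ n₃ f b,
    β X Y ∈ gradedPiece n₁ n₂ n₃ f (a + b) ∧ ⁅X, Y⁆ - β X Y ∈ filtration n₁ n₂ n₃ f (a + b - 1)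

variable {n₁ n₂ n₃ : ℕ}

/-- The exponential of the endomorphism `ad_Γ X = β X`; the series is cut off after `dim 𝔤` terms,
which changes nothing for nilpotent endomorphisms. -/
def expEnd (β : 𝔤 n₁ n₂ n₃ →ₗ[ℝ] 𝔤 n₁ n₂ n₃ →ₗ[ℝ] 𝔤 n₁ n₂ n₃) (X : 𝔤 n₁ n₂ n₃) :
    Module.End ℝ (𝔤 n₁ n₂ n₃) :=
  ∑ k ∈ Finset.range (Module.finrank ℝ (𝔤 n₁ n₂ n₃) + 1),
    ((k.factorial : ℝ)⁻¹ • (β X : Module.End ℝ (𝔤 n₁ n₂ n₃)) ^ k)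

open Classical in
/-- `exp (ad_Γ X)` as an element of `GL(𝔤_Γ)` (it is invertible whenever `ad_Γ X` is nilpotent). -/
def expAd (β : 𝔤 n₁ n₂ n₃ →ₗ[ℝ] 𝔤 n₁ n₂ n₃ →ₗ[ℝ] 𝔤 n₁ n₂ n₃) (X : 𝔤 n₁ n₂ n₃) :
    (Module.End ℝ (𝔤 n₁ n₂ n₃))ˣ :=
  if h : IsUnit (expEnd β X) then h.unit else 1

/-- The subgroup `H = U(n₁) × U(n₂) × SO(2n₃+1)` of `GL(𝔤_Γ)`: the elements of
`SO(2(n₁+n₂+n₃)+1)` which commute with the centre of `H`, acting by the adjoint representation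
(which is faithful). -/
def isotropy (n₁ n₂ n₃ : ℕ) : Subgroup (Module.End ℝ (𝔤 n₁ n₂ n₃))ˣ where
  carrier := {u | ∃ k ∈ Matrix.specialOrthogonalGroup (Idx n₁ n₂ n₃) ℝ,
    (∀ a b : ℝ, Commute k (central n₁ n₂ n₃ a b)) ∧
    ∀ X : 𝔤 n₁ n₂ n₃, (u.1 X).1 = k * X.1 * star k}
  mul_mem' := by
    rintro u v ⟨k, hk, hkc, hku⟩ ⟨l, hl, hlc, hlv⟩
    refine ⟨k * l, mul_mem hk hl, fun a b => (hkc a b).mul_left (hlc a b), fun X => ?_⟩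
    rw [Units.val_mul, Module.End.mul_apply, hku, hlv, star_mul]
    simp only [mul_assoc]
  one_mem' := ⟨1, one_mem _, fun a b => Commute.one_left _, fun X => by simp⟩
  inv_mem' := by
    rintro u ⟨k, hk, hkc, hku⟩
    have hk1 : star k * k = 1 :=
      (Matrix.mem_orthogonalGroup_iff' _ _).1 (Matrix.mem_specialOrthogonalGroup_iff.1 hk).1
    have hk2 : k * star k = 1 :=
      (Matrix.mem_orthogonalGroup_iff _ _).1 (Matrix.mem_specialOrthogonalGroup_iff.1 hk).1
    refine ⟨star k, ?_, fun a b => ?_, fun X => ?_⟩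
    · rw [Matrix.mem_specialOrthogonalGroup_iff] at hk ⊢
      refine ⟨Unitary.star_mem hk.1, ?_⟩
      rw [Matrix.star_eq_conjTranspose, Matrix.det_conjTranspose, hk.2, star_one]
    · have h := (hkc a b).eq
      calc star k * central n₁ n₂ n₃ a b
          = star k * (central n₁ n₂ n₃ a b * k) * star k := by
            rw [mul_assoc, mul_assoc, hk2, mul_one]
        _ = central n₁ n₂ n₃ a b * star k := by
            rw [← h, ← mul_assoc, hk1, one_mul]
    · have h := hku (u⁻¹.1 X)
      rw [← Module.End.mul_apply, ← Units.val_mul, mul_inv_cancel, Units.val_one,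
        Module.End.one_apply] at h
      rw [h, star_star]
      calc (u⁻¹.1 X).1 = (star k * k) * (u⁻¹.1 X).1 * (star k * k) := by rw [hk1]; simp
        _ = _ := by simp only [mul_assoc]

/-- The Lie group `G_Γ` with Lie algebra `𝔤_Γ`, in its adjoint representation on `𝔤_Γ` (the centre
of `𝔤_Γ` is zero): the subgroup of `GL(𝔤_Γ)` generated by `H` and by `exp (ad_Γ X)`, `X ∈ 𝔪`. -/
def contractedGroup (β : 𝔤 n₁ n₂ n₃ →ₗ[ℝ] 𝔤 n₁ n₂ n₃ →ₗ[ℝ] 𝔤 n₁ n₂ n₃) :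
    Subgroup (Module.End ℝ (𝔤 n₁ n₂ n₃))ˣ :=
  isotropy n₁ n₂ n₃ ⊔ Subgroup.closure (expAd β '' (𝔪sum n₁ n₂ n₃ : Set (𝔤 n₁ n₂ n₃)))

/-- The contraction `M_Γ = G_Γ / H`. -/
abbrev Contraction (β : 𝔤 n₁ n₂ n₃ →ₗ[ℝ] 𝔤 n₁ n₂ n₃ →ₗ[ℝ] 𝔤 n₁ n₂ n₃) : Type :=
  contractedGroup β ⧸ (isotropy n₁ n₂ n₃).subgroupOf (contractedGroup β)

/-- The element `exp X` of `G_Γ`, for `X ∈ 𝔪`. -/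
def expG (β : 𝔤 n₁ n₂ n₃ →ₗ[ℝ] 𝔤 n₁ n₂ n₃ →ₗ[ℝ] 𝔤 n₁ n₂ n₃) (X : 𝔪sum n₁ n₂ n₃) :
    contractedGroup β :=
  ⟨expAd β X, (le_sup_right : _ ≤ contractedGroup β)
    (Subgroup.subset_closure (Set.mem_image_of_mem _ X.2))⟩

/-- The Euclidean space of dimension `dim 𝔪 = dim M_Γ`. -/
abbrev Euc (n₁ n₂ n₃ : ℕ) : Type :=
  EuclideanSpace ℝ (Fin (Module.finrank ℝ (𝔪sum n₁ n₂ n₃)))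

/-- The exponential map `x ↦ exp (c x) H` from the Euclidean space to `M_Γ`, where `c` is a linear
isomorphism of the Euclidean space with `𝔪`. -/
def expMap (β : 𝔤 n₁ n₂ n₃ →ₗ[ℝ] 𝔤 n₁ n₂ n₃ →ₗ[ℝ] 𝔤 n₁ n₂ n₃)
    (c : Euc n₁ n₂ n₃ ≃ₗ[ℝ] 𝔪sum n₁ n₂ n₃) (x : Euc n₁ n₂ n₃) : Contraction β :=
  QuotientGroup.mk (expG β (c x))

/-- The action of `γ ∈ G_Γ` on `M_Γ`, read in the coordinates given by `expMap` (once this map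
is known to be bijective). -/
def translation (β : 𝔤 n₁ n₂ n₃ →ₗ[ℝ] 𝔤 n₁ n₂ n₃ →ₗ[ℝ] 𝔤 n₁ n₂ n₃)
    (c : Euc n₁ n₂ n₃ ≃ₗ[ℝ] 𝔪sum n₁ n₂ n₃) (γ : contractedGroup β) (x : Euc n₁ n₂ n₃) :
    Euc n₁ n₂ n₃ :=
  Function.invFun (expMap β c) (QuotientGroup.mk (γ * expG β (c x)))

/-- `expMap` is a diffeomorphism of the Euclidean space onto `M_Γ`: it is bijective, and in the
global coordinates which it gives, the action of `G_Γ` on `M_Γ` is smooth, jointly in the point and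
in the group element (near `γ`, modulo the compact group `H`, which acts linearly). The smooth
structure of a homogeneous space is the only one for which the transitive action is smooth. -/
structure IsGlobalChart (β : 𝔤 n₁ n₂ n₃ →ₗ[ℝ] 𝔤 n₁ n₂ n₃ →ₗ[ℝ] 𝔤 n₁ n₂ n₃)
    (c : Euc n₁ n₂ n₃ ≃ₗ[ℝ] 𝔪sum n₁ n₂ n₃) : Prop where
  bijective : Function.Bijective (expMap β c)
  smooth : ∀ γ : contractedGroup β,
    ContDiff ℝ ∞ (fun q : Euc n₁ n₂ n₃ × Euc n₁ n₂ n₃ => translation β c (γ * expG β (c q.1)) q.2)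
  linear : ∀ γ : contractedGroup β, γ.1 ∈ isotropy n₁ n₂ n₃ →
    ∀ x, (c (translation β c γ x) : 𝔤 n₁ n₂ n₃) = γ.1.1 (c x)

/-- `g` is the `G_Γ`-invariant metric on `M_Γ`, in the coordinates given by `expMap`, whose value at
the base point, on the tangent space `𝔪`, is `∑_i t_i (-B|𝔪_i)`, `B` being the Killing form
of `𝔤`. -/
structure IsInvariantMetric (β : 𝔤 n₁ n₂ n₃ →ₗ[ℝ] 𝔤 n₁ n₂ n₃ →ₗ[ℝ] 𝔤 n₁ n₂ n₃)
    (c : Euc n₁ n₂ n₃ ≃ₗ[ℝ] 𝔪sum n₁ n₂ n₃) (t : Fin 6 → ℝ)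
    (g : Euc n₁ n₂ n₃ → Euc n₁ n₂ n₃ →L[ℝ] Euc n₁ n₂ n₃ →L[ℝ] ℝ) : Prop where
  isMetric : PseudoRiemannian.IsMetric g
  invariant : ∀ (γ : contractedGroup β) (x u v : Euc n₁ n₂ n₃),
    g (translation β c γ x) (fderiv ℝ (translation β c γ) x u) (fderiv ℝ (translation β c γ) x v) =
      g x u v
  value : ∀ (i j : Fin 6) (u v : Euc n₁ n₂ n₃),
    (c u : 𝔤 n₁ n₂ n₃) ∈ 𝔪 n₁ n₂ n₃ i → (c v : 𝔤 n₁ n₂ n₃) ∈ 𝔪 n₁ n₂ n₃ j →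
      g 0 u v = if i = j then t i * -(killingForm ℝ (𝔤 n₁ n₂ n₃) (c u) (c v)) else 0

/-- The normal vector `f` defines a parallelogram face `Γ` of the Newton polytope, the contraction
`M_Γ` is diffeomorphic to a Euclidean space, and for every `t ∈ T` the tuple `t` defines an
invariant metric on `M_Γ`, which is Ricci-flat. -/
def ContractionIsRicciFlat (n₁ n₂ n₃ : ℕ) (f : Fin 6 → ℤ) (T : Set (Fin 6 → ℝ)) : Prop :=
  IsParallelogram (face n₁ n₂ n₃ f) ∧
  ∃ β : 𝔤 n₁ n₂ n₃ →ₗ[ℝ] 𝔤 n₁ n₂ n₃ →ₗ[ℝ] 𝔤 n₁ n₂ n₃,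
    IsContractedBracket n₁ n₂ n₃ f β ∧
    ∀ c : Euc n₁ n₂ n₃ ≃ₗ[ℝ] 𝔪sum n₁ n₂ n₃,
      IsGlobalChart β c ∧
      ∀ t ∈ T, ∃ g, IsInvariantMetric β c t g ∧ PseudoRiemannian.IsRicciFlat g

end Flag

end

/-! Summands are numbered 0,…,5 as in the code. For the form (4,2,2,4,3,1) the only brackets between
isotropy summands that survive in the contraction are [1,2]→3, [5,5]→1, [2,5]→4 and [4,5]→3. They
make 𝔪 a three-step nilpotent Lie algebra on which H acts by automorphisms. Hence every element of
G_Γ is exp(z)u with z in 𝔪 and u in H. Since exp(𝔪) meets H trivially (`eq_zero_of_expAd_mem`), M_Γ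
is the nilpotent group exp(𝔪), and exp is a global chart in which the action is polynomial
(`bijective_expMap`, `translation_eq`). The invariant metric becomes a left-invariant metric,
written explicitly through the Maurer-Cartan form (`maurerCartan_fderiv_bch`).

For a left-invariant metric on a three-step nilpotent group, Koszul's formula turns the Ricci tensor
into −1/4 times 2 tr(ad_c* ad_b) + tr(J_c J_b), where ad* is the metric adjoint and J_x y = ad_y* x
(`isRicciFlat_leftInvariantMetric`). Here this form is block diagonal. Its blocks are multiples of
the trace form, with coefficients given by the structure constants `tau`. These are traces of maps M
↦ A M B and M ↦ A Mᵀ B on matrices.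

Put a = t₃/(t₁t₂), b = t₁/t₅², c = t₄/(t₂t₅), d = t₃/(t₄t₅), the monomials at the vertices of the
face. The parallelogram is the relation ab = cd. The Ricci equations for the summands 1,…,5 are 2n₁a
= (2n₃+1)b, (n₂−1)a + (2n₃+1)c = 0, (n₂−1)a + (2n₃+1)d = 0, c = d, (n₂−1)b + n₁(c+d) = 0. With K =
(n₂−1)/(2n₁), the last two equations and ab = cd give c = d = −Kb and a = K²b. The first then says
2n₃+1 = 2n₁K², which is the numerical hypothesis, and the other two follow. Summand 0 occurs in no
bracket, so t₀ is free. `ricci_identity` checks the resulting identity.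

The three other faces need no new computation. Reversing the complex structure of the second complex
summand exchanges the T-roots ε₁−ε₂ and ε₁+ε₂, and exchanging the two complex summands exchanges ε₁
and ε₂. All arguments are therefore carried out for an abstract splitting `BlockData`, and
`IsAdapted` records the resulting permutation of the T-roots. The face itself is found from the fact
that f is at most 0 on all generators of Δ and vanishes exactly at the four exponents above. -/

noncomputable section

/-! ### Connections with constant coefficients in a coframe, and their curvature. -/

namespace PseudoRiemannian

variable {E : Type*} [NormedAddCommGroup E] [NormedSpace ℝ E]

/-- The pull-back of the bilinear form `B` by the coframe `θ`. -/
def coframeMetric (B : E →L[ℝ] E →L[ℝ] ℝ) (θ : E → E →L[ℝ] E) (x : E) : E →L[ℝ] E →L[ℝ] ℝ :=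
  B.bilinearComp (θ x) (θ x)

/-- The connection whose coefficients in the coframe `θ` are the constants `L`. -/
def coframeConnection (L : E →L[ℝ] E →L[ℝ] E) (θ θ' : E → E →L[ℝ] E) (x : E) :
    E →L[ℝ] E →L[ℝ] E :=
  (ContinuousLinearMap.compL ℝ E E E (θ' x)).comp (fderiv ℝ θ x + L.bilinearComp (θ x) (θ x))

lemma coframeConnection_apply (L : E →L[ℝ] E →L[ℝ] E) (θ θ' : E → E →L[ℝ] E) (x u v : E) :
    coframeConnection L θ θ' x u v = θ' x (fderiv ℝ θ x u v + L (θ x u) (θ x v)) := rfl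

lemma contDiff_bilinearComp {F : Type*} [NormedAddCommGroup F] [NormedSpace ℝ F]
    (B : E →L[ℝ] E →L[ℝ] F) {θ : E → E →L[ℝ] E} (hθ : ContDiff ℝ ∞ θ) :
    ContDiff ℝ ∞ fun x => B.bilinearComp (θ x) (θ x) := by
  have hf : ContDiff ℝ ∞ fun T : E →L[ℝ] E →L[ℝ] F => T.flip :=
    LinearIsometryEquiv.contDiff (𝕜 := ℝ) (E := E →L[ℝ] E →L[ℝ] F) (F := E →L[ℝ] E →L[ℝ] F)
      (ContinuousLinearMap.flipₗᵢ ℝ E E F)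
  have h1 : ContDiff ℝ ∞ fun x => (B.comp (θ x)).flip := hf.comp (contDiff_const.clm_comp hθ)
  exact hf.comp (h1.clm_comp hθ)

lemma isMetric_coframeMetric {B : E →L[ℝ] E →L[ℝ] ℝ} {θ θ' : E → E →L[ℝ] E}
    (hB : ∀ u v, B u v = B v u) (hB' : ∀ u, (∀ v, B u v = 0) → u = 0)
    (hθ : ContDiff ℝ ∞ θ) (h1 : ∀ x u, θ x (θ' x u) = u) (h2 : ∀ x u, θ' x (θ x u) = u) :
    IsMetric (coframeMetric B θ) where
  smooth := contDiff_bilinearComp B hθ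
  symm x u v := hB _ _
  nondegenerate x u h := by
    have : θ x u = 0 := hB' _ fun v => by
      have := h (θ' x v)
      rwa [coframeMetric, ContinuousLinearMap.bilinearComp_apply, h1] at this
    rw [← h2 x u, this, map_zero]

lemma contDiff_coframeConnection {L : E →L[ℝ] E →L[ℝ] E} {θ θ' : E → E →L[ℝ] E}
    (hθ : ContDiff ℝ ∞ θ) (hθ' : ContDiff ℝ ∞ θ') : ContDiff ℝ ∞ (coframeConnection L θ θ') := by
  have h1 : ContDiff ℝ ∞ (fderiv ℝ θ) := hθ.fderiv_right (by simp)
  exact ((ContinuousLinearMap.compL ℝ E E E).contDiff.comp hθ').clm_comp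
    (h1.add (contDiff_bilinearComp L hθ))

/-- In the coframe, covariant differentiation reads θ(∇_u V) = D_u(θ V) + L(θ u, θ V). The
antisymmetric part of L cancels dθ by `mc`, so there is no torsion; the metric is parallel because
every L w is skew for B. -/
lemma isLeviCivita_coframeConnection {B : E →L[ℝ] E →L[ℝ] ℝ} {L br : E →L[ℝ] E →L[ℝ] E}
    {θ θ' : E → E →L[ℝ] E}
    (hθ : ContDiff ℝ ∞ θ) (hθ' : ContDiff ℝ ∞ θ')
    (h1 : ∀ x u, θ x (θ' x u) = u)
    (mc : ∀ x u v, fderiv ℝ θ x u v - fderiv ℝ θ x v u = -br (θ x u) (θ x v))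
    (hL : ∀ u v, L u v - L v u = br u v)
    (hLB : ∀ w u v, B (L w u) v + B u (L w v) = 0) :
    IsLeviCivita (coframeMetric B θ) (coframeConnection L θ θ') where
  smooth := contDiff_coframeConnection hθ hθ'
  torsionFree x u v := by
    rw [coframeConnection_apply, coframeConnection_apply]
    congr 1
    have := mc x u v
    rw [← hL] at this
    rw [← sub_eq_zero]
    calc _ = (fderiv ℝ θ x u v - fderiv ℝ θ x v u) + (L (θ x u) (θ x v) - L (θ x v) (θ x u)) := by
          abel
      _ = 0 := by rw [this]; abel
  compatible x w u v := by
    have hd : DifferentiableAt ℝ θ x := (hθ.differentiable (by simp)) x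
    have hu : HasFDerivAt (fun y => θ y u) _ x := hd.hasFDerivAt.clm_apply (hasFDerivAt_const u x)
    have hv : HasFDerivAt (fun y => θ y v) _ x := hd.hasFDerivAt.clm_apply (hasFDerivAt_const v x)
    have hg : HasFDerivAt (fun y => coframeMetric B θ y u v) _ x :=
      (B.hasFDerivAt.comp x hu).clm_apply hv
    have hs : DifferentiableAt ℝ (coframeMetric B θ) x :=
      ((contDiff_bilinearComp B hθ).differentiable (by simp)) x
    have hg' : HasFDerivAt (fun y => coframeMetric B θ y u v) _ x :=
      (hs.hasFDerivAt.clm_apply (hasFDerivAt_const u x)).clm_apply (hasFDerivAt_const v x)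
    have := congrArg (fun T => T w) (hg'.unique hg)
    simp at this
    rw [this]
    simp only [coframeMetric, ContinuousLinearMap.bilinearComp_apply, coframeConnection_apply, h1,
      map_add, add_apply]
    linear_combination -hLB (θ x w) (θ x u) (θ x v)

/-- The curvature of a left-invariant connection with coefficients `L`, in the coframe. -/
def frameCurvature (L br : E →L[ℝ] E →L[ℝ] E) (b c : E) : E →ₗ[ℝ] E :=
  (L.flip (L b c) - (L b).comp (L.flip c) + (L.flip c).comp (br b) : E →L[ℝ] E)

/-- Differentiating θ(Γ(v, w)) = Dθ(v)w + L(θ v, θ w) gives θ∘DΓ without any derivative of θ'. After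
antisymmetrization the second derivatives of θ cancel, and the first derivatives combine through
`mc` into a term with `br`, so that the result has constant coefficients in the coframe. -/
lemma curvature_coframeConnection {L br : E →L[ℝ] E →L[ℝ] E} {θ θ' : E → E →L[ℝ] E}
    (hθ : ContDiff ℝ ∞ θ) (hθ' : ContDiff ℝ ∞ θ')
    (h1 : ∀ x u, θ x (θ' x u) = u) (h2 : ∀ x u, θ' x (θ x u) = u)
    (mc : ∀ x u v, fderiv ℝ θ x u v - fderiv ℝ θ x v u = -br (θ x u) (θ x v))
    (skew : ∀ u v, br u v = -br v u) (x v w u : E) :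
    curvature (coframeConnection L θ θ') x v w u =
      θ' x (frameCurvature L br (θ x v) (θ x w) (θ x u)) := by
  set Γ := coframeConnection L θ θ' with hΓ
  have key : ∀ u v w, θ x (fderiv ℝ Γ x u v w) = fderiv ℝ (fderiv ℝ θ) x u v w
      + L (fderiv ℝ θ x u v) (θ x w) + L (θ x v) (fderiv ℝ θ x u w)
      - fderiv ℝ θ x u (Γ x v w) := by
    intro u v w
    have hd : DifferentiableAt ℝ θ x := (hθ.differentiable (by simp)) x
    have hd1 : DifferentiableAt ℝ (fderiv ℝ θ) x :=
      ((hθ.fderiv_right (m := ∞) (by simp)).differentiable (by simp)) x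
    have hs : DifferentiableAt ℝ Γ x :=
      ((contDiff_coframeConnection hθ hθ').differentiable (by simp)) x
    have hv : HasFDerivAt (fun y => θ y v) _ x := hd.hasFDerivAt.clm_apply (hasFDerivAt_const v x)
    have hw : HasFDerivAt (fun y => θ y w) _ x := hd.hasFDerivAt.clm_apply (hasFDerivAt_const w x)
    have hL : HasFDerivAt (fun y => fderiv ℝ θ y v w + L (θ y v) (θ y w)) _ x :=
      ((hd1.hasFDerivAt.clm_apply (hasFDerivAt_const v x)).clm_apply (hasFDerivAt_const w x)).add
        ((L.hasFDerivAt.comp x hv).clm_apply hw)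
    have hR : HasFDerivAt (fun y => θ y (Γ y v w)) _ x :=
      hd.hasFDerivAt.clm_apply
        ((hs.hasFDerivAt.clm_apply (hasFDerivAt_const v x)).clm_apply (hasFDerivAt_const w x))
    have he : (fun y => θ y (Γ y v w)) = fun y => fderiv ℝ θ y v w + L (θ y v) (θ y w) := by
      funext y; rw [hΓ, coframeConnection_apply, h1]
    rw [he] at hR
    have := congrArg (fun T => T u) (hR.unique hL)
    simp at this
    rw [eq_sub_iff_add_eq, this]
    abel
  have hsymm : fderiv ℝ (fderiv ℝ θ) x u v w = fderiv ℝ (fderiv ℝ θ) x v u w := by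
    have : IsSymmSndFDerivAt ℝ θ x := hθ.contDiffAt.isSymmSndFDerivAt (by
      simp only [minSmoothness_of_isRCLikeNormedField]
      exact WithTop.coe_le_coe.2 (le_top : (2 : ℕ∞) ≤ ⊤))
    rw [this u v]
  have hG : ∀ u v w, θ x (Γ x u (Γ x v w)) = fderiv ℝ θ x u (Γ x v w)
      + L (θ x u) (fderiv ℝ θ x v w) + L (θ x u) (L (θ x v) (θ x w)) := by
    intro u v w
    rw [hΓ, coframeConnection_apply, h1, coframeConnection_apply, h1, map_add (L _), add_assoc]
  have hmc : L (fderiv ℝ θ x u v) (θ x w) - L (fderiv ℝ θ x v u) (θ x w)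
      = L (br (θ x v) (θ x u)) (θ x w) := by
    rw [← sub_apply, ← map_sub, mc, ← skew]
  rw [← h2 x (curvature Γ x v w u)]
  congr 1
  simp only [curvature, add_apply, sub_apply,
    ContinuousLinearMap.flip_apply, ContinuousLinearMap.comp_apply, map_add, map_sub, key, hG,
    frameCurvature, ContinuousLinearMap.coe_coe, hsymm]
  rw [← hmc]
  abel

/-- The curvature endomorphism at x is conjugate by θ x to a constant one, and traces are
conjugation invariant. Ricci-flatness is therefore a single algebraic condition. -/
theorem isRicciFlat_coframeMetric [FiniteDimensional ℝ E] {B : E →L[ℝ] E →L[ℝ] ℝ} {L br : E →L[ℝ] E →L[ℝ] E}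
    {θ θ' : E → E →L[ℝ] E}
    (hθ : ContDiff ℝ ∞ θ) (hθ' : ContDiff ℝ ∞ θ')
    (h1 : ∀ x u, θ x (θ' x u) = u) (h2 : ∀ x u, θ' x (θ x u) = u)
    (mc : ∀ x u v, fderiv ℝ θ x u v - fderiv ℝ θ x v u = -br (θ x u) (θ x v))
    (skew : ∀ u v, br u v = -br v u)
    (hL : ∀ u v, L u v - L v u = br u v)
    (hLB : ∀ w u v, B (L w u) v + B u (L w v) = 0)
    (hR : ∀ b c, LinearMap.trace ℝ E (frameCurvature L br b c) = 0) :
    IsRicciFlat (coframeMetric B θ) := by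
  refine ⟨_, isLeviCivita_coframeConnection hθ hθ' h1 mc hL hLB, fun x v w => ?_⟩
  have : (curvature (coframeConnection L θ θ') x v w : E →ₗ[ℝ] E) =
      (θ' x : E →ₗ[ℝ] E) ∘ₗ (frameCurvature L br (θ x v) (θ x w) ∘ₗ (θ x : E →ₗ[ℝ] E)) := by
    ext u
    exact curvature_coframeConnection hθ hθ' h1 h2 mc skew x v w u
  rw [ricci, this, LinearMap.trace_comp_comm', LinearMap.comp_assoc]
  have : (θ x : E →ₗ[ℝ] E) ∘ₗ (θ' x : E →ₗ[ℝ] E) = LinearMap.id := by ext u; exact h1 x u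
  rw [this, LinearMap.comp_id, hR]

end PseudoRiemannian
end

/-! ### Left-invariant metrics on three-step nilpotent groups. -/

noncomputable section

namespace PseudoRiemannian

section Trace

variable {V : Type*} [AddCommGroup V] [Module ℝ V] [FiniteDimensional ℝ V]

/-- The form B identifies V with its dual and carries T to the transpose of S, which has the same
trace as S. -/
lemma trace_eq_of_isAdjoint (B : V →ₗ[ℝ] V →ₗ[ℝ] ℝ) (hB : ∀ u, (∀ v, B u v = 0) → u = 0)
    (hs : ∀ u v, B u v = B v u) {S T : Module.End ℝ V} (h : ∀ x y, B (S x) y = B x (T y)) :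
    LinearMap.trace ℝ V S = LinearMap.trace ℝ V T := by
  have hinj : Function.Injective B := by
    rw [injective_iff_map_eq_zero]
    exact fun u hu => hB u fun v => by rw [hu, LinearMap.zero_apply]
  let e : V ≃ₗ[ℝ] Module.Dual ℝ V :=
    LinearEquiv.ofInjectiveOfFinrankEq B hinj Subspace.dual_finrank_eq.symm
  have he : ∀ u, e u = B u := fun _ => rfl
  have : Module.Dual.transpose (R := ℝ) S = e.conj T := by
    refine LinearMap.ext fun φ => ?_
    obtain ⟨y, rfl⟩ := e.surjective φ
    refine LinearMap.ext fun x => ?_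
    rw [LinearEquiv.conj_apply_apply, e.symm_apply_apply, he, he, Module.Dual.transpose_apply,
      LinearMap.comp_apply, hs y, h, hs]
  rw [← LinearMap.trace_transpose' S, this, LinearMap.trace_conj']

lemma trace_eq_neg_of_isAdjoint (B : V →ₗ[ℝ] V →ₗ[ℝ] ℝ) (hB : ∀ u, (∀ v, B u v = 0) → u = 0)
    (hs : ∀ u v, B u v = B v u) {S T : Module.End ℝ V} (h : ∀ x y, B (S x) y = -B x (T y)) :
    LinearMap.trace ℝ V S = -LinearMap.trace ℝ V T := by
  rw [← map_neg]
  exact trace_eq_of_isAdjoint B hB hs fun x y => by rw [h, LinearMap.neg_apply, map_neg]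

/-- The Ricci form of a nilpotent metric Lie algebra: `A x` is `ad x`, `S x` is the adjoint of `ad x`,
and `J x y = S y x`. -/
lemma trace_ricci_nilpotent (B : V →ₗ[ℝ] V →ₗ[ℝ] ℝ) (hB : ∀ u, (∀ v, B u v = 0) → u = 0)
    (hs : ∀ u v, B u v = B v u) (A S J : V →ₗ[ℝ] Module.End ℝ V)
    (hS : ∀ x y z, B (S x y) z = B y (A x z)) (hJ : ∀ x y, J x y = S y x)
    (skew : ∀ x y, A x y = -A y x) (nil : ∀ w x y z, A w (A x (A y z)) = 0) (b c : V) :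
    LinearMap.trace ℝ V ((A c + S c + J c) * (A b + S b + J b)) =
      2 * LinearMap.trace ℝ V (S c * A b) + LinearMap.trace ℝ V (J c * J b) := by
  have hJ' : ∀ x y z, B (J x y) z = -B y (J x z) := fun x y z => by
    rw [hJ, hJ, hS, hs y, hS, skew z y, map_neg, neg_neg]
  -- Of the nine products, A A is nilpotent by `nil` and S S is adjoint to such a product; A S has
  -- the same trace as S A; and as J is skew for B, the traces of J A and J S cancel, as do those of
  -- A J and S J.
  have e1 : LinearMap.trace ℝ V (A c * A b) = 0 :=
    (LinearMap.isNilpotent_trace_of_isNilpotent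
      ⟨2, LinearMap.ext fun z => by simp [pow_two, nil]⟩).eq_zero
  have e2 : LinearMap.trace ℝ V (S c * S b) = 0 := by
    rw [trace_eq_of_isAdjoint B hB hs (T := A b * A c) fun x y => by
      rw [Module.End.mul_apply, Module.End.mul_apply, hS, hS], LinearMap.trace_mul_comm, e1]
  have e3 : LinearMap.trace ℝ V (A c * S b) = LinearMap.trace ℝ V (S c * A b) := by
    rw [trace_eq_of_isAdjoint B hB hs (T := A b * S c) fun x y => by
      rw [Module.End.mul_apply, Module.End.mul_apply, hs, ← hS, hs, hS], LinearMap.trace_mul_comm]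
  have e4 : LinearMap.trace ℝ V (J c * A b) = -LinearMap.trace ℝ V (J c * S b) := by
    rw [trace_eq_neg_of_isAdjoint B hB hs (T := S b * J c) fun x y => by
      rw [Module.End.mul_apply, Module.End.mul_apply, hJ', hs, ← hS, hs], LinearMap.trace_mul_comm]
  have e5 : LinearMap.trace ℝ V (A c * J b) = -LinearMap.trace ℝ V (S c * J b) := by
    rw [trace_eq_neg_of_isAdjoint B hB hs (T := J b * S c) fun x y => by
      rw [Module.End.mul_apply, Module.End.mul_apply, hs, ← hS, hs, hJ'],
      LinearMap.trace_mul_comm ℝ (J b)]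
  simp only [add_mul, mul_add, map_add, e1, e2, e3, e4, e5]
  ring

end Trace

variable {E : Type*} [NormedAddCommGroup E] [NormedSpace ℝ E]

/-- The left-invariant Maurer-Cartan form of a three-step nilpotent Lie group, in exponential
coordinates. -/
def maurerCartan (br : E →L[ℝ] E →L[ℝ] E) (x : E) : E →L[ℝ] E :=
  ContinuousLinearMap.id ℝ E - (1 / 2 : ℝ) • br x + (1 / 6 : ℝ) • (br x).comp (br x)

/-- The inverse of `maurerCartan`. -/
def maurerCartanInv (br : E →L[ℝ] E →L[ℝ] E) (x : E) : E →L[ℝ] E :=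
  ContinuousLinearMap.id ℝ E + (1 / 2 : ℝ) • br x + (1 / 12 : ℝ) • (br x).comp (br x)

variable (br : E →L[ℝ] E →L[ℝ] E)

lemma maurerCartan_apply (x u : E) :
    maurerCartan br x u = u - (1 / 2 : ℝ) • br x u + (1 / 6 : ℝ) • br x (br x u) := rfl

lemma maurerCartanInv_apply (x u : E) :
    maurerCartanInv br x u = u + (1 / 2 : ℝ) • br x u + (1 / 12 : ℝ) • br x (br x u) := rfl

lemma contDiff_maurerCartan : ContDiff ℝ ∞ (maurerCartan br) :=
  (contDiff_const.sub (br.contDiff.const_smul _)).add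
    ((br.contDiff.clm_comp br.contDiff).const_smul _)

lemma contDiff_maurerCartanInv : ContDiff ℝ ∞ (maurerCartanInv br) :=
  (contDiff_const.add (br.contDiff.const_smul _)).add
    ((br.contDiff.clm_comp br.contDiff).const_smul _)

variable {br}

/-- The two maps are the truncations of (1 − e^(−ad x))/ad x and of its inverse 1 + (ad x)/2 + (ad
x)²/12 − …, and (ad x)³ = 0. -/
lemma maurerCartan_inv (nil : ∀ w x y z, br w (br x (br y z)) = 0) (x u : E) :
    maurerCartan br x (maurerCartanInv br x u) = u := by
  simp only [maurerCartan_apply, maurerCartanInv_apply, map_add, map_smul, nil, map_zero]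
  module

lemma maurerCartanInv_maurerCartan (nil : ∀ w x y z, br w (br x (br y z)) = 0) (x u : E) :
    maurerCartanInv br x (maurerCartan br x u) = u := by
  simp only [maurerCartan_apply, maurerCartanInv_apply, map_add, map_sub, map_smul, nil, map_zero]
  module

lemma fderiv_maurerCartan (x u v : E) : fderiv ℝ (maurerCartan br) x u v =
    (1 / 6 : ℝ) • (br u (br x v) + br x (br u v)) - (1 / 2 : ℝ) • br u v := by
  have hd : HasFDerivAt (maurerCartan br) (fderiv ℝ (maurerCartan br) x) x :=
    (((contDiff_maurerCartan br).differentiable (by simp)) x).hasFDerivAt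
  have h1 : HasFDerivAt (fun y => maurerCartan br y v) _ x :=
    hd.clm_apply (hasFDerivAt_const v x)
  have hb : HasFDerivAt (fun y => br y v) _ x := br.hasFDerivAt.clm_apply (hasFDerivAt_const v x)
  have h2 : HasFDerivAt (fun y => maurerCartan br y v) _ x :=
    ((hasFDerivAt_const v x).sub (hb.const_smul (1 / 2 : ℝ))).add
      ((br.hasFDerivAt.clm_apply hb).const_smul (1 / 6 : ℝ))
  have := congrArg (fun T => T u) (h1.unique h2)
  simp at this
  rw [this]
  module

/-- Only terms with at most two brackets survive, by `nil` and its consequences `n1`, `n2`; these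
match by the Jacobi identity. -/
lemma maurerCartan_equation (skew : ∀ u v, br u v = -br v u)
    (jacobi : ∀ x y z, br (br x y) z = br x (br y z) - br y (br x z))
    (nil : ∀ w x y z, br w (br x (br y z)) = 0) (x u v : E) :
    fderiv ℝ (maurerCartan br) x u v - fderiv ℝ (maurerCartan br) x v u =
      -br (maurerCartan br x u) (maurerCartan br x v) := by
  have n1 : ∀ a b c d, br (br a b) (br c d) = 0 := fun a b c d => by
    rw [jacobi, nil, nil, sub_zero]
  have n2 : ∀ a b c d, br (br a (br b c)) d = 0 := fun a b c d => by
    rw [skew, nil, neg_zero]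
  simp only [fderiv_maurerCartan, maurerCartan_apply, map_add, map_sub, map_smul, add_apply,
    sub_apply, smul_apply, nil, n1, n2, jacobi, smul_zero, sub_zero, add_zero]
  rw [skew v u, map_neg, skew v (br x u), jacobi]
  have := jacobi u x v
  module

/-- The left-invariant metric on a three-step nilpotent Lie group, in exponential coordinates. -/
def leftInvariantMetric (B : E →L[ℝ] E →L[ℝ] ℝ) (br : E →L[ℝ] E →L[ℝ] E) :
    E → E →L[ℝ] E →L[ℝ] ℝ :=
  coframeMetric B (maurerCartan br)

lemma leftInvariantMetric_apply (B : E →L[ℝ] E →L[ℝ] ℝ) (x u v : E) :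
    leftInvariantMetric B br x u v = B (maurerCartan br x u) (maurerCartan br x v) := rfl

theorem isMetric_leftInvariantMetric {B : E →L[ℝ] E →L[ℝ] ℝ} (hs : ∀ u v, B u v = B v u)
    (hB : ∀ u, (∀ v, B u v = 0) → u = 0) (nil : ∀ w x y z, br w (br x (br y z)) = 0) :
    IsMetric (leftInvariantMetric B br) :=
  isMetric_coframeMetric hs hB (contDiff_maurerCartan br) (maurerCartan_inv nil)
    (maurerCartanInv_maurerCartan nil)

theorem isRicciFlat_leftInvariantMetric [FiniteDimensional ℝ E] {B : E →L[ℝ] E →L[ℝ] ℝ}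
    (hs : ∀ u v, B u v = B v u)
    (hB : ∀ u, (∀ v, B u v = 0) → u = 0) (skew : ∀ u v, br u v = -br v u)
    (jacobi : ∀ x y z, br (br x y) z = br x (br y z) - br y (br x z))
    (nil : ∀ w x y z, br w (br x (br y z)) = 0)
    (S : E →L[ℝ] E →L[ℝ] E) (hS : ∀ x y z, B (S x y) z = B y (br x z))
    (ric : ∀ b c : E, 2 * LinearMap.trace ℝ E ((S c).toLinearMap * (br b).toLinearMap) +
      LinearMap.trace ℝ E ((S.flip c).toLinearMap * (S.flip b).toLinearMap) = 0) :
    IsRicciFlat (leftInvariantMetric B br) := by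
  -- Koszul's formula for left-invariant fields, with S x the adjoint of ad x.
  set L : E →L[ℝ] E →L[ℝ] E := (1 / 2 : ℝ) • (br - S - S.flip) with hLdef
  have hL : ∀ u v, L u v = (1 / 2 : ℝ) • (br u v - S u v - S v u) := fun _ _ => rfl
  refine isRicciFlat_coframeMetric (L := L) (contDiff_maurerCartan br)
    (contDiff_maurerCartanInv br) (maurerCartan_inv nil) (maurerCartanInv_maurerCartan nil)
    (maurerCartan_equation skew jacobi nil) skew ?_ ?_ ?_
  · intro u v
    rw [hL, hL, skew v u]
    module
  · intro w u v
    have e : ∀ w u v, B (L w u) v = (1 / 2) * (B (br w u) v - B u (br w v) - B w (br u v)) := by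
      intro w u v
      simp only [hL, map_smul, map_sub, smul_apply, sub_apply, hS, smul_eq_mul]
    rw [hs u, e, e, hs (br w u), hs (br w v), skew v u, map_neg]
    ring
  · intro b c
    let toEnd : (E →L[ℝ] E) →ₗ[ℝ] Module.End ℝ E := ContinuousLinearMap.coeLM ℝ
    let A : E →ₗ[ℝ] Module.End ℝ E := toEnd ∘ₗ br.toLinearMap
    let S' : E →ₗ[ℝ] Module.End ℝ E := toEnd ∘ₗ S.toLinearMap
    let J : E →ₗ[ℝ] Module.End ℝ E := toEnd ∘ₗ S.flip.toLinearMap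
    let B' : E →ₗ[ℝ] E →ₗ[ℝ] ℝ := (ContinuousLinearMap.coeLM ℝ) ∘ₗ B.toLinearMap
    have hJ' : ∀ x y z, B' (J x y) z = -B' y (J x z) := fun x y z => by
      change B (S y x) z = -B y (S z x)
      rw [hS, hs y, hS, skew z y, map_neg, neg_neg]
    have hP : ∀ z, ((L.flip z : E →L[ℝ] E) : E →ₗ[ℝ] E) = -(1 / 2 : ℝ) • (A z + S' z + J z) := by
      intro z
      ext a
      change L a z = -(1 / 2 : ℝ) • (br z a + S z a + S a z)
      rw [hL, skew a z]
      module
    have hLb : ((L b : E →L[ℝ] E) : E →ₗ[ℝ] E) = (1 / 2 : ℝ) • (A b - S' b - J b) := rfl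
    -- Unimodularity: ad z is nilpotent, S z is its adjoint and J z is skew. The term of the Ricci
    -- tensor linear in L b c therefore vanishes.
    have tP : ∀ z, LinearMap.trace ℝ E (A z + S' z + J z) = 0 := by
      intro z
      have hA : LinearMap.trace ℝ E (A z) = 0 :=
        (LinearMap.isNilpotent_trace_of_isNilpotent
          ⟨3, LinearMap.ext fun y => nil z z z y⟩).eq_zero
      have hS' : LinearMap.trace ℝ E (S' z) = 0 :=
        (trace_eq_of_isAdjoint B' hB hs fun x y => hS z x y).trans hA
      have hJ0 : LinearMap.trace ℝ E (J z) = 0 := by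
        have := trace_eq_neg_of_isAdjoint B' hB hs fun x y => hJ' z x y
        linarith
      rw [map_add, map_add, hA, hS', hJ0]
      norm_num
    have e : frameCurvature L br b c = -(1 / 2 : ℝ) • (A (L b c) + S' (L b c) + J (L b c))
        - ((1 / 2 : ℝ) • (A b - S' b - J b)) * (-(1 / 2 : ℝ) • (A c + S' c + J c))
        + (-(1 / 2 : ℝ) • (A c + S' c + J c)) * A b := by
      rw [← hP, ← hP, ← hLb]
      rfl
    rw [e, map_add, map_sub, LinearMap.trace_mul_comm, ← sub_eq_zero.2 (tP (L b c)).symm]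
    -- ad b is L b plus half of A b + S b + J b. The first part cancels the remaining curvature term
    -- up to a cyclic permutation, the second leaves −1/4 times the trace of
    -- `trace_ricci_nilpotent`.
    have e2 : (-(1 / 2 : ℝ) • (A c + S' c + J c)) * A b =
        (-(1 / 2 : ℝ) • (A c + S' c + J c)) * ((1 / 2 : ℝ) • (A b - S' b - J b)) -
        (1 / 4 : ℝ) • ((A c + S' c + J c) * (A b + S' b + J b)) := by
      have : A b = (1 / 2 : ℝ) • (A b - S' b - J b) + (1 / 2 : ℝ) • (A b + S' b + J b) := by module
      nth_rewrite 1 [this]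
      rw [mul_add, smul_mul_smul_comm _ _ (1 / 2 : ℝ) (A b + S' b + J b)]
      module
    rw [e2, map_sub, map_smul, map_smul, tP,
      trace_ricci_nilpotent B' hB hs A S' J hS (fun _ _ => rfl) skew nil b c]
    have := ric b c
    change 2 * LinearMap.trace ℝ E (S' c * A b) + LinearMap.trace ℝ E (J c * J b) = 0 at this
    rw [this]
    simp

end PseudoRiemannian
end

/-! ### The exponential and the group law of a three-step nilpotent group. -/

noncomputable section

namespace NilpotentExp

section Algebra

variable {R : Type*} [Ring R] [Algebra ℝ R]

/-- The exponential of an element whose fourth power vanishes. -/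
def exp3 (a : R) : R := 1 + a + (1 / 2 : ℝ) • (a * a) + (1 / 6 : ℝ) • (a * (a * a))

/-- The Baker-Campbell-Hausdorff series in class three. -/
def bchRing (a b : R) : R :=
  a + b + (1 / 2 : ℝ) • (a * b - b * a)
    + (1 / 12 : ℝ) • (a * (a * b - b * a) - (a * b - b * a) * a)
    - (1 / 12 : ℝ) • (b * (a * b - b * a) - (a * b - b * a) * b)

lemma exp3_mul_exp3 {a b : R}
    (h : ∀ w x y z : R, (w = a ∨ w = b) → (x = a ∨ x = b) → (y = a ∨ y = b) → (z = a ∨ z = b) →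
      w * (x * (y * z)) = 0) : exp3 a * exp3 b = exp3 (bchRing a b) := by
  -- c₁, c₂, c₃ are homogeneous of degrees 1, 2, 3 in a and b. Products of total degree at least 4
  -- vanish, so the square and the cube of the sum keep only a few terms.
  obtain ⟨c₁, h₁⟩ : ∃ c, c = a + b := ⟨_, rfl⟩
  obtain ⟨c₂, h₂⟩ : ∃ c, c = (1 / 2 : ℝ) • (a * b - b * a) := ⟨_, rfl⟩
  obtain ⟨c₃, h₃⟩ : ∃ c, c = (1 / 12 : ℝ) • (a * (a * b - b * a) - (a * b - b * a) * a)
    - (1 / 12 : ℝ) • (b * (a * b - b * a) - (a * b - b * a) * b) := ⟨_, rfl⟩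
  have hc : bchRing a b = c₁ + c₂ + c₃ := by rw [bchRing, h₁, h₂, h₃]; abel
  have z13 : c₁ * c₃ = 0 := by
    rw [h₁, h₃]
    simp [add_mul, mul_sub, sub_mul, mul_assoc, h]
  have z31 : c₃ * c₁ = 0 := by
    rw [h₁, h₃]
    simp [mul_add, mul_sub, sub_mul, mul_assoc, h]
  have z22 : c₂ * c₂ = 0 := by
    rw [h₂]
    simp [mul_sub, sub_mul, mul_assoc, h]
  have z23 : c₂ * c₃ = 0 := by
    rw [h₂, h₃]
    simp [mul_sub, sub_mul, mul_assoc, h]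
  have z32 : c₃ * c₂ = 0 := by
    rw [h₂, h₃]
    simp [mul_sub, sub_mul, mul_assoc, h]
  have z33 : c₃ * c₃ = 0 := by
    rw [h₃]
    simp [mul_sub, sub_mul, mul_assoc, h]
  have z112 : c₁ * (c₁ * c₂) = 0 := by
    rw [h₁, h₂]
    simp [mul_add, add_mul, mul_sub, h]
  have z121 : c₁ * (c₂ * c₁) = 0 := by
    rw [h₁, h₂]
    simp [mul_add, add_mul, mul_sub, sub_mul, mul_assoc, h]
  have z211 : c₂ * (c₁ * c₁) = 0 := by
    rw [h₁, h₂]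
    simp [mul_add, add_mul, sub_mul, mul_assoc, h]
  have z212 : c₂ * (c₁ * c₂) = 0 := by
    rw [h₁, h₂]
    simp [mul_add, add_mul, mul_sub, sub_mul, mul_assoc, h]
  have z221 : c₂ * (c₂ * c₁) = 0 := by rw [← mul_assoc, z22, zero_mul]
  have z321 : c₃ * (c₂ * c₁) = 0 := by rw [← mul_assoc, z32, zero_mul]
  have z312 : c₃ * (c₁ * c₂) = 0 := by rw [← mul_assoc, z31, zero_mul]
  have z311 : c₃ * (c₁ * c₁) = 0 := by rw [← mul_assoc, z31, zero_mul]
  have hsq : bchRing a b * bchRing a b = c₁ * c₁ + c₁ * c₂ + c₂ * c₁ := by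
    rw [hc]
    simp only [mul_add, add_mul, z13, z31, z22, z23, z32, z33, add_zero]
    abel
  have hcube : bchRing a b * (bchRing a b * bchRing a b) = c₁ * (c₁ * c₁) := by
    rw [hsq, hc]
    simp only [mul_add, add_mul, z112, z121, z211, z212, z221, z321, z312, z311, add_zero]
  rw [exp3, exp3, exp3, hcube, hsq, hc, h₃, h₂, h₁]
  simp only [mul_add, add_mul, mul_sub, sub_mul, smul_mul_assoc, mul_smul_comm, smul_add, smul_sub,
    mul_assoc, one_mul, mul_one]
  simp only [h, true_or, or_true, mul_zero, smul_zero]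
  module

/-- The truncated logarithm inverts the truncated exponential; this yields injectivity of `exp3` on
elements with vanishing fourth power. -/
lemma log3_exp3 {a : R} (h : a * (a * (a * a)) = 0) :
    (exp3 a - 1) - (1 / 2 : ℝ) • ((exp3 a - 1) * (exp3 a - 1)) +
      (1 / 3 : ℝ) • ((exp3 a - 1) * ((exp3 a - 1) * (exp3 a - 1))) = a := by
  have e : exp3 a - 1 = a + (1 / 2 : ℝ) • (a * a) + (1 / 6 : ℝ) • (a * (a * a)) := by
    rw [exp3]; abel
  have e2 : (exp3 a - 1) * (exp3 a - 1) = a * a + a * (a * a) := by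
    rw [e]
    simp only [mul_add, add_mul, smul_mul_assoc, mul_smul_comm, smul_add, mul_assoc, h, mul_zero,
      smul_zero]
    module
  have e3 : (exp3 a - 1) * ((exp3 a - 1) * (exp3 a - 1)) = a * (a * a) := by
    rw [e2, e]
    simp only [mul_add, add_mul, smul_mul_assoc, mul_assoc, h, mul_zero, smul_zero]
    module
  rw [e3, e2, e]
  module

lemma exp3_injective {a b : R} (ha : a * (a * (a * a)) = 0) (hb : b * (b * (b * b)) = 0)
    (h : exp3 a = exp3 b) : a = b := by
  rw [← log3_exp3 ha, ← log3_exp3 hb, h]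

lemma exp3_zero : exp3 (0 : R) = 1 := by simp [exp3]

lemma bchRing_neg_self (a : R) : bchRing (-a) a = 0 := by
  simp [bchRing]

lemma exp3_neg_mul_exp3 {a : R} (h : a * (a * (a * a)) = 0) : exp3 (-a) * exp3 a = 1 := by
  rw [exp3_mul_exp3, bchRing_neg_self, exp3_zero]
  rintro w x y z (rfl | rfl) (rfl | rfl) (rfl | rfl) (rfl | rfl) <;> simp [h]

end Algebra

variable {E : Type*} [NormedAddCommGroup E] [NormedSpace ℝ E]

/-- The multiplication of a three-step nilpotent Lie group in exponential coordinates. -/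
def bch (br : E →L[ℝ] E →L[ℝ] E) (x y : E) : E :=
  x + y + (1 / 2 : ℝ) • br x y + (1 / 12 : ℝ) • br x (br x y) - (1 / 12 : ℝ) • br y (br x y)

variable {br : E →L[ℝ] E →L[ℝ] E}

lemma contDiff_bch {F : Type*} [NormedAddCommGroup F] [NormedSpace ℝ F] {f g : F → E}
    (hf : ContDiff ℝ ∞ f) (hg : ContDiff ℝ ∞ g) : ContDiff ℝ ∞ fun q => bch br (f q) (g q) := by
  have h {f g : F → E} (hf : ContDiff ℝ ∞ f) (hg : ContDiff ℝ ∞ g) :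
      ContDiff ℝ ∞ fun q => br (f q) (g q) := (br.contDiff.comp hf).clm_apply hg
  exact ((((hf.add hg).add ((h hf hg).const_smul _)).add
    ((h hf (h hf hg)).const_smul _))).sub ((h hg (h hf hg)).const_smul _)

/-- This identifies the explicit polynomial form with the Maurer-Cartan form: at x it is the
differential of left translation by the inverse of exp x. -/
lemma fderiv_bch_neg_self (skew : ∀ u v, br u v = -br v u) (x u : E) :
    fderiv ℝ (fun y => bch br (-x) y) x u = PseudoRiemannian.maurerCartan br x u := by
  have hxx : br x x = 0 := by
    have h := skew x x
    rw [eq_neg_iff_add_eq_zero, ← two_smul ℝ] at h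
    simpa using h
  have hb : HasFDerivAt (fun y => br (-x) y) (br (-x)) x := (br (-x)).hasFDerivAt
  have h : HasFDerivAt (fun y => bch br (-x) y) _ x :=
    (((((hasFDerivAt_const (-x) x).add (hasFDerivAt_id x)).add (hb.const_smul (1 / 2 : ℝ))).add
      (((br (-x)).hasFDerivAt.comp x hb).const_smul (1 / 12 : ℝ)))).sub
      ((br.hasFDerivAt.clm_apply hb).const_smul (1 / 12 : ℝ))
  rw [h.fderiv, PseudoRiemannian.maurerCartan_apply]
  simp [hxx]
  module

section Representation

variable {R : Type*} [Ring R] [Algebra ℝ R] {ρ : E →ₗ[ℝ] R}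

lemma map_bch (hρ : ∀ x y, ρ (br x y) = ρ x * ρ y - ρ y * ρ x) (x y : E) :
    ρ (bch br x y) = bchRing (ρ x) (ρ y) := by
  simp only [bch, bchRing, map_add, map_sub, map_smul, hρ]

lemma exp3_bch (hρ : ∀ x y, ρ (br x y) = ρ x * ρ y - ρ y * ρ x)
    (nil : ∀ w x y z, ρ w * (ρ x * (ρ y * ρ z)) = 0) (x y : E) :
    exp3 (ρ (bch br x y)) = exp3 (ρ x) * exp3 (ρ y) := by
  rw [map_bch hρ, exp3_mul_exp3]
  rintro w x y z (rfl | rfl) (rfl | rfl) (rfl | rfl) (rfl | rfl) <;> exact nil _ _ _ _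

/-- The cancellation (zx)⁻¹(zy) = x⁻¹y is checked in a faithful nilpotent representation, where the
group law is multiplication of exponentials. This avoids proving associativity of the polynomial
`bch` directly. -/
lemma bch_neg_bch (hi : Function.Injective ρ) (hρ : ∀ x y, ρ (br x y) = ρ x * ρ y - ρ y * ρ x)
    (nil : ∀ w x y z, ρ w * (ρ x * (ρ y * ρ z)) = 0) (z x y : E) :
    bch br (-bch br z x) (bch br z y) = bch br (-x) y := by
  refine hi (exp3_injective (nil _ _ _ _) (nil _ _ _ _) ?_)
  rw [exp3_bch hρ nil, exp3_bch hρ nil, exp3_bch hρ nil, map_neg, map_neg, ← mul_assoc]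
  congr 1
  have h (x : E) : exp3 (-ρ x) * exp3 (ρ x) = 1 := exp3_neg_mul_exp3 (nil _ _ _ _)
  have h' (x : E) : exp3 (ρ x) * exp3 (-ρ x) = 1 := by simpa using h (-x)
  calc exp3 (-ρ (bch br z x)) * exp3 (ρ z)
      = exp3 (-ρ (bch br z x)) * (exp3 (ρ z) * exp3 (ρ x)) * exp3 (-ρ x) := by
        rw [mul_assoc, mul_assoc (exp3 (ρ z)), h', mul_one]
    _ = exp3 (-ρ x) := by rw [← exp3_bch hρ nil, h, one_mul]

/-- Left invariance of the Maurer-Cartan form: the chain rule applied to (zx)⁻¹(zy) = x⁻¹y at y = x.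
-/
theorem maurerCartan_fderiv_bch (skew : ∀ u v, br u v = -br v u)
    (hi : Function.Injective ρ) (hρ : ∀ x y, ρ (br x y) = ρ x * ρ y - ρ y * ρ x)
    (nil : ∀ w x y z, ρ w * (ρ x * (ρ y * ρ z)) = 0) (z x u : E) :
    PseudoRiemannian.maurerCartan br (bch br z x) (fderiv ℝ (bch br z) x u) =
      PseudoRiemannian.maurerCartan br x u := by
  have hd (z x : E) : DifferentiableAt ℝ (fun y => bch br z y) x :=
    (contDiff_bch contDiff_const contDiff_id).differentiable (by simp) x
  have h := fderiv_comp x (hd (-bch br z x) (bch br z x)) (hd z x)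
  rw [← fderiv_bch_neg_self skew, ← fderiv_bch_neg_self skew]
  have e : (fun y => bch br (-bch br z x) y) ∘ (fun y => bch br z y) = fun y => bch br (-x) y := by
    funext y
    exact bch_neg_bch hi hρ nil z x y
  rw [e] at h
  rw [h]
  rfl

end Representation

end NilpotentExp
end

/-! ### Splittings into two complex summands and a real one; projections of the space of matrices.
-/

noncomputable section

/-- An orthogonal splitting of a Euclidean space into two complex summands, with projections `p`,
`q` and complex structures `I`, `J`, and a third summand with projection `o`. -/
structure BlockData (ι : Type*) [Fintype ι] [DecidableEq ι] where
  (p q o I J : Matrix ι ι ℝ)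
  pp : p * p = p
  qq : q * q = q
  pq : p * q = 0
  qp : q * p = 0
  o_eq : o = 1 - p - q
  II : I * I = -p
  JJ : J * J = -q
  pI : p * I = I
  Ip : I * p = I
  qJ : q * J = J
  Jq : J * q = J
  pT : p.transpose = p
  qT : q.transpose = q
  IT : I.transpose = -I
  JT : J.transpose = -J

namespace BlockData

open Matrix LieAlgebra.Orthogonal

variable {ι : Type*} [Fintype ι] [DecidableEq ι]

attribute [simp] pp qq pq qp II JJ pI Ip qJ Jq pT qT IT JT

section Products

variable (D : BlockData ι)

@[simp] lemma po : D.p * D.o = 0 := by simp [o_eq, mul_sub]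
@[simp] lemma op : D.o * D.p = 0 := by simp [o_eq, sub_mul]
@[simp] lemma qo : D.q * D.o = 0 := by simp [o_eq, mul_sub]
@[simp] lemma oq : D.o * D.q = 0 := by simp [o_eq, sub_mul]
@[simp] lemma Io : D.I * D.o = 0 := by simp [o_eq, mul_sub, show D.I * D.q = 0 by
  rw [← D.Ip, mul_assoc, D.pq, mul_zero]]
@[simp] lemma oI : D.o * D.I = 0 := by rw [← D.pI, ← mul_assoc, D.op, zero_mul]
@[simp] lemma oJ : D.o * D.J = 0 := by rw [← D.qJ, ← mul_assoc, D.oq, zero_mul]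
@[simp] lemma Jo : D.J * D.o = 0 := by rw [← D.Jq, mul_assoc, D.qo, mul_zero]
@[simp] lemma Iq : D.I * D.q = 0 := by rw [← D.Ip, mul_assoc, D.pq, mul_zero]
@[simp] lemma qI : D.q * D.I = 0 := by rw [← D.pI, ← mul_assoc, D.qp, zero_mul]
@[simp] lemma Jp : D.J * D.p = 0 := by rw [← D.Jq, mul_assoc, D.qp, mul_zero]
@[simp] lemma pJ : D.p * D.J = 0 := by rw [← D.qJ, ← mul_assoc, D.pq, zero_mul]
@[simp] lemma IJ : D.I * D.J = 0 := by rw [← D.qJ, ← mul_assoc, D.Iq, zero_mul]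
@[simp] lemma JI : D.J * D.I = 0 := by rw [← D.pI, ← mul_assoc, D.Jp, zero_mul]
@[simp] lemma oo : D.o * D.o = D.o := by
  nth_rewrite 2 [D.o_eq]
  rw [mul_sub, mul_sub, D.op, D.oq, mul_one, sub_zero, sub_zero]
@[simp] lemma oT : D.oᵀ = D.o := by simp [o_eq]

@[simp] lemma trace_I : D.I.trace = 0 := by
  have := D.I.trace_transpose
  rw [D.IT, trace_neg] at this
  linarith

@[simp] lemma trace_J : D.J.trace = 0 := by
  have := D.J.trace_transpose
  rw [D.JT, trace_neg] at this
  linarith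

end Products

/-- The map `M ↦ A M B`. -/
def sandwich (A B : Matrix ι ι ℝ) : Matrix ι ι ℝ →ₗ[ℝ] Matrix ι ι ℝ :=
  LinearMap.mulLeftRight ℝ (A, B)

lemma sandwich_apply (A B M : Matrix ι ι ℝ) : sandwich A B M = A * M * B := by
  simp [sandwich]

variable (D : BlockData ι)

/-- The projections of the space of matrices which induce those of `𝔰𝔬` onto the isotropy algebra
(`none`) and onto the isotropy summands. -/
def matProj : Option (Fin 6) → Matrix ι ι ℝ →ₗ[ℝ] Matrix ι ι ℝ
  | none => (1 / 2 : ℝ) • (sandwich D.p D.p - sandwich D.I D.I) +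
      (1 / 2 : ℝ) • (sandwich D.q D.q - sandwich D.J D.J) + sandwich D.o D.o
  | some k => ![(1 / 2 : ℝ) • (sandwich D.p D.p + sandwich D.I D.I),
      (1 / 2 : ℝ) • (sandwich D.q D.q + sandwich D.J D.J),
      (1 / 2 : ℝ) • (sandwich D.p D.q - sandwich D.I D.J) +
        (1 / 2 : ℝ) • (sandwich D.q D.p - sandwich D.J D.I),
      (1 / 2 : ℝ) • (sandwich D.p D.q + sandwich D.I D.J) +
        (1 / 2 : ℝ) • (sandwich D.q D.p + sandwich D.J D.I),
      sandwich D.p D.o + sandwich D.o D.p,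
      sandwich D.q D.o + sandwich D.o D.q] k

/-- The roots by which `a I + b J` acts on the images of the projections. -/
def root (a b : ℝ) : Option (Fin 6) → ℝ
  | none => 0
  | some k => ![2 * a, 2 * b, a - b, a + b, a, b] k

/-- The element `a I + b J` of the centre of the isotropy algebra. -/
def center (a b : ℝ) : Matrix ι ι ℝ := a • D.I + b • D.J

lemma matProj_transpose (k : Option (Fin 6)) (M : Matrix ι ι ℝ) :
    (D.matProj k M)ᵀ = D.matProj k Mᵀ := by
  rcases k with _ | k
  · simp [matProj, sandwich_apply, mul_assoc]
  · fin_cases k <;> simp [matProj, sandwich_apply, mul_assoc]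
    all_goals abel

lemma sum_matProj (M : Matrix ι ι ℝ) : ∑ k, D.matProj k M = M := by
  have h : (D.p + D.q + D.o) * M * (D.p + D.q + D.o) = M := by
    simp [o_eq]
  nth_rewrite 2 [← h]
  rw [Fintype.sum_option, Fin.sum_univ_six]
  simp [matProj, sandwich_apply, add_mul, mul_add]
  module

/-- For a block between complex summands, M − I M J is twice the complex-linear part and M + I M J
twice the antilinear part. The first carries the difference of the two characters of the centre, the
second their sum. -/
lemma center_matProj (a b : ℝ) (k : Option (Fin 6)) (M : Matrix ι ι ℝ) :
    ⁅D.center a b, ⁅D.center a b, D.matProj k M⁆⁆ = -(root a b k) ^ 2 • D.matProj k M := by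
  have h1 (X Y Z : Matrix ι ι ℝ) (h : X * Y = Z) (W : Matrix ι ι ℝ) : X * (Y * W) = Z * W := by
    rw [← h, mul_assoc]
  rcases k with _ | k
  · simp [matProj, sandwich_apply, Ring.lie_def, center, root, add_mul, mul_add, mul_sub, sub_mul,
      mul_assoc, h1 _ _ _ D.II, h1 _ _ _ D.JJ, h1 _ _ _ D.Ip,
      h1 _ _ _ D.Jq, h1 _ _ _ D.IJ, h1 _ _ _ D.JI, h1 _ _ _ D.Iq, h1 _ _ _ D.Jp, h1 _ _ _ D.Io,
      h1 _ _ _ D.Jo]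
    module
  · fin_cases k <;>
    simp [matProj, sandwich_apply, Ring.lie_def, center, root, add_mul, mul_add, mul_sub, sub_mul,
      mul_assoc, h1 _ _ _ D.II, h1 _ _ _ D.JJ, h1 _ _ _ D.Ip,
      h1 _ _ _ D.Jq, h1 _ _ _ D.IJ, h1 _ _ _ D.JI, h1 _ _ _ D.Iq, h1 _ _ _ D.Jp, h1 _ _ _ D.Io,
      h1 _ _ _ D.Jo] <;> module

lemma center_matProj_none (a b : ℝ) (M : Matrix ι ι ℝ) :
    ⁅D.center a b, D.matProj none M⁆ = 0 := by
  have h1 (X Y Z : Matrix ι ι ℝ) (h : X * Y = Z) (W : Matrix ι ι ℝ) : X * (Y * W) = Z * W := by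
    rw [← h, mul_assoc]
  simp [matProj, sandwich_apply, Ring.lie_def, center, add_mul, mul_add, mul_sub, sub_mul,
      mul_assoc, h1 _ _ _ D.II, h1 _ _ _ D.JJ, h1 _ _ _ D.Ip,
      h1 _ _ _ D.Jq, h1 _ _ _ D.IJ, h1 _ _ _ D.JI, h1 _ _ _ D.Iq, h1 _ _ _ D.Jp, h1 _ _ _ D.Io,
      h1 _ _ _ D.Jo]
  module

/-- An endomorphism which commutes with the complex structures commutes with the projections. -/
lemma matProj_conj (k : Option (Fin 6)) {A B : Matrix ι ι ℝ} (hAI : Commute A D.I)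
    (hAJ : Commute A D.J) (hBI : Commute B D.I) (hBJ : Commute B D.J) (M : Matrix ι ι ℝ) :
    D.matProj k (A * M * B) = A * D.matProj k M * B := by
  have hc (A : Matrix ι ι ℝ) (hAI : Commute A D.I) (hAJ : Commute A D.J) :
      Commute A D.p ∧ Commute A D.q ∧ Commute A D.o := by
    have hp : Commute A D.p := by
      have := (hAI.mul_right hAI).neg_right
      rwa [D.II, neg_neg] at this
    have hq : Commute A D.q := by
      have := (hAJ.mul_right hAJ).neg_right
      rwa [D.JJ, neg_neg] at this
    refine ⟨hp, hq, ?_⟩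
    rw [D.o_eq]
    exact ((Commute.one_right A).sub_right hp).sub_right hq
  obtain ⟨hAp, hAq, hAo⟩ := hc A hAI hAJ
  obtain ⟨hBp, hBq, hBo⟩ := hc B hBI hBJ
  have hs (X Y : Matrix ι ι ℝ) (hX : Commute A X) (hY : Commute B Y) :
      sandwich X Y (A * M * B) = A * sandwich X Y M * B := by
    rw [sandwich_apply, sandwich_apply]
    calc X * (A * M * B) * Y = (X * A) * M * (B * Y) := by simp only [mul_assoc]
      _ = _ := by rw [hY.eq, ← hX.eq]; simp only [mul_assoc]
  rcases k with _ | k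
  · simp [matProj, hs, hAp, hAq, hAo, hBp, hBq, hBo, hAI, hAJ, hBI, hBJ, mul_add, add_mul, mul_sub,
      sub_mul]
  · fin_cases k <;>
    simp [matProj, hs, hAp, hAq, hAo, hBp, hBq, hBo, hAI, hAJ, hBI, hBJ, mul_add, add_mul, mul_sub,
      sub_mul]

end BlockData
end

/-! ### The isotropy decomposition, selection rules for brackets, and the contracted bracket. -/

noncomputable section

namespace BlockData

open Matrix LieAlgebra.Orthogonal

variable {ι : Type*} [Fintype ι] [DecidableEq ι] (D : BlockData ι)

/-- The projections of `𝔰𝔬` onto the isotropy algebra (`none`) and the isotropy summands. -/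
def proj (k : Option (Fin 6)) : so ι ℝ →ₗ[ℝ] so ι ℝ :=
  (D.matProj k).restrict fun M (hM : M ∈ so ι ℝ) => show D.matProj k M ∈ so ι ℝ by
    rw [mem_so] at hM ⊢
    rw [matProj_transpose, hM, map_neg]

lemma coe_proj (k : Option (Fin 6)) (X : so ι ℝ) :
    (D.proj k X : Matrix ι ι ℝ) = D.matProj k X := rfl

/-- The element `a I + b J` of `𝔰𝔬`. -/
def centerSo (a b : ℝ) : so ι ℝ := ⟨D.center a b, by
  rw [mem_so, center, transpose_add, transpose_smul, transpose_smul, IT, JT]; module⟩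

lemma sum_proj (X : so ι ℝ) : ∑ k, D.proj k X = X :=
  Subtype.ext <| by
    rw [AddSubmonoidClass.coe_finsetSum]
    exact D.sum_matProj X

lemma eq_of_proj_eq {X Y : so ι ℝ} (h : ∀ k, D.proj k X = D.proj k Y) : X = Y := by
  rw [← D.sum_proj X, ← D.sum_proj Y]
  exact Finset.sum_congr rfl fun k _ => h k

lemma centerSo_proj (a b : ℝ) (k : Option (Fin 6)) (X : so ι ℝ) :
    ⁅D.centerSo a b, ⁅D.centerSo a b, D.proj k X⁆⁆ = -(root a b k) ^ 2 • D.proj k X :=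
  Subtype.ext (D.center_matProj a b k X)

lemma centerSo_proj_none (a b : ℝ) (X : so ι ℝ) : ⁅D.centerSo a b, D.proj none X⁆ = 0 :=
  Subtype.ext (D.center_matProj_none a b X)

lemma proj_centerSo (a b : ℝ) (k : Option (Fin 6)) (X : so ι ℝ) :
    D.proj k ⁅D.centerSo a b, X⁆ = ⁅D.centerSo a b, D.proj k X⁆ := by
  have hI : Commute (D.center a b) D.I := by
    rw [center, commute_iff_eq]
    simp [add_mul, mul_add]
  have hJ : Commute (D.center a b) D.J := by
    rw [center, commute_iff_eq]
    simp [add_mul, mul_add]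
  have h1 := D.matProj_conj k hI hJ (Commute.one_left _) (Commute.one_left _) X
  have h2 := D.matProj_conj k (Commute.one_left _) (Commute.one_left _) hI hJ X
  refine Subtype.ext ?_
  change D.matProj k (D.center a b * X - X * D.center a b) =
    D.center a b * D.matProj k X - D.matProj k X * D.center a b
  rw [mul_one, mul_one] at h1
  rw [one_mul, one_mul] at h2
  rw [map_sub, h1, h2]

/-- The values of the roots on the regular element `10 I + 3 J`. -/
def weight : Option (Fin 6) → ℤ
  | none => 0
  | some k => ![20, 6, 7, 13, 10, 3] k

lemma root_eq_weight (k : Option (Fin 6)) : root 10 3 k = weight k := by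
  rcases k with _ | k
  · simp [root, weight]
  · fin_cases k <;> norm_num [root, weight]

/-- One regular element Z of the centre suffices to separate the summands: (ad Z)² commutes with the
projections and acts on the summands by distinct scalars. -/
lemma proj_eq_zero_of_weight {X : so ι ℝ} {μ : ℝ}
    (h : ⁅D.centerSo 10 3, ⁅D.centerSo 10 3, X⁆⁆ = -μ ^ 2 • X) {k : Option (Fin 6)}
    (hk : (weight k : ℝ) ^ 2 ≠ μ ^ 2) : D.proj k X = 0 := by
  have h1 := congrArg (D.proj k) h
  rw [proj_centerSo, proj_centerSo, centerSo_proj, map_smul, root_eq_weight, ← sub_eq_zero,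
    ← sub_smul] at h1
  refine (smul_eq_zero.1 h1).resolve_left fun h2 => hk ?_
  linear_combination -h2

lemma weight_sq_injective : Function.Injective fun k => weight k ^ 2 := by decide

lemma proj_proj_of_ne {k l : Option (Fin 6)} (h : k ≠ l) (X : so ι ℝ) :
    D.proj k (D.proj l X) = 0 := by
  refine D.proj_eq_zero_of_weight (D.centerSo_proj 10 3 l X) ?_
  rw [root_eq_weight]
  exact_mod_cast fun h' => h (weight_sq_injective h')

lemma proj_proj_self (k : Option (Fin 6)) (X : so ι ℝ) : D.proj k (D.proj k X) = D.proj k X := by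
  have h := D.sum_proj (D.proj k X)
  rwa [Finset.sum_eq_single k (fun l _ hl => D.proj_proj_of_ne hl X) (by simp)] at h

lemma proj_proj (k l : Option (Fin 6)) (X : so ι ℝ) :
    D.proj k (D.proj l X) = if k = l then D.proj k X else 0 := by
  split_ifs with h
  · rw [← h, proj_proj_self]
  · exact D.proj_proj_of_ne h X

lemma proj_eq_self_iff (k : Option (Fin 6)) (X : so ι ℝ) :
    D.proj k X = X ↔ ∀ l, l ≠ k → D.proj l X = 0 := by
  refine ⟨fun h l hl => by rw [← h, proj_proj_of_ne _ hl], fun h => ?_⟩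
  have h' := D.sum_proj X
  rwa [Finset.sum_eq_single k (fun l _ hl => h l hl) (by simp)] at h'

lemma proj_eq_self_iff_root (k : Option (Fin 6)) (X : so ι ℝ) :
    D.proj k X = X ↔
      ∀ a b : ℝ, ⁅D.centerSo a b, ⁅D.centerSo a b, X⁆⁆ = -(root a b k) ^ 2 • X := by
  refine ⟨fun h a b => by rw [← h, centerSo_proj], fun h => ?_⟩
  refine (D.proj_eq_self_iff k X).2 fun l hl => D.proj_eq_zero_of_weight (h 10 3) ?_
  rw [root_eq_weight]
  exact_mod_cast fun h' => hl (weight_sq_injective h')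

lemma proj_none_eq_self_iff (X : so ι ℝ) :
    D.proj none X = X ↔ ∀ a b : ℝ, ⁅D.centerSo a b, X⁆ = 0 := by
  refine ⟨fun h a b => by rw [← h, centerSo_proj_none], fun h => ?_⟩
  refine (D.proj_eq_self_iff_root none X).2 fun a b => ?_
  rw [h, lie_zero]
  simp [root]

/-- The condition on weights for `[𝔪_i, 𝔪_j]` to have a component in `𝔪_k`. -/
def Compatible (i j k : Option (Fin 6)) : Prop :=
  (weight i ^ 2 + weight j ^ 2 - weight k ^ 2) ^ 2 = 4 * weight i ^ 2 * weight j ^ 2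

instance (i j k : Option (Fin 6)) : Decidable (Compatible i j k) := by
  unfold Compatible; infer_instance

/-- [X, Y] and [[Z, X], [Z, Y]] span a space stable under (ad Z)², with possible eigenvalues −(w_i ±
w_j)². A component in summand k thus requires w_k = ±w_i ± w_j, which is `Compatible`. Working with
(ad Z)² avoids complexification. -/
lemma proj_lie_of_not_compatible {i j k : Option (Fin 6)} (h : ¬ Compatible i j k)
    {X Y : so ι ℝ} (hX : D.proj i X = X) (hY : D.proj j Y = Y) : D.proj k ⁅X, Y⁆ = 0 := by
  set Z := D.centerSo 10 3 with hZ
  have hX' : ⁅Z, ⁅Z, X⁆⁆ = -(weight i : ℝ) ^ 2 • X := by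
    rw [← hX, hZ, centerSo_proj, root_eq_weight]
  have hY' : ⁅Z, ⁅Z, Y⁆⁆ = -(weight j : ℝ) ^ 2 • Y := by
    rw [← hY, hZ, centerSo_proj, root_eq_weight]
  have e1 : ⁅Z, ⁅Z, ⁅X, Y⁆⁆⁆ = -((weight i : ℝ) ^ 2 + (weight j : ℝ) ^ 2) • ⁅X, Y⁆ +
      (2 : ℝ) • ⁅⁅Z, X⁆, ⁅Z, Y⁆⁆ := by
    rw [leibniz_lie Z X Y, lie_add, leibniz_lie Z ⁅Z, X⁆ Y, leibniz_lie Z X ⁅Z, Y⁆, hX', hY',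
      smul_lie, lie_smul]
    module
  have e2 : ⁅Z, ⁅Z, ⁅⁅Z, X⁆, ⁅Z, Y⁆⁆⁆⁆ =
      -((weight i : ℝ) ^ 2 + (weight j : ℝ) ^ 2) • ⁅⁅Z, X⁆, ⁅Z, Y⁆⁆ +
      (2 * (weight i : ℝ) ^ 2 * (weight j : ℝ) ^ 2) • ⁅X, Y⁆ := by
    rw [leibniz_lie Z ⁅Z, X⁆ ⁅Z, Y⁆, hX', hY', lie_add, smul_lie, lie_smul, lie_smul, lie_smul,
      leibniz_lie Z X ⁅Z, Y⁆, leibniz_lie Z ⁅Z, X⁆ Y, hX', hY', smul_lie, lie_smul]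
    module
  have f1 := congrArg (D.proj k) e1
  have f2 := congrArg (D.proj k) e2
  rw [hZ, proj_centerSo, proj_centerSo, centerSo_proj, map_add, map_smul, map_smul,
    root_eq_weight, ← hZ] at f1 f2
  set α := D.proj k ⁅X, Y⁆
  set γ := D.proj k ⁅⁅Z, X⁆, ⁅Z, Y⁆⁆
  set s : ℝ := (weight i : ℝ) ^ 2 + (weight j : ℝ) ^ 2 - (weight k : ℝ) ^ 2 with hs
  have g1 : s • α = (2 : ℝ) • γ := by
    rw [hs]
    linear_combination (norm := module) f1
  have g2 : s • γ = (2 * (weight i : ℝ) ^ 2 * (weight j : ℝ) ^ 2) • α := by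
    rw [hs]
    linear_combination (norm := module) f2
  have g3 : (s ^ 2 - 4 * (weight i : ℝ) ^ 2 * (weight j : ℝ) ^ 2) • α = 0 := by
    linear_combination (norm := module) s • g1 + (2 : ℝ) • g2
  refine (smul_eq_zero.1 g3).resolve_left fun h0 => h ?_
  rw [hs] at h0
  rw [Compatible]
  exact_mod_cast sub_eq_zero.1 h0

/-- The degrees of the filtration of `𝔤`. -/
def deg : Option (Fin 6) → ℤ
  | none => 0
  | some k => ![4, 2, 2, 4, 3, 1] k

/-- A second grading, preserved by the bracket of the contraction. -/
def step : Option (Fin 6) → ℕ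
  | none => 0
  | some k => ![1, 2, 1, 3, 2, 1] k

lemma deg_le_of_compatible : ∀ i j k, Compatible i j k → deg k ≤ deg i + deg j := by decide

lemma step_of_compatible : ∀ i j k, Compatible i j k → deg i + deg j = deg k →
    step k = step i + step j := by decide

/-- The triples `(i, j, k)` such that the bracket of the contraction maps `𝔪_i × 𝔪_j` to `𝔪_k`. -/
def brackets : Finset (Fin 6 × Fin 6 × Fin 6) :=
  {(1, 2, 3), (2, 1, 3), (5, 5, 1), (2, 5, 4), (5, 2, 4), (4, 5, 3), (5, 4, 3)}

lemma mem_brackets_of_compatible : ∀ i j k : Fin 6, Compatible (some i) (some j) (some k) →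
    deg (some i) + deg (some j) = deg (some k) → (i, j, k) ∈ brackets := by decide

lemma deg_of_mem_brackets : ∀ i j k : Fin 6, (i, j, k) ∈ brackets →
    deg (some i) + deg (some j) = deg (some k) := by decide

lemma proj_lie_of_deg_lt {i j k : Option (Fin 6)} (h : deg i + deg j < deg k)
    {X Y : so ι ℝ} (hX : D.proj i X = X) (hY : D.proj j Y = Y) : D.proj k ⁅X, Y⁆ = 0 :=
  D.proj_lie_of_not_compatible (fun hc => h.not_ge (deg_le_of_compatible i j k hc)) hX hY

/-- The bracket of the contraction. -/
def contracted : so ι ℝ →ₗ[ℝ] so ι ℝ →ₗ[ℝ] so ι ℝ :=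
  ∑ i, ∑ j, ∑ k, if deg i + deg j = deg k then
    (((LieModule.toEnd ℝ (so ι ℝ) (so ι ℝ) : so ι ℝ →ₗ[ℝ] Module.End ℝ (so ι ℝ)).compl₁₂
      (D.proj i) (D.proj j)).compr₂ (D.proj k)) else 0

lemma contracted_apply (X Y : so ι ℝ) : D.contracted X Y =
    ∑ i, ∑ j, ∑ k, if deg i + deg j = deg k then D.proj k ⁅D.proj i X, D.proj j Y⁆ else 0 := by
  simp only [contracted, LinearMap.sum_apply]
  refine Finset.sum_congr rfl fun i _ => Finset.sum_congr rfl fun j _ =>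
    Finset.sum_congr rfl fun k _ => ?_
  split_ifs
  · rfl
  · rfl

lemma proj_contracted_apply (k : Option (Fin 6)) (X Y : so ι ℝ) : D.proj k (D.contracted X Y) =
    ∑ i, ∑ j, if deg i + deg j = deg k then D.proj k ⁅D.proj i X, D.proj j Y⁆ else 0 := by
  simp only [contracted_apply, map_sum, apply_ite (D.proj k), map_zero, proj_proj]
  refine Finset.sum_congr rfl fun i _ => Finset.sum_congr rfl fun j _ => ?_
  rw [Finset.sum_eq_single k]
  · simp
  · intro l _ hl
    simp [hl.symm]
  · simp

lemma proj_contracted {i j : Option (Fin 6)} (k : Option (Fin 6)) {X Y : so ι ℝ}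
    (hX : D.proj i X = X) (hY : D.proj j Y = Y) : D.proj k (D.contracted X Y) =
    if deg i + deg j = deg k then D.proj k ⁅X, Y⁆ else 0 := by
  rw [proj_contracted_apply, Finset.sum_eq_single i, Finset.sum_eq_single j, hX, hY]
  · intro l _ hl
    rw [(D.proj_eq_self_iff j Y).1 hY l hl]
    simp
  · simp
  · intro l _ hl
    rw [(D.proj_eq_self_iff i X).1 hX l hl]
    simp
  · simp

lemma contracted_skew (X Y : so ι ℝ) : D.contracted X Y = -D.contracted Y X := by
  rw [contracted_apply, contracted_apply, Finset.sum_comm, ← Finset.sum_neg_distrib]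
  refine Finset.sum_congr rfl fun j _ => ?_
  rw [← Finset.sum_neg_distrib]
  refine Finset.sum_congr rfl fun i _ => ?_
  rw [← Finset.sum_neg_distrib]
  refine Finset.sum_congr rfl fun k _ => ?_
  rw [add_comm (deg i)]
  split_ifs
  · rw [← map_neg, lie_skew]
  · simp

/-- Every intermediate component m of [X, Y] may be kept. One of degree above deg i + deg j is zero,
and from one of lower degree the bracket with Z cannot reach degree deg i + deg j + deg k. The
double contracted bracket is thus the top-degree part of the original one, and the Jacobi identity
is inherited. -/
lemma proj_contracted_contracted {i j k : Option (Fin 6)} (l : Option (Fin 6)) {X Y Z : so ι ℝ}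
    (hX : D.proj i X = X) (hY : D.proj j Y = Y) (hZ : D.proj k Z = Z) :
    D.proj l (D.contracted (D.contracted X Y) Z) =
      if deg i + deg j + deg k = deg l then D.proj l ⁅⁅X, Y⁆, Z⁆ else 0 := by
  have e : D.contracted X Y = ∑ m, D.proj m (D.contracted X Y) := (D.sum_proj _).symm
  rw [e, map_sum, LinearMap.sum_apply, map_sum]
  have h1 : ∀ m, D.proj l (D.contracted (D.proj m (D.contracted X Y)) Z) =
      if deg i + deg j + deg k = deg l then D.proj l ⁅D.proj m ⁅X, Y⁆, Z⁆ else 0 := by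
    intro m
    rw [D.proj_contracted l (D.proj_proj_self m _) hZ, D.proj_contracted m hX hY]
    by_cases h : deg i + deg j = deg m
    · rw [if_pos h, h]
    · rw [if_neg h, zero_lie, map_zero, ite_self]
      split_ifs with h2
      · rcases lt_or_gt_of_ne h with h3 | h3
        · rw [D.proj_lie_of_deg_lt h3 hX hY, zero_lie, map_zero]
        · rw [D.proj_lie_of_deg_lt (by omega) (D.proj_proj_self m _) hZ]
      · rfl
  rw [Finset.sum_congr rfl fun m _ => h1 m]
  split_ifs
  · rw [← map_sum, ← sum_lie, D.sum_proj]
  · simp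

lemma contracted_jacobi (X Y Z : so ι ℝ) : D.contracted (D.contracted X Y) Z =
    D.contracted X (D.contracted Y Z) - D.contracted Y (D.contracted X Z) := by
  have h1 : ∀ i j k X Y Z, D.proj i X = X → D.proj j Y = Y → D.proj k Z = Z →
      D.contracted (D.contracted X Y) Z =
        D.contracted X (D.contracted Y Z) - D.contracted Y (D.contracted X Z) := by
    intro i j k X Y Z hX hY hZ
    refine D.eq_of_proj_eq fun l => ?_
    rw [map_sub, D.contracted_skew X (D.contracted Y Z), D.contracted_skew Y (D.contracted X Z),
      map_neg, map_neg, D.proj_contracted_contracted l hX hY hZ,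
      D.proj_contracted_contracted l hY hZ hX, D.proj_contracted_contracted l hX hZ hY,
      show deg j + deg k + deg i = deg i + deg j + deg k by ring,
      show deg i + deg k + deg j = deg i + deg j + deg k by ring]
    split_ifs
    · rw [← map_neg, ← map_neg, lie_skew, lie_skew, ← map_sub, lie_lie]
    · simp
  have h2 : ∀ i j X Y, D.proj i X = X → D.proj j Y = Y → ∀ Z, D.contracted (D.contracted X Y) Z =
      D.contracted X (D.contracted Y Z) - D.contracted Y (D.contracted X Z) := by
    intro i j X Y hX hY Z
    rw [← D.sum_proj Z]
    simp only [map_sum]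
    rw [← Finset.sum_sub_distrib]
    exact Finset.sum_congr rfl fun k _ => h1 i j k X Y _ hX hY (D.proj_proj_self k Z)
  have h3 : ∀ i X, D.proj i X = X → ∀ Y Z, D.contracted (D.contracted X Y) Z =
      D.contracted X (D.contracted Y Z) - D.contracted Y (D.contracted X Z) := by
    intro i X hX Y Z
    rw [← D.sum_proj Y]
    simp only [map_sum, LinearMap.sum_apply]
    rw [← Finset.sum_sub_distrib]
    exact Finset.sum_congr rfl fun j _ => h2 i j X _ hX (D.proj_proj_self j Y) Z
  rw [← D.sum_proj X]
  simp only [map_sum, LinearMap.sum_apply]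
  rw [← Finset.sum_sub_distrib]
  exact Finset.sum_congr rfl fun i _ => h3 i _ (D.proj_proj_self i X) Y Z

end BlockData
end

/-! ### Traces of endomorphisms of matrix spaces; the Killing form. -/

noncomputable section

namespace BlockData

open Matrix LieAlgebra.Orthogonal

variable {ι : Type*} [Fintype ι] [DecidableEq ι]

section Trace

lemma trace_matrix_end (T : Module.End ℝ (Matrix ι ι ℝ)) :
    LinearMap.trace ℝ _ T = ∑ i, ∑ j, T (single i j 1) i j := by
  rw [LinearMap.trace_eq_matrix_trace ℝ (Matrix.stdBasis ℝ ι ι), Matrix.trace,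
    Fintype.sum_prod_type]
  refine Finset.sum_congr rfl fun i _ => Finset.sum_congr rfl fun j _ => ?_
  rw [diag_apply, LinearMap.toMatrix_apply, stdBasis_eq_single]
  rfl

lemma trace_sandwich (A B : Matrix ι ι ℝ) :
    LinearMap.trace ℝ _ (sandwich A B) = A.trace * B.trace := by
  rw [trace_matrix_end, Matrix.trace, Matrix.trace, Finset.sum_mul_sum]
  refine Finset.sum_congr rfl fun i _ => Finset.sum_congr rfl fun j _ => ?_
  simp [sandwich_apply, mul_apply, single_apply, ite_and]

/-- The map `M ↦ A Mᵀ B`. -/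
def sandwichT (A B : Matrix ι ι ℝ) : Matrix ι ι ℝ →ₗ[ℝ] Matrix ι ι ℝ :=
  sandwich A B ∘ₗ (transposeLinearEquiv ι ι ℝ ℝ).toLinearMap

lemma sandwichT_apply (A B M : Matrix ι ι ℝ) : sandwichT A B M = A * Mᵀ * B := by
  simp [sandwichT, sandwich_apply]

/-- Transposition merges the two factors into a single trace. Such terms are the origin of the −2 in
the Killing form and of the −1 in `tau_three_one` and `tau_five_one`. -/
lemma trace_sandwichT (A B : Matrix ι ι ℝ) :
    LinearMap.trace ℝ _ (sandwichT A B) = (Aᵀ * B).trace := by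
  rw [trace_matrix_end, Matrix.trace, Finset.sum_comm]
  refine Finset.sum_congr rfl fun j _ => ?_
  rw [diag_apply, mul_apply]
  refine Finset.sum_congr rfl fun i _ => ?_
  simp [sandwichT_apply, mul_apply, single_apply, ite_and]

/-- The inclusion of `𝔰𝔬` in the space of matrices. -/
def toMatrix : so ι ℝ →ₗ[ℝ] Matrix ι ι ℝ where
  toFun X := X
  map_add' _ _ := rfl
  map_smul' _ _ := rfl

/-- The projection of the space of matrices onto `𝔰𝔬`. -/
def skewPart : Matrix ι ι ℝ →ₗ[ℝ] so ι ℝ where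
  toFun M := ⟨(1 / 2 : ℝ) • (M - Mᵀ), by
    rw [mem_so, transpose_smul, transpose_sub, transpose_transpose]
    module⟩
  map_add' M N := Subtype.ext <| by
    change (1 / 2 : ℝ) • (M + N - (M + N)ᵀ) = (1 / 2 : ℝ) • (M - Mᵀ) + (1 / 2 : ℝ) • (N - Nᵀ)
    rw [transpose_add]
    module
  map_smul' r M := Subtype.ext <| by
    change (1 / 2 : ℝ) • (r • M - (r • M)ᵀ) = r • (1 / 2 : ℝ) • (M - Mᵀ)
    rw [transpose_smul]
    module

lemma coe_skewPart (M : Matrix ι ι ℝ) :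
    (skewPart M : Matrix ι ι ℝ) = (1 / 2 : ℝ) • (M - Mᵀ) := rfl

lemma so_transpose (X : so ι ℝ) : (X : Matrix ι ι ℝ)ᵀ = -X := (mem_so _ _ _).1 X.2

lemma skewPart_coe (X : so ι ℝ) : skewPart (X : Matrix ι ι ℝ) = X :=
  Subtype.ext <| by
    rw [coe_skewPart, so_transpose]
    module

/-- `skewPart` is a retraction of matrices onto 𝔰𝔬, so traces on 𝔰𝔬 can be computed with matrix
units. -/
lemma trace_so (T : Module.End ℝ (so ι ℝ)) : LinearMap.trace ℝ _ T =
    LinearMap.trace ℝ _ (toMatrix ∘ₗ T ∘ₗ skewPart) := by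
  rw [LinearMap.trace_comp_comm', LinearMap.comp_assoc]
  congr 1
  ext X : 1
  exact congrArg T (skewPart_coe X).symm

/-- The Killing form of `𝔰𝔬(n)` is `(n - 2) tr (X Y)`. -/
theorem killingForm_so (X Y : so ι ℝ) : killingForm ℝ (so ι ℝ) X Y =
    ((Fintype.card ι : ℝ) - 2) * ((X : Matrix ι ι ℝ) * Y).trace := by
  rw [killingForm_apply_apply, trace_so]
  set x : Matrix ι ι ℝ := X.1
  set y : Matrix ι ι ℝ := Y.1
  have e : (toMatrix ∘ₗ (LieAlgebra.ad ℝ (so ι ℝ) X ∘ₗ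
      LieAlgebra.ad ℝ (so ι ℝ) Y) ∘ₗ skewPart) = (1 / 2 : ℝ) •
      (sandwich (x * y) 1 - sandwich x y - sandwich y x + sandwich 1 (y * x)
      - (sandwichT (x * y) 1 - sandwichT x y - sandwichT y x + sandwichT 1 (y * x))) := by
    refine LinearMap.ext fun M => ?_
    change x * (y * ((1 / 2 : ℝ) • (M - Mᵀ)) - ((1 / 2 : ℝ) • (M - Mᵀ)) * y) -
      (y * ((1 / 2 : ℝ) • (M - Mᵀ)) - ((1 / 2 : ℝ) • (M - Mᵀ)) * y) * x = _
    simp only [LinearMap.smul_apply, LinearMap.sub_apply, LinearMap.add_apply, sandwich_apply,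
      sandwichT_apply, mul_sub, sub_mul, mul_smul_comm, smul_mul_assoc, mul_one, one_mul,
      mul_assoc]
    module
  have hx : xᵀ = -x := so_transpose X
  have hy : yᵀ = -y := so_transpose Y
  have tx : x.trace = 0 := by
    have := x.trace_transpose
    rw [hx, trace_neg] at this
    linarith
  rw [e]
  simp only [map_smul, map_sub, map_add, trace_sandwich, trace_sandwichT, trace_one,
    transpose_mul, hx, hy, transpose_one, one_mul, mul_one, neg_mul, mul_neg, neg_neg, trace_neg,
    tx, smul_eq_mul, trace_mul_comm y x]
  ring

end Trace

end BlockData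
end

/-! ### Nilpotency and faithfulness of the contracted adjoint action; conjugation by the isotropy
group. -/

noncomputable section

namespace BlockData

open Matrix LieAlgebra.Orthogonal

variable {ι : Type*} [Fintype ι] [DecidableEq ι] (D : BlockData ι)

lemma step_pos : ∀ k : Fin 6, 1 ≤ step (some k) := by decide

lemma step_le : ∀ k : Option (Fin 6), step k < 4 := by decide

/-- The contracted bracket is additive for `step`, and the isotropy summands have step at least 1,
so bracketing with X raises the step. -/
lemma proj_contracted_eq_zero_of_step {X Y : so ι ℝ} (hX : D.proj none X = 0) {n : ℕ}
    (hY : ∀ k, step k < n → D.proj k Y = 0) (k : Option (Fin 6)) (hk : step k < n + 1) :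
    D.proj k (D.contracted X Y) = 0 := by
  rw [proj_contracted_apply]
  refine Finset.sum_eq_zero fun i _ => Finset.sum_eq_zero fun j _ => ?_
  split_ifs with h
  · by_cases hc : Compatible i j k
    · have hs := step_of_compatible i j k hc h
      rcases i with _ | i
      · rw [hX, zero_lie, map_zero]
      · have := step_pos i
        rw [hY j (by omega), lie_zero, map_zero]
    · exact D.proj_lie_of_not_compatible hc (D.proj_proj_self i X) (D.proj_proj_self j Y)
  · rfl

lemma proj_none_contracted {X Y : so ι ℝ} (hX : D.proj none X = 0) :
    D.proj none (D.contracted X Y) = 0 :=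
  D.proj_contracted_eq_zero_of_step hX (n := 0) (fun _ h => absurd h (by omega)) none (by decide)

lemma contracted_nilpotent {W X Y Z : so ι ℝ} (hW : D.proj none W = 0) (hX : D.proj none X = 0)
    (hY : D.proj none Y = 0) (hZ : D.proj none Z = 0) (V : so ι ℝ) :
    D.contracted W (D.contracted X (D.contracted Y (D.contracted Z V))) = 0 := by
  refine D.eq_of_proj_eq fun k => ?_
  rw [map_zero]
  refine D.proj_contracted_eq_zero_of_step hW (n := 3) ?_ k (step_le k)
  refine D.proj_contracted_eq_zero_of_step hX (n := 2) ?_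
  refine D.proj_contracted_eq_zero_of_step hY (n := 1) ?_
  exact D.proj_contracted_eq_zero_of_step hZ (n := 0) (fun _ h => absurd h (by omega))

/-- Steps run from 0 to 3. Four brackets kill all of 𝔰𝔬, but an element Z of the isotropy module
already has step at least 1, so three are enough. -/
lemma contracted_nilpotent' {W X Y Z : so ι ℝ} (hW : D.proj none W = 0) (hX : D.proj none X = 0)
    (hY : D.proj none Y = 0) (hZ : D.proj none Z = 0) :
    D.contracted W (D.contracted X (D.contracted Y Z)) = 0 := by
  refine D.eq_of_proj_eq fun k => ?_
  rw [map_zero]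
  refine D.proj_contracted_eq_zero_of_step hW (n := 3) ?_ k (step_le k)
  refine D.proj_contracted_eq_zero_of_step hX (n := 2) ?_
  refine D.proj_contracted_eq_zero_of_step hY (n := 1) ?_
  intro l hl
  rcases l with _ | l
  · exact hZ
  · have := step_pos l
    omega

lemma proj_none_centerSo (a b : ℝ) : D.proj none (D.centerSo a b) = D.centerSo a b := by
  refine (D.proj_none_eq_self_iff _).2 fun c d => Subtype.ext ?_
  change D.center c d * D.center a b - D.center a b * D.center c d = 0
  simp [center, add_mul, mul_add, smul_smul, mul_comm]

/-- The isotropy algebra has degree 0, so the contraction leaves its action unchanged. -/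
lemma contracted_centerSo (X : so ι ℝ) :
    D.contracted X (D.centerSo 10 3) = -⁅D.centerSo 10 3, X⁆ := by
  have h1 : ∀ i, D.contracted (D.proj i X) (D.centerSo 10 3) =
      -⁅D.centerSo 10 3, D.proj i X⁆ := by
    intro i
    refine D.eq_of_proj_eq fun k => ?_
    rw [D.proj_contracted k (D.proj_proj_self i X) (D.proj_none_centerSo 10 3), ← lie_skew,
      map_neg, proj_centerSo, proj_proj]
    by_cases h : k = i
    · subst h
      simp [deg]
    · simp [h]
  conv_lhs => rw [← D.sum_proj X]
  conv_rhs => rw [← D.sum_proj X]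
  simp only [map_sum, LinearMap.sum_apply, h1, lie_sum, Finset.sum_neg_distrib]

/-- All isotropy summands have nonzero weight. This gives both the faithfulness of the adjoint
action of 𝔪 and the triviality of exp(𝔪) ∩ H. -/
lemma eq_zero_of_contracted_centerSo {X : so ι ℝ} (hX : D.proj none X = 0)
    (h : D.contracted X (D.centerSo 10 3) = 0) : X = 0 := by
  rw [contracted_centerSo, neg_eq_zero] at h
  have h2 : ⁅D.centerSo 10 3, ⁅D.centerSo 10 3, X⁆⁆ = -(0 : ℝ) ^ 2 • X := by
    rw [h, lie_zero]
    simp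
  rw [← D.sum_proj X]
  refine Finset.sum_eq_zero fun k _ => ?_
  rcases k with _ | k
  · exact hX
  · refine D.proj_eq_zero_of_weight h2 ?_
    have : (weight (some k)) ^ 2 ≠ 0 ^ 2 := fun h =>
      Option.some_ne_none k (weight_sq_injective h)
    exact_mod_cast this

section Conjugation

variable {k l : Matrix ι ι ℝ} (u : so ι ℝ →ₗ[ℝ] so ι ℝ)

lemma conj_lie (hlk : l * k = 1) (hu : ∀ X, (u X : Matrix ι ι ℝ) = k * X * l)
    (X Y : so ι ℝ) : ⁅u X, u Y⁆ = u ⁅X, Y⁆ := by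
  refine Subtype.ext ?_
  change (u X : Matrix ι ι ℝ) * u Y - u Y * u X = u ⁅X, Y⁆
  rw [hu, hu, hu]
  change _ = k * (X * Y - Y * X : Matrix ι ι ℝ) * l
  have e (A B : Matrix ι ι ℝ) : k * A * l * (k * B * l) = k * (A * B) * l := by
    calc k * A * l * (k * B * l) = k * A * (l * k) * B * l := by simp only [mul_assoc]
      _ = _ := by rw [hlk, mul_one]; simp only [mul_assoc]
  rw [e, e, mul_sub, sub_mul]

lemma trace_conj (hlk : l * k = 1) (hu : ∀ X, (u X : Matrix ι ι ℝ) = k * X * l)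
    (X Y : so ι ℝ) : ((u X : Matrix ι ι ℝ) * u Y).trace = ((X : Matrix ι ι ℝ) * Y).trace := by
  rw [hu, hu, trace_mul_comm, ← mul_assoc, mul_assoc (k * (Y : Matrix ι ι ℝ)), ← mul_assoc l,
    hlk, one_mul, trace_mul_comm, ← mul_assoc, ← mul_assoc, hlk, one_mul]
  exact trace_mul_comm _ _

lemma proj_conj (hI : Commute k D.I) (hJ : Commute k D.J) (hI' : Commute l D.I) (hJ' : Commute l D.J)
    (hu : ∀ X, (u X : Matrix ι ι ℝ) = k * X * l) (j : Option (Fin 6)) (X : so ι ℝ) :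
    D.proj j (u X) = u (D.proj j X) := by
  refine Subtype.ext ?_
  rw [hu, coe_proj, hu, coe_proj, D.matProj_conj j hI hJ hI' hJ']

lemma contracted_conj (hI : Commute k D.I) (hJ : Commute k D.J) (hI' : Commute l D.I) (hJ' : Commute l D.J)
    (hlk : l * k = 1) (hu : ∀ X, (u X : Matrix ι ι ℝ) = k * X * l)
    (X Y : so ι ℝ) : D.contracted (u X) (u Y) = u (D.contracted X Y) := by
  simp only [contracted_apply, map_sum, D.proj_conj u hI hJ hI' hJ' hu, conj_lie u hlk hu,
    apply_ite u, map_zero]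

end Conjugation

end BlockData
end

/-! ### Off-diagonal blocks and their brackets. -/

noncomputable section

namespace BlockData

open Matrix LieAlgebra.Orthogonal

variable {ι : Type*} [Fintype ι] [DecidableEq ι] (D : BlockData ι)

/-- The three orthogonal projections. -/
def idem : Fin 3 → Matrix ι ι ℝ := ![D.p, D.q, D.o]

lemma idem_mul_of_ne {i j : Fin 3} (h : i ≠ j) : D.idem i * D.idem j = 0 := by
  fin_cases i <;> fin_cases j <;> simp [idem] at h ⊢

lemma idem_transpose (i : Fin 3) : (D.idem i)ᵀ = D.idem i := by
  fin_cases i <;> simp [idem]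

/-- The matrix `x` maps the `j`-th summand to the `i`-th one and vanishes on the other summands. -/
structure IsBlock (i j : Fin 3) (x : Matrix ι ι ℝ) : Prop where
  left : D.idem i * x = x
  right : x * D.idem j = x

variable {D}

lemma IsBlock.transpose {i j : Fin 3} {x : Matrix ι ι ℝ} (h : D.IsBlock i j x) :
    D.IsBlock j i xᵀ where
  left := by rw [← D.idem_transpose, ← transpose_mul, h.right]
  right := by rw [← D.idem_transpose, ← transpose_mul, h.left]

lemma IsBlock.mul {i j k l : Fin 3} {x y : Matrix ι ι ℝ} (hx : D.IsBlock i j x)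
    (hy : D.IsBlock k l y) : D.IsBlock i l (x * y) where
  left := by rw [← mul_assoc, hx.left]
  right := by rw [mul_assoc, hy.right]

lemma IsBlock.mul_eq_zero {i j k l : Fin 3} {x y : Matrix ι ι ℝ} (hx : D.IsBlock i j x)
    (hy : D.IsBlock k l y) (h : j ≠ k) : x * y = 0 := by
  rw [← hx.right, ← hy.left, mul_assoc, ← mul_assoc (D.idem j), D.idem_mul_of_ne h, zero_mul,
    mul_zero]

lemma IsBlock.add {i j : Fin 3} {x y : Matrix ι ι ℝ} (hx : D.IsBlock i j x)
    (hy : D.IsBlock i j y) : D.IsBlock i j (x + y) where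
  left := by rw [mul_add, hx.left, hy.left]
  right := by rw [add_mul, hx.right, hy.right]

lemma IsBlock.smul {i j : Fin 3} {x : Matrix ι ι ℝ} (hx : D.IsBlock i j x) (r : ℝ) :
    D.IsBlock i j (r • x) where
  left := by rw [mul_smul_comm, hx.left]
  right := by rw [smul_mul_assoc, hx.right]

lemma IsBlock.neg {i j : Fin 3} {x : Matrix ι ι ℝ} (hx : D.IsBlock i j x) :
    D.IsBlock i j (-x) where
  left := by rw [mul_neg, hx.left]
  right := by rw [neg_mul, hx.right]

lemma IsBlock.sub {i j : Fin 3} {x y : Matrix ι ι ℝ} (hx : D.IsBlock i j x)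
    (hy : D.IsBlock i j y) : D.IsBlock i j (x - y) := by
  rw [sub_eq_add_neg]
  exact hx.add hy.neg

variable (D)

lemma isBlock_I : D.IsBlock 0 0 D.I := ⟨D.pI, D.Ip⟩

lemma isBlock_J : D.IsBlock 1 1 D.J := ⟨D.qJ, D.Jq⟩

lemma isBlock_p : D.IsBlock 0 0 D.p := ⟨D.pp, D.pp⟩

lemma isBlock_q : D.IsBlock 1 1 D.q := ⟨D.qq, D.qq⟩

lemma isBlock_o : D.IsBlock 2 2 D.o := ⟨D.oo, D.oo⟩

lemma IsBlock.sandwich {D : BlockData ι} {i j : Fin 3} {x y : Matrix ι ι ℝ} (hx : D.IsBlock i i x)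
    (hy : D.IsBlock j j y) (M : Matrix ι ι ℝ) : D.IsBlock i j (x * M * y) where
  left := by rw [← mul_assoc, ← mul_assoc, hx.left]
  right := by rw [mul_assoc, hy.right]

/-- The element `M - Mᵀ` of `𝔰𝔬`. -/
def alt : Matrix ι ι ℝ →ₗ[ℝ] so ι ℝ := (2 : ℝ) • skewPart

lemma coe_alt (M : Matrix ι ι ℝ) : (alt M : Matrix ι ι ℝ) = M - Mᵀ := by
  change (2 : ℝ) • (1 / 2 : ℝ) • (M - Mᵀ) = M - Mᵀ
  module

lemma alt_transpose (M : Matrix ι ι ℝ) : alt Mᵀ = -alt M := by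
  refine Subtype.ext ?_
  rw [coe_alt]
  change _ = -(alt M : Matrix ι ι ℝ)
  rw [coe_alt, transpose_transpose, neg_sub]

lemma proj_alt (k : Option (Fin 6)) (M : Matrix ι ι ℝ) :
    D.proj k (alt M) = alt (D.matProj k M) := by
  refine Subtype.ext ?_
  rw [coe_proj, coe_alt, coe_alt, map_sub, matProj_transpose]

variable {D}

/-- Of the eight products only x y and its transpose have matching inner blocks. -/
lemma lie_alt_alt {i j k : Fin 3} {x y : Matrix ι ι ℝ} (hx : D.IsBlock i j x)
    (hy : D.IsBlock j k y) (hij : i ≠ j) (hjk : j ≠ k) (hik : i ≠ k) :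
    ⁅alt x, alt y⁆ = alt (x * y) := by
  refine Subtype.ext ?_
  change (alt x : Matrix ι ι ℝ) * alt y - alt y * alt x = _
  simp only [coe_alt, sub_mul, mul_sub, hx.mul_eq_zero hy.transpose hjk,
    hx.transpose.mul_eq_zero hy hij, hx.transpose.mul_eq_zero hy.transpose hik,
    hy.mul_eq_zero hx hik.symm, hy.mul_eq_zero hx.transpose hjk.symm,
    hy.transpose.mul_eq_zero hx hij.symm, transpose_mul]
  abel

lemma lie_so_alt {j k : Fin 3} {z : so ι ℝ} {y : Matrix ι ι ℝ}
    (hz : D.IsBlock j j (z : Matrix ι ι ℝ)) (hy : D.IsBlock j k y) (hjk : j ≠ k) :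
    ⁅z, alt y⁆ = alt (z.1 * y) := by
  refine Subtype.ext ?_
  change (z : Matrix ι ι ℝ) * alt y - alt y * z = _
  simp only [coe_alt, sub_mul, mul_sub, hz.mul_eq_zero hy.transpose hjk,
    hy.mul_eq_zero hz hjk.symm, transpose_mul, so_transpose, mul_neg]
  abel

lemma lie_alt_alt_same {i j : Fin 3} {x y : Matrix ι ι ℝ} (hx : D.IsBlock i j x)
    (hy : D.IsBlock i j y) (hij : i ≠ j) :
    ⁅alt x, alt y⁆ = alt (y * xᵀ) + alt (yᵀ * x) := by
  refine Subtype.ext ?_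
  change (alt x : Matrix ι ι ℝ) * alt y - alt y * alt x = alt (y * xᵀ) + alt (yᵀ * x)
  simp only [coe_alt, sub_mul, mul_sub, hx.mul_eq_zero hy hij.symm, hy.mul_eq_zero hx hij.symm,
    hx.transpose.mul_eq_zero hy.transpose hij, hy.transpose.mul_eq_zero hx.transpose hij,
    transpose_mul, transpose_transpose]
  abel

lemma trace_alt_mul_alt {i j : Fin 3} {x y : Matrix ι ι ℝ} (hx : D.IsBlock i j x)
    (hy : D.IsBlock i j y) (hij : i ≠ j) :
    ((alt x : Matrix ι ι ℝ) * alt y).trace = -2 * (xᵀ * y).trace := by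
  have h : (x * yᵀ).trace = (xᵀ * y).trace := by
    rw [← trace_transpose, transpose_mul, transpose_transpose, trace_mul_comm]
  simp only [coe_alt, sub_mul, mul_sub, hx.mul_eq_zero hy hij.symm,
    hx.transpose.mul_eq_zero hy.transpose hij, trace_sub, trace_zero, h]
  ring

variable (D)

/-- The projections of the space of matrices whose antisymmetrizations are the projections of `𝔰𝔬`
onto the summands `2`, `3` and `5`. -/
def upper : Fin 6 → Matrix ι ι ℝ →ₗ[ℝ] Matrix ι ι ℝ :=
  ![0, 0, (1 / 2 : ℝ) • (sandwich D.p D.q - sandwich D.I D.J),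
    (1 / 2 : ℝ) • (sandwich D.p D.q + sandwich D.I D.J), sandwich D.p D.o, sandwich D.q D.o]

lemma upper_two (M : Matrix ι ι ℝ) :
    D.upper 2 M = (1 / 2 : ℝ) • (D.p * M * D.q - D.I * M * D.J) := by
  simp [upper, sandwich_apply]

lemma upper_three (M : Matrix ι ι ℝ) :
    D.upper 3 M = (1 / 2 : ℝ) • (D.p * M * D.q + D.I * M * D.J) := by
  simp [upper, sandwich_apply]

lemma upper_four (M : Matrix ι ι ℝ) : D.upper 4 M = D.p * M * D.o := by
  simp [upper, sandwich_apply]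

lemma upper_five (M : Matrix ι ι ℝ) : D.upper 5 M = D.q * M * D.o := by
  simp [upper, sandwich_apply]

lemma isBlock_upper_two (M : Matrix ι ι ℝ) : D.IsBlock 0 1 (D.upper 2 M) := by
  rw [upper_two]
  exact ((D.isBlock_p.sandwich D.isBlock_q M).sub (D.isBlock_I.sandwich D.isBlock_J M)).smul _

lemma isBlock_upper_three (M : Matrix ι ι ℝ) : D.IsBlock 0 1 (D.upper 3 M) := by
  rw [upper_three]
  exact ((D.isBlock_p.sandwich D.isBlock_q M).add (D.isBlock_I.sandwich D.isBlock_J M)).smul _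

lemma isBlock_upper_four (M : Matrix ι ι ℝ) : D.IsBlock 0 2 (D.upper 4 M) := by
  rw [upper_four]
  exact D.isBlock_p.sandwich D.isBlock_o M

lemma isBlock_upper_five (M : Matrix ι ι ℝ) : D.IsBlock 1 2 (D.upper 5 M) := by
  rw [upper_five]
  exact D.isBlock_q.sandwich D.isBlock_o M

lemma proj_eq_alt_upper {k : Fin 6} (hk : 2 ≤ k) (X : so ι ℝ) :
    D.proj (some k) X = alt (D.upper k X) := by
  refine Subtype.ext ?_
  rw [coe_proj, coe_alt]
  fin_cases k
  · simp at hk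
  · exact absurd hk (by decide)
  all_goals
    simp [matProj, upper, sandwich_apply, so_transpose, mul_assoc]
  all_goals module

lemma upper_upper {k : Fin 6} (M : Matrix ι ι ℝ) :
    D.upper k (D.upper k M) = D.upper k M := by
  have h1 (X Y Z : Matrix ι ι ℝ) (h : X * Y = Z) (W : Matrix ι ι ℝ) : X * (Y * W) = Z * W := by
    rw [← h, mul_assoc]
  fin_cases k <;> simp [upper, sandwich_apply, mul_assoc, mul_add, add_mul, mul_sub, sub_mul,
    h1 _ _ _ D.pp, h1 _ _ _ D.qq, h1 _ _ _ D.II, h1 _ _ _ D.pI, h1 _ _ _ D.Ip]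
  all_goals module

/-- For k ≥ 2 an element of the summand is determined by its block above the diagonal, which `upper`
cuts out and `alt` completes. Cyclicity moves the trace to the space of matrices; `hV` ensures that
the transposed block created by `alt` does not contribute. -/
lemma trace_proj_comp {k : Fin 6} (hk : 2 ≤ k) (T : Module.End ℝ (so ι ℝ))
    (V : Module.End ℝ (Matrix ι ι ℝ)) (h : ∀ M, T (alt (D.upper k M)) = alt (V M))
    (hV : ∀ M, D.upper k (V M)ᵀ = 0) :
    LinearMap.trace ℝ _ (D.proj (some k) ∘ₗ T) = LinearMap.trace ℝ _ (D.upper k ∘ₗ V) := by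
  have e1 : D.proj (some k) ∘ₗ T = (alt ∘ₗ D.upper k) ∘ₗ (D.upper k ∘ₗ toMatrix ∘ₗ T) := by
    refine LinearMap.ext fun X => ?_
    change D.proj (some k) (T X) = alt (D.upper k (D.upper k (T X)))
    rw [upper_upper, D.proj_eq_alt_upper hk]
  rw [e1, LinearMap.trace_comp_comm']
  congr 1
  refine LinearMap.ext fun M => ?_
  change D.upper k (T (alt (D.upper k M)) : so ι ℝ) = D.upper k (V M)
  rw [h, coe_alt, map_sub, hV, sub_zero]

end BlockData
end

/-! ### Structure constants of the isotropy summands: complex-linear and antilinear blocks, first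
values. -/

noncomputable section

namespace BlockData

open Matrix LieAlgebra.Orthogonal

variable {ι : Type*} [Fintype ι] [DecidableEq ι] (D : BlockData ι)

/-- The trace of `π_k ∘ ad Y ∘ π_l ∘ ad X`. -/
def tau (k l : Fin 6) (X Y : so ι ℝ) : ℝ :=
  LinearMap.trace ℝ (so ι ℝ) (D.proj (some k) ∘ₗ
    (LieAlgebra.ad ℝ (so ι ℝ) Y ∘ₗ D.proj (some l) ∘ₗ LieAlgebra.ad ℝ (so ι ℝ) X))

lemma tau_comm (k l : Fin 6) (X Y : so ι ℝ) : D.tau k l X Y = D.tau l k Y X := by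
  rw [tau, tau, ← LinearMap.comp_assoc, LinearMap.trace_comp_comm', LinearMap.comp_assoc]

/-- The trace form on `𝔰𝔬`. -/
def traceForm (X Y : so ι ℝ) : ℝ := ((X : Matrix ι ι ℝ) * Y).trace

/-- The splitting with the opposite complex structure on the second summand. -/
def flip : BlockData ι :=
  { D with
    J := -D.J
    JJ := by simp
    qJ := by simp
    Jq := by simp
    JT := by simp }

lemma flip_proj_two (X : so ι ℝ) : D.flip.proj (some 2) X = D.proj (some 3) X := by
  refine Subtype.ext ?_
  simp [coe_proj, matProj, sandwich_apply, flip]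

lemma flip_proj_three (X : so ι ℝ) : D.flip.proj (some 3) X = D.proj (some 2) X := by
  refine Subtype.ext ?_
  simp [coe_proj, matProj, sandwich_apply, flip, sub_eq_add_neg]

lemma flip_proj {k : Fin 6} (h2 : k ≠ 2) (h3 : k ≠ 3) (X : so ι ℝ) :
    D.flip.proj (some k) X = D.proj (some k) X := by
  refine Subtype.ext ?_
  fin_cases k <;> simp [coe_proj, matProj, sandwich_apply, flip] at h2 h3 ⊢

lemma I_mul_upper_two (M : Matrix ι ι ℝ) : D.I * D.upper 2 M = D.upper 2 M * D.J := by
  rw [upper_two, mul_smul_comm, smul_mul_assoc, mul_sub, sub_mul]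
  simp only [← mul_assoc, D.Ip, D.II]
  simp only [mul_assoc, D.qJ, D.JJ, mul_neg, neg_mul]
  module

lemma I_mul_upper_three (M : Matrix ι ι ℝ) : D.I * D.upper 3 M = -(D.upper 3 M * D.J) := by
  rw [upper_three, mul_smul_comm, smul_mul_assoc, mul_add, add_mul]
  simp only [← mul_assoc, D.Ip, D.II]
  simp only [mul_assoc, D.qJ, D.JJ, mul_neg, neg_mul]
  module

lemma exists_alt_two {X : so ι ℝ} (h : D.proj (some 2) X = X) :
    ∃ x, alt x = X ∧ D.IsBlock 0 1 x ∧ D.I * x = x * D.J :=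
  ⟨D.upper 2 X, by rw [← D.proj_eq_alt_upper (by decide), h], D.isBlock_upper_two _,
    D.I_mul_upper_two _⟩

lemma exists_alt_three {X : so ι ℝ} (h : D.proj (some 3) X = X) :
    ∃ x, alt x = X ∧ D.IsBlock 0 1 x ∧ D.I * x = -(x * D.J) :=
  ⟨D.upper 3 X, by rw [← D.proj_eq_alt_upper (by decide), h], D.isBlock_upper_three _,
    D.I_mul_upper_three _⟩

lemma exists_alt_four {X : so ι ℝ} (h : D.proj (some 4) X = X) :
    ∃ x, alt x = X ∧ D.IsBlock 0 2 x :=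
  ⟨D.upper 4 X, by rw [← D.proj_eq_alt_upper (by decide), h], D.isBlock_upper_four _⟩

lemma exists_alt_five {X : so ι ℝ} (h : D.proj (some 5) X = X) :
    ∃ x, alt x = X ∧ D.IsBlock 1 2 x :=
  ⟨D.upper 5 X, by rw [← D.proj_eq_alt_upper (by decide), h], D.isBlock_upper_five _⟩

lemma isBlock_one {X : so ι ℝ} (h : D.proj (some 1) X = X) :
    D.IsBlock 1 1 (X : Matrix ι ι ℝ) ∧ D.J * X.1 = -(X.1 * D.J) := by
  have e : (X : Matrix ι ι ℝ) = (1 / 2 : ℝ) • (D.q * X.1 * D.q + D.J * X.1 * D.J) := by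
    conv_lhs => rw [← h]
    simp [coe_proj, matProj, sandwich_apply]
  constructor
  · rw [e]
    exact ((D.isBlock_q.sandwich D.isBlock_q _).add (D.isBlock_J.sandwich D.isBlock_J _)).smul _
  · rw [e, mul_smul_comm, smul_mul_assoc, mul_add, add_mul]
    simp only [← mul_assoc, D.Jq, D.JJ]
    simp only [mul_assoc, D.qJ, D.JJ, mul_neg, neg_mul]
    module

variable {D}

lemma matProj_of_isBlock_zero_two {v : Matrix ι ι ℝ} (hv : D.IsBlock 0 2 v) :
    D.matProj (some 4) v = v := by
  have h1 : D.o * v = 0 := D.isBlock_o.mul_eq_zero hv (by decide)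
  have h2 : D.p * v = v := hv.left
  have h3 : v * D.o = v := hv.right
  simp [matProj, sandwich_apply, h1, h2, h3]

lemma matProj_of_isBlock_one_two {v : Matrix ι ι ℝ} (hv : D.IsBlock 1 2 v) :
    D.matProj (some 5) v = v := by
  have h1 : D.o * v = 0 := D.isBlock_o.mul_eq_zero hv (by decide)
  have h2 : D.q * v = v := hv.left
  have h3 : v * D.o = v := hv.right
  simp [matProj, sandwich_apply, h1, h2, h3]

lemma matProj_three_of_isBlock {v : Matrix ι ι ℝ} (hv : D.IsBlock 0 1 v) :
    D.matProj (some 3) v = (1 / 2 : ℝ) • (v + D.I * v * D.J) := by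
  have h1 : D.q * v = 0 := D.isBlock_q.mul_eq_zero hv (by decide)
  have h2 : D.J * v = 0 := D.isBlock_J.mul_eq_zero hv (by decide)
  have h3 : D.p * v = v := hv.left
  have h4 : v * D.q = v := hv.right
  simp [matProj, sandwich_apply, h1, h2, h3, h4]

lemma matProj_one_eq_zero {i j : Fin 3} {v : Matrix ι ι ℝ} (hv : D.IsBlock i j v) (hi : 1 ≠ i) :
    D.matProj (some 1) v = 0 := by
  have h1 : D.q * v = 0 := D.isBlock_q.mul_eq_zero hv hi
  have h2 : D.J * v = 0 := D.isBlock_J.mul_eq_zero hv hi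
  simp [matProj, sandwich_apply, h1, h2]

lemma matProj_one_of_isBlock {v : Matrix ι ι ℝ} (hv : D.IsBlock 1 1 v) :
    D.matProj (some 1) v = (1 / 2 : ℝ) • (v + D.J * v * D.J) := by
  have h1 : D.q * v = v := hv.left
  have h2 : v * D.q = v := hv.right
  simp [matProj, sandwich_apply, h1, h2]

lemma upper_two_of_isBlock {v : Matrix ι ι ℝ} (hv : D.IsBlock 1 0 v) : D.upper 2 v = 0 := by
  rw [upper_two, show D.p * v = 0 from D.isBlock_p.mul_eq_zero hv (by decide),
    show D.I * v = 0 from D.isBlock_I.mul_eq_zero hv (by decide)]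
  simp

lemma upper_three_of_isBlock {v : Matrix ι ι ℝ} (hv : D.IsBlock 1 0 v) : D.upper 3 v = 0 := by
  rw [upper_three, show D.p * v = 0 from D.isBlock_p.mul_eq_zero hv (by decide),
    show D.I * v = 0 from D.isBlock_I.mul_eq_zero hv (by decide)]
  simp

lemma upper_five_of_isBlock {v : Matrix ι ι ℝ} (hv : D.IsBlock 2 1 v) : D.upper 5 v = 0 := by
  rw [upper_five, show D.q * v = 0 from D.isBlock_q.mul_eq_zero hv (by decide)]
  simp

variable (D)

lemma matProj_three_eq_self {D : BlockData ι} {v : Matrix ι ι ℝ} (hv : D.IsBlock 0 1 v)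
    (h : D.I * v = -(v * D.J)) : D.matProj (some 3) v = v := by
  have h4 : v * D.q = v := hv.right
  rw [matProj_three_of_isBlock hv, h, neg_mul, mul_assoc, D.JJ, mul_neg, neg_neg, h4]
  module

lemma matProj_one_eq_self {D : BlockData ι} {v : Matrix ι ι ℝ} (hv : D.IsBlock 1 1 v)
    (h : D.J * v = -(v * D.J)) : D.matProj (some 1) v = v := by
  have h4 : v * D.q = v := hv.right
  rw [matProj_one_of_isBlock hv, h, neg_mul, mul_assoc, D.JJ, mul_neg, neg_neg, h4]
  module

variable {D} in
lemma lie_so_alt' {i j : Fin 3} {z : so ι ℝ} {v : Matrix ι ι ℝ}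
    (hz : D.IsBlock j j (z : Matrix ι ι ℝ)) (hv : D.IsBlock i j v) (hij : j ≠ i) :
    ⁅z, alt v⁆ = -alt (v * z.1) := by
  have h1 : alt v = -alt vᵀ := by rw [alt_transpose, neg_neg]
  have h2 : z.1 * vᵀ = -(v * z.1)ᵀ := by rw [transpose_mul, so_transpose, neg_mul, neg_neg]
  rw [h1, lie_neg, lie_so_alt hz hv.transpose hij, h2, map_neg, alt_transpose, neg_neg]

/-- X and Y anticommute with J, so right multiplication by X carries complex-linear blocks to
antilinear ones with no loss, and the composite is w ↦ w X Y. On complex-linear blocks its trace is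
half of tr p · tr(X Y), the correction being a multiple of tr I = 0. -/
lemma tau_two_three {X Y : so ι ℝ} (hX : D.proj (some 1) X = X) (hY : D.proj (some 1) Y = Y) :
    D.tau 2 3 X Y = D.p.trace / 2 * traceForm X Y := by
  obtain ⟨hXb, hXJ⟩ := D.isBlock_one hX
  obtain ⟨hYb, hYJ⟩ := D.isBlock_one hY
  rw [tau, D.trace_proj_comp (k := 2) (by decide) _ (sandwich 1 (X.1 * Y.1) ∘ₗ D.upper 2)]
  · have hq : X.1 * Y.1 * D.q = X.1 * Y.1 := (hXb.mul hYb).right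
    have hJ : X.1 * Y.1 * D.J = D.J * (X.1 * Y.1) := by
      rw [mul_assoc, ← neg_eq_iff_eq_neg.2 hYJ, mul_neg, ← mul_assoc, ← mul_assoc, hXJ, neg_mul]
    have hq' : D.q * (X.1 * Y.1) = X.1 * Y.1 := (hXb.mul hYb).left
    have e : D.upper 2 ∘ₗ sandwich 1 (X.1 * Y.1) ∘ₗ D.upper 2 =
        (1 / 2 : ℝ) • (sandwich D.p (X.1 * Y.1) - sandwich D.I (D.J * (X.1 * Y.1))) := by
      refine LinearMap.ext fun M => ?_
      change D.upper 2 (sandwich 1 (X.1 * Y.1) (D.upper 2 M)) =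
        (1 / 2 : ℝ) • (sandwich D.p (X.1 * Y.1) M - sandwich D.I (D.J * (X.1 * Y.1)) M)
      have h1 : D.I * D.upper 2 M = D.upper 2 M * D.J := D.I_mul_upper_two M
      have h2 : D.p * D.upper 2 M = D.upper 2 M := (D.isBlock_upper_two M).left
      rw [upper_two, sandwich_apply, one_mul, ← mul_assoc D.p, h2, ← mul_assoc D.I, h1,
        mul_assoc _ _ D.q, hq, mul_assoc (D.upper 2 M), mul_assoc, mul_assoc, hJ,
        ← mul_assoc D.J, D.JJ, neg_mul, hq', upper_two, sandwich_apply, sandwich_apply]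
      simp only [smul_mul_assoc, sub_mul, mul_assoc, hq', mul_neg]
      module
    rw [e, map_smul, map_sub, trace_sandwich, trace_sandwich, D.trace_I, smul_eq_mul, traceForm]
    ring
  · intro M
    have hw : D.IsBlock 0 1 (D.upper 2 M) := D.isBlock_upper_two M
    have hwJ : D.I * D.upper 2 M = D.upper 2 M * D.J := D.I_mul_upper_two M
    change ⁅Y, D.proj (some 3) ⁅X, alt (D.upper 2 M)⁆⁆ = _
    rw [lie_so_alt' hXb hw (by decide), map_neg, proj_alt,
      matProj_three_eq_self (hw.mul hXb) (by
        rw [← mul_assoc, hwJ, mul_assoc, hXJ, mul_neg, mul_assoc]),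
      lie_neg, lie_so_alt' hYb (hw.mul hXb) (by decide), neg_neg, LinearMap.comp_apply,
      sandwich_apply, one_mul, mul_assoc]
  · intro M
    refine upper_two_of_isBlock (D := D) ?_
    rw [LinearMap.comp_apply, sandwich_apply, one_mul]
    exact ((D.isBlock_upper_two M).mul (hXb.mul hYb)).transpose

lemma tau_five_five {X Y : so ι ℝ} (hX : D.proj (some 1) X = X) (hY : D.proj (some 1) Y = Y) :
    D.tau 5 5 X Y = D.o.trace * traceForm X Y := by
  obtain ⟨hXb, hXJ⟩ := D.isBlock_one hX
  obtain ⟨hYb, hYJ⟩ := D.isBlock_one hY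
  have hXq : X.1 * D.q = X.1 := hXb.right
  have hYq : D.q * Y.1 = Y.1 := hYb.left
  rw [tau, D.trace_proj_comp (k := 5) (by decide) _ (sandwich (Y.1 * X.1) D.o)]
  · have e : D.upper 5 ∘ₗ sandwich (Y.1 * X.1) D.o = sandwich (Y.1 * X.1) D.o := by
      refine LinearMap.ext fun M => ?_
      rw [LinearMap.comp_apply, upper_five, sandwich_apply]
      simp only [mul_assoc, D.oo]
      rw [← mul_assoc, hYq]
    rw [e, trace_sandwich, traceForm, trace_mul_comm X.1]
    ring
  · intro M
    have hw : D.IsBlock 1 2 (D.upper 5 M) := D.isBlock_upper_five M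
    change ⁅Y, D.proj (some 5) ⁅X, alt (D.upper 5 M)⁆⁆ = _
    rw [lie_so_alt hXb hw (by decide), proj_alt, matProj_of_isBlock_one_two (hXb.mul hw),
      lie_so_alt hYb (hXb.mul hw) (by decide), upper_five, sandwich_apply]
    simp only [← mul_assoc]
    rw [mul_assoc Y.1, hXq]
  · intro M
    rw [sandwich_apply]
    exact upper_five_of_isBlock ((hYb.mul hXb).sandwich D.isBlock_o M).transpose

/-- The product x w fills out summand 4 whether x is complex linear or antilinear, so one formula
serves the summands 2 and 3. -/
lemma tau_five_four {x y : Matrix ι ι ℝ} (hx : D.IsBlock 0 1 x) (hy : D.IsBlock 0 1 y) :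
    D.tau 5 4 (alt x) (alt y) = D.o.trace / 2 * traceForm (alt x) (alt y) := by
  have hxq : x * D.q = x := hx.right
  have hyq : D.q * yᵀ = yᵀ := hy.transpose.left
  have hyx : D.IsBlock 1 1 (yᵀ * x) := hy.transpose.mul hx
  rw [tau, D.trace_proj_comp (k := 5) (by decide) _ (-sandwich (yᵀ * x) D.o)]
  · have e : D.upper 5 ∘ₗ (-sandwich (yᵀ * x) D.o) = -sandwich (yᵀ * x) D.o := by
      refine LinearMap.ext fun M => ?_
      rw [LinearMap.comp_apply, LinearMap.neg_apply, map_neg, upper_five, sandwich_apply]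
      simp only [mul_assoc, D.oo]
      rw [← mul_assoc, hyq]
    rw [e, map_neg, trace_sandwich, traceForm, trace_alt_mul_alt hx hy (by decide),
      ← trace_transpose (yᵀ * x), transpose_mul, transpose_transpose]
    ring
  · intro M
    have hw : D.IsBlock 1 2 (D.upper 5 M) := D.isBlock_upper_five M
    change ⁅alt y, D.proj (some 4) ⁅alt x, alt (D.upper 5 M)⁆⁆ = _
    have h1 : alt y = -alt yᵀ := by rw [alt_transpose, neg_neg]
    rw [lie_alt_alt hx hw (by decide) (by decide) (by decide), proj_alt,
      matProj_of_isBlock_zero_two (hx.mul hw), h1, neg_lie,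
      lie_alt_alt hy.transpose (hx.mul hw) (by decide) (by decide) (by decide), ← map_neg,
      upper_five, LinearMap.neg_apply, sandwich_apply]
    simp only [← mul_assoc]
    rw [mul_assoc yᵀ, hxq]
  · intro M
    rw [LinearMap.neg_apply, sandwich_apply]
    exact upper_five_of_isBlock (hyx.sandwich D.isBlock_o M).neg.transpose

end BlockData
end

/-! ### Structure constants: the remaining values, and the reversal of J. -/

noncomputable section

namespace BlockData

open Matrix LieAlgebra.Orthogonal

variable {ι : Type*} [Fintype ι] [DecidableEq ι] (D : BlockData ι)

lemma upper_three_eq_self {D : BlockData ι} {v : Matrix ι ι ℝ} (hv : D.IsBlock 0 1 v)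
    (h : D.I * v = -(v * D.J)) : D.upper 3 v = v := by
  have h3 : D.p * v = v := hv.left
  have h4 : v * D.q = v := hv.right
  rw [upper_three, h, h3, h4, neg_mul, mul_assoc, D.JJ, mul_neg, neg_neg, h4]
  module

lemma isBlock_alt {D : BlockData ι} {i : Fin 3} {v : Matrix ι ι ℝ} (hv : D.IsBlock i i v) :
    D.IsBlock i i (alt v : Matrix ι ι ℝ) := by
  rw [coe_alt]
  exact hv.sub hv.transpose

/-- The composite is w ↦ y (wᵀx − xᵀw). The second term contributes the multiple of tr q; the first
involves wᵀ and contributes the −1, reflecting that summand 1 consists of skew matrices. -/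
lemma tau_three_one {X Y : so ι ℝ} (hX : D.proj (some 2) X = X) (hY : D.proj (some 2) Y = Y) :
    D.tau 3 1 X Y = (D.q.trace / 2 - 1) / 2 * traceForm X Y := by
  obtain ⟨x, rfl, hx, hxJ⟩ := D.exists_alt_two hX
  obtain ⟨y, rfl, hy, hyJ⟩ := D.exists_alt_two hY
  obtain ⟨V, hVe⟩ : ∃ V : Module.End ℝ (Matrix ι ι ℝ), V = (1 / 2 : ℝ) • (sandwichT y x +
      sandwichT (y * D.J) (D.I * x) - sandwich (y * xᵀ) D.q - sandwich (y * xᵀ * D.I) D.J) :=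
    ⟨_, rfl⟩
  have hV : ∀ M, V M = y * (alt ((D.upper 3 M)ᵀ * x)).1 := by
    intro M
    rw [hVe]
    have h2 : y * D.q = y := hy.right
    have h3 : D.p * x = x := hx.left
    have e (Z : Matrix ι ι ℝ) : y * (D.q * Z) = y * Z := by rw [← mul_assoc, h2]
    rw [coe_alt, upper_three]
    simp only [LinearMap.smul_apply, LinearMap.sub_apply, LinearMap.add_apply, sandwich_apply,
      sandwichT_apply, transpose_smul, transpose_add, transpose_mul, D.pT, D.qT, D.IT, D.JT,
      transpose_transpose, mul_assoc, mul_add, mul_sub, add_mul, smul_mul_assoc, mul_smul_comm,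
      neg_mul, mul_neg, neg_neg, e, h3]
    module
  have hZ : ∀ M, D.J * ((D.upper 3 M)ᵀ * x) = -((D.upper 3 M)ᵀ * x * D.J) := by
    intro M
    have h := congrArg transpose (D.I_mul_upper_three M)
    rw [transpose_mul, transpose_neg, transpose_mul, D.IT, D.JT, neg_mul, neg_neg, mul_neg] at h
    rw [← mul_assoc, ← h, neg_mul, mul_assoc, mul_assoc, hxJ]
  have hZ' : ∀ M, D.J * (alt ((D.upper 3 M)ᵀ * x)).1 = -((alt ((D.upper 3 M)ᵀ * x)).1 * D.J) := by
    intro M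
    have h := congrArg transpose (hZ M)
    rw [transpose_mul, transpose_neg, transpose_mul _ D.J, D.JT, mul_neg, neg_mul, neg_neg] at h
    rw [coe_alt, mul_sub, sub_mul, hZ, ← h]
    abel
  have hb : ∀ M, D.IsBlock 1 1 (alt ((D.upper 3 M)ᵀ * x)).1 := fun M =>
    isBlock_alt ((D.isBlock_upper_three M).transpose.mul hx)
  have e : D.upper 3 ∘ₗ V = V := by
    refine LinearMap.ext fun M => ?_
    rw [LinearMap.comp_apply, hV M]
    refine upper_three_eq_self (hy.mul (hb M)) ?_
    rw [← mul_assoc, hyJ, mul_assoc, hZ', mul_neg, mul_assoc]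
  rw [tau, D.trace_proj_comp (k := 3) (by decide) _ V]
  · rw [e, hVe]
    · have h1 : ((y * D.J)ᵀ * (D.I * x)).trace = (yᵀ * x).trace := by
        rw [transpose_mul, D.JT, hxJ, trace_mul_comm, mul_assoc, neg_mul, mul_neg, ← mul_assoc D.J,
          D.JJ, neg_mul, neg_neg, ← mul_assoc, show x * D.q = x from hx.right, trace_mul_comm]
      have h2 : (y * xᵀ).trace = (xᵀ * y).trace := trace_mul_comm _ _
      have h3 : (yᵀ * x).trace = (xᵀ * y).trace := by
        rw [← trace_transpose, transpose_mul, transpose_transpose]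
      rw [map_smul, map_sub, map_sub, map_add, trace_sandwichT, trace_sandwichT, trace_sandwich,
        trace_sandwich, D.trace_J, traceForm, trace_alt_mul_alt hx hy (by decide), h1, h2, h3,
        smul_eq_mul]
      ring
  · intro M
    have hw : D.IsBlock 0 1 (D.upper 3 M) := D.isBlock_upper_three M
    change ⁅alt y, D.proj (some 1) ⁅alt x, alt (D.upper 3 M)⁆⁆ = _
    rw [hV M, lie_alt_alt_same hx hw (by decide), map_add, proj_alt, proj_alt,
      matProj_one_eq_zero (hw.mul hx.transpose) (by decide), map_zero, zero_add,
      matProj_one_eq_self (hw.transpose.mul hx) (hZ M), ← lie_skew,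
      lie_so_alt' (hb M) hy (by decide), neg_neg]
  · intro M
    rw [hV M]
    exact upper_three_of_isBlock (hy.mul (hb M)).transpose

lemma tau_five_three {X Y : so ι ℝ} (hX : D.proj (some 4) X = X) (hY : D.proj (some 4) Y = Y) :
    D.tau 5 3 X Y = D.q.trace / 4 * traceForm X Y := by
  obtain ⟨x, rfl, hx⟩ := D.exists_alt_four hX
  obtain ⟨y, rfl, hy⟩ := D.exists_alt_four hY
  have hxo : D.o * xᵀ = xᵀ := hx.transpose.left
  have hyo : y * D.o = y := hy.right
  rw [tau, D.trace_proj_comp (k := 5) (by decide) _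
    (-(1 / 2 : ℝ) • (sandwich D.q (xᵀ * y) + sandwich D.J (xᵀ * D.I * y)))]
  · have e : D.upper 5 ∘ₗ (-(1 / 2 : ℝ) • (sandwich D.q (xᵀ * y) + sandwich D.J (xᵀ * D.I * y))) =
        -(1 / 2 : ℝ) • (sandwich D.q (xᵀ * y) + sandwich D.J (xᵀ * D.I * y)) := by
      refine LinearMap.ext fun M => ?_
      rw [LinearMap.comp_apply, upper_five]
      simp only [LinearMap.smul_apply, LinearMap.add_apply, sandwich_apply, mul_assoc, hyo,
        mul_smul_comm, smul_mul_assoc, mul_add, add_mul]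
      rw [← mul_assoc, D.qq, ← mul_assoc D.q D.J, D.qJ]
    rw [e, map_smul, map_add, trace_sandwich, trace_sandwich, D.trace_J, traceForm,
      trace_alt_mul_alt hx hy (by decide), smul_eq_mul]
    ring
  · intro M
    have hw : D.IsBlock 1 2 (D.upper 5 M) := D.isBlock_upper_five M
    have hv : D.IsBlock 0 1 (x * (D.upper 5 M)ᵀ) := hx.mul hw.transpose
    change ⁅alt y, D.proj (some 3) ⁅alt x, alt (D.upper 5 M)⁆⁆ = _
    have h1 : alt (D.upper 5 M) = -alt (D.upper 5 M)ᵀ := by rw [alt_transpose, neg_neg]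
    have h2 : D.IsBlock 0 1 ((1 / 2 : ℝ) • (x * (D.upper 5 M)ᵀ + D.I * (x * (D.upper 5 M)ᵀ) * D.J)) :=
      (hv.add (D.isBlock_I.sandwich D.isBlock_J _)).smul _
    rw [h1, lie_neg, lie_alt_alt hx hw.transpose (by decide) (by decide) (by decide), map_neg,
      proj_alt, matProj_three_of_isBlock hv, ← alt_transpose, ← lie_skew,
      lie_alt_alt h2.transpose hy (by decide) (by decide) (by decide), ← map_neg, upper_five]
    congr 1
    simp only [LinearMap.smul_apply, LinearMap.add_apply, sandwich_apply, transpose_smul,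
      transpose_add, transpose_mul, transpose_transpose, D.IT, D.JT, D.qT, D.oT, smul_mul_assoc,
      add_mul, mul_assoc, neg_mul, mul_neg, neg_neg]
    rw [← mul_assoc D.o, hxo, ← mul_assoc D.J, D.Jq, ← mul_assoc D.o, hxo]
    module
  · intro M
    refine upper_five_of_isBlock (D := D) (IsBlock.transpose ?_)
    have hI : D.IsBlock 1 2 (D.J * M * (xᵀ * D.I * y)) :=
      ⟨by rw [← mul_assoc, ← mul_assoc (D.idem 1), show D.idem 1 * D.J = D.J from D.qJ],
        by rw [mul_assoc, mul_assoc (xᵀ * D.I), hy.right]⟩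
    have hq : D.IsBlock 1 2 (D.q * M * (xᵀ * y)) :=
      ⟨by rw [← mul_assoc, ← mul_assoc (D.idem 1), show D.idem 1 * D.q = D.q from D.qq],
        by rw [mul_assoc, mul_assoc xᵀ, hy.right]⟩
    rw [LinearMap.smul_apply, LinearMap.add_apply, sandwich_apply, sandwich_apply]
    exact (hq.add hI).smul _

/-- The block w x yᵀ has components in the summands 2 and 3, and only the first is traced. This
makes the factor 1/4 rather than 1/2. -/
lemma tau_two_four {X Y : so ι ℝ} (hX : D.proj (some 5) X = X) (hY : D.proj (some 5) Y = Y) :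
    D.tau 2 4 X Y = D.p.trace / 4 * traceForm X Y := by
  obtain ⟨x, rfl, hx⟩ := D.exists_alt_five hX
  obtain ⟨y, rfl, hy⟩ := D.exists_alt_five hY
  have hxq : D.q * x = x := hx.left
  have hyq : yᵀ * D.q = yᵀ := hy.transpose.right
  rw [tau, D.trace_proj_comp (k := 2) (by decide) _ (-(sandwich 1 (x * yᵀ) ∘ₗ D.upper 2))]
  · have e : D.upper 2 ∘ₗ (-(sandwich 1 (x * yᵀ) ∘ₗ D.upper 2)) =
        -(1 / 4 : ℝ) • (sandwich D.p (x * yᵀ) - sandwich D.I (D.J * (x * yᵀ))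
        - sandwich D.I (x * yᵀ * D.J) - sandwich D.p (D.J * (x * yᵀ) * D.J)) := by
      refine LinearMap.ext fun M => ?_
      have h1 (X Y Z : Matrix ι ι ℝ) (h : X * Y = Z) (W : Matrix ι ι ℝ) : X * (Y * W) = Z * W := by
        rw [← h, mul_assoc]
      rw [LinearMap.comp_apply, LinearMap.neg_apply, LinearMap.comp_apply, map_neg, upper_two,
        sandwich_apply, upper_two]
      simp only [LinearMap.smul_apply, LinearMap.sub_apply, sandwich_apply, mul_assoc, hyq,
        mul_smul_comm, smul_mul_assoc, mul_sub, sub_mul, one_mul, h1 _ _ _ D.pp, h1 _ _ _ D.pI,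
        h1 _ _ _ D.Ip, h1 _ _ _ D.II, h1 _ _ _ hxq, neg_mul]
      module
    have h3 : (x * yᵀ).trace = (xᵀ * y).trace := by
      rw [← trace_transpose, transpose_mul, transpose_transpose, trace_mul_comm]
    have h4 : (D.J * (x * yᵀ) * D.J).trace = -(xᵀ * y).trace := by
      rw [trace_mul_comm, ← mul_assoc, D.JJ, neg_mul, ← mul_assoc, hxq, trace_neg, h3]
    rw [e, map_smul, map_sub, map_sub, map_sub, trace_sandwich, trace_sandwich, trace_sandwich,
      trace_sandwich, D.trace_I, traceForm, trace_alt_mul_alt hx hy (by decide), smul_eq_mul, h3,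
      h4]
    ring
  · intro M
    have hw : D.IsBlock 0 1 (D.upper 2 M) := D.isBlock_upper_two M
    change ⁅alt y, D.proj (some 4) ⁅alt x, alt (D.upper 2 M)⁆⁆ = _
    have h1 : alt y = -alt yᵀ := by rw [alt_transpose, neg_neg]
    rw [← lie_skew (alt x), lie_alt_alt hw hx (by decide) (by decide) (by decide), map_neg,
      proj_alt, matProj_of_isBlock_zero_two (hw.mul hx), lie_neg, lie_skew, h1, lie_neg,
      lie_alt_alt (hw.mul hx) hy.transpose (by decide) (by decide) (by decide), ← map_neg,
      LinearMap.neg_apply, LinearMap.comp_apply, sandwich_apply, one_mul, mul_assoc]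
  · intro M
    refine upper_two_of_isBlock (D := D) ?_
    rw [LinearMap.neg_apply, LinearMap.comp_apply, sandwich_apply, one_mul]
    exact ((D.isBlock_upper_two M).mul (hx.mul hy.transpose)).neg.transpose

lemma tau_five_one {X Y : so ι ℝ} (hX : D.proj (some 5) X = X) (hY : D.proj (some 5) Y = Y) :
    D.tau 5 1 X Y = (D.q.trace / 2 - 1) / 2 * traceForm X Y := by
  obtain ⟨x, rfl, hx⟩ := D.exists_alt_five hX
  obtain ⟨y, rfl, hy⟩ := D.exists_alt_five hY
  have hb : ∀ M, D.IsBlock 1 1 (D.upper 5 M * xᵀ) := fun M =>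
    (D.isBlock_upper_five M).mul hx.transpose
  have hb' : ∀ M, D.IsBlock 1 1 ((1 / 2 : ℝ) • (D.upper 5 M * xᵀ + D.J * (D.upper 5 M * xᵀ) * D.J)) :=
    fun M => ((hb M).add (D.isBlock_J.sandwich D.isBlock_J _)).smul _
  -- V expands w ↦ −π₁(w xᵀ − x wᵀ) y into sandwiches; the two transposed ones give the −1.
  obtain ⟨V, hVe⟩ : ∃ V : Module.End ℝ (Matrix ι ι ℝ), V = -(1 / 2 : ℝ) • (sandwich D.q (xᵀ * y) -
      sandwichT x y + sandwich D.J (xᵀ * D.J * y) - sandwichT (D.J * x) (D.J * y)) := ⟨_, rfl⟩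
  have hV : ∀ M, V M = -((alt ((1 / 2 : ℝ) • (D.upper 5 M * xᵀ + D.J * (D.upper 5 M * xᵀ) * D.J))).1 * y) := by
    intro M
    rw [hVe]
    have h1 : D.o * xᵀ = xᵀ := hx.transpose.left
    have h1' : x * D.o = x := hx.right
    have h2 : D.q * y = y := hy.left
    have h5 (Z : Matrix ι ι ℝ) : D.J * (D.q * Z) = D.J * Z := by rw [← mul_assoc, D.Jq]
    rw [coe_alt, upper_five]
    simp only [LinearMap.smul_apply, LinearMap.sub_apply, LinearMap.add_apply, sandwich_apply,
      sandwichT_apply, transpose_smul, transpose_add, transpose_mul, D.qT, D.JT,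
      transpose_transpose, mul_assoc, add_mul, sub_mul, smul_mul_assoc,
      neg_mul, mul_neg, neg_neg, h1, h2, h5]
    module
  have e : D.upper 5 ∘ₗ V = V := by
    refine LinearMap.ext fun M => ?_
    rw [LinearMap.comp_apply, hV M]
    have := ((isBlock_alt (hb' M)).mul hy).neg
    rw [upper_five, show D.q * _ = _ from this.left, show _ * D.o = _ from this.right]
  rw [tau, D.trace_proj_comp (k := 5) (by decide) _ V]
  · rw [e, hVe]
    · have h1 : ((D.J * x)ᵀ * (D.J * y)).trace = (xᵀ * y).trace := by
        rw [transpose_mul, D.JT, mul_assoc, neg_mul, ← mul_assoc D.J, D.JJ, neg_mul, neg_neg,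
          show D.q * y = y from hy.left]
      rw [map_smul, map_sub, map_add, map_sub, trace_sandwichT, trace_sandwichT, trace_sandwich,
        trace_sandwich, D.trace_J, traceForm, trace_alt_mul_alt hx hy (by decide), h1,
        smul_eq_mul]
      ring
  · intro M
    have hw : D.IsBlock 1 2 (D.upper 5 M) := D.isBlock_upper_five M
    change ⁅alt y, D.proj (some 1) ⁅alt x, alt (D.upper 5 M)⁆⁆ = _
    rw [hV M, lie_alt_alt_same hx hw (by decide), map_add, proj_alt, proj_alt,
      matProj_one_eq_zero (hw.transpose.mul hx) (by decide), map_zero, add_zero,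
      matProj_one_of_isBlock (hb M), ← lie_skew,
      lie_so_alt (isBlock_alt (hb' M)) hy (by decide), map_neg]
  · intro M
    rw [hV M]
    exact upper_five_of_isBlock ((isBlock_alt (hb' M)).mul hy).neg.transpose

/-- Reversing J exchanges the summands 2 and 3 and fixes the others, so each constant involving one
of them yields its counterpart for the other. -/
lemma flip_tau_three_one (X Y : so ι ℝ) : D.flip.tau 3 1 X Y = D.tau 2 1 X Y := by
  have h3 : D.flip.proj (some 3) = D.proj (some 2) := LinearMap.ext D.flip_proj_three
  have h1 : D.flip.proj (some 1) = D.proj (some 1) :=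
    LinearMap.ext (D.flip_proj (by decide) (by decide))
  rw [tau, tau, h3, h1]

lemma flip_tau_five_three (X Y : so ι ℝ) : D.flip.tau 5 3 X Y = D.tau 5 2 X Y := by
  have h3 : D.flip.proj (some 3) = D.proj (some 2) := LinearMap.ext D.flip_proj_three
  have h1 : D.flip.proj (some 5) = D.proj (some 5) :=
    LinearMap.ext (D.flip_proj (by decide) (by decide))
  rw [tau, tau, h3, h1]

lemma flip_tau_two_four (X Y : so ι ℝ) : D.flip.tau 2 4 X Y = D.tau 3 4 X Y := by
  have h3 : D.flip.proj (some 2) = D.proj (some 3) := LinearMap.ext D.flip_proj_two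
  have h1 : D.flip.proj (some 4) = D.proj (some 4) :=
    LinearMap.ext (D.flip_proj (by decide) (by decide))
  rw [tau, tau, h3, h1]

lemma tau_two_one {X Y : so ι ℝ} (hX : D.proj (some 3) X = X) (hY : D.proj (some 3) Y = Y) :
    D.tau 2 1 X Y = (D.q.trace / 2 - 1) / 2 * traceForm X Y := by
  rw [← flip_tau_three_one, D.flip.tau_three_one (by rwa [flip_proj_two])
    (by rwa [flip_proj_two])]
  rfl

lemma tau_five_two {X Y : so ι ℝ} (hX : D.proj (some 4) X = X) (hY : D.proj (some 4) Y = Y) :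
    D.tau 5 2 X Y = D.q.trace / 4 * traceForm X Y := by
  rw [← flip_tau_five_three, D.flip.tau_five_three (by rwa [flip_proj _ (by decide) (by decide)])
    (by rwa [flip_proj _ (by decide) (by decide)])]
  rfl

lemma tau_three_four {X Y : so ι ℝ} (hX : D.proj (some 5) X = X) (hY : D.proj (some 5) Y = Y) :
    D.tau 3 4 X Y = D.p.trace / 4 * traceForm X Y := by
  rw [← flip_tau_two_four, D.flip.tau_two_four (by rwa [flip_proj _ (by decide) (by decide)])
    (by rwa [flip_proj _ (by decide) (by decide)])]
  rfl

end BlockData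
end

/-! ### Orthogonality, the invariant forms, and the metric adjoint of the contracted bracket. -/

noncomputable section

namespace BlockData

open Matrix LieAlgebra.Orthogonal

variable {ι : Type*} [Fintype ι] [DecidableEq ι] (D : BlockData ι)

lemma traceForm_comm (X Y : so ι ℝ) : traceForm X Y = traceForm Y X := trace_mul_comm _ _

lemma traceForm_lie (X Y Z : so ι ℝ) : traceForm ⁅X, Y⁆ Z = -traceForm Y ⁅X, Z⁆ := by
  change ((X.1 * Y.1 - Y.1 * X.1) * Z.1).trace = -(Y.1 * (X.1 * Z.1 - Z.1 * X.1)).trace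
  rw [sub_mul, mul_sub, trace_sub, trace_sub, mul_assoc X.1, trace_mul_comm X.1]
  simp only [mul_assoc]
  ring

/-- (ad Z)² is self-adjoint for the invariant trace form and has different eigenvalues on the two
summands. -/
lemma traceForm_proj_of_ne {k l : Option (Fin 6)} (h : k ≠ l) (X Y : so ι ℝ) :
    traceForm (D.proj k X) (D.proj l Y) = 0 := by
  have h1 : traceForm ⁅D.centerSo 10 3, ⁅D.centerSo 10 3, D.proj k X⁆⁆ (D.proj l Y) =
      traceForm (D.proj k X) ⁅D.centerSo 10 3, ⁅D.centerSo 10 3, D.proj l Y⁆⁆ := by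
    rw [traceForm_lie, traceForm_lie, neg_neg]
  rw [centerSo_proj, centerSo_proj, root_eq_weight, root_eq_weight] at h1
  have h2 (r : ℝ) (U V : so ι ℝ) : traceForm (r • U) V = r * traceForm U V := by
    change ((r • U.1) * V.1).trace = _
    rw [smul_mul_assoc, trace_smul]
    rfl
  rw [h2, traceForm_comm (D.proj k X) (_ • _), h2, traceForm_comm (D.proj l Y)] at h1
  have h3 : ((weight k : ℝ) ^ 2 - (weight l : ℝ) ^ 2) * traceForm (D.proj k X) (D.proj l Y) = 0 := by
    linear_combination -h1
  refine (mul_eq_zero.1 h3).resolve_left fun h4 => h (weight_sq_injective ?_)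
  exact_mod_cast sub_eq_zero.1 h4

/-- The trace form as a bilinear map. -/
def traceFormₗ : so ι ℝ →ₗ[ℝ] so ι ℝ →ₗ[ℝ] ℝ :=
  LinearMap.mk₂ ℝ traceForm
    (fun X Y Z => by change ((X.1 + Y.1) * Z.1).trace = _; rw [add_mul, trace_add]; rfl)
    (fun r X Z => by change ((r • X.1) * Z.1).trace = _; rw [smul_mul_assoc, trace_smul]; rfl)
    (fun X Y Z => by change (X.1 * (Y.1 + Z.1)).trace = _; rw [mul_add, trace_add]; rfl)
    (fun r X Z => by change (X.1 * (r • Z.1)).trace = _; rw [mul_smul_comm, trace_smul]; rfl)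

lemma traceFormₗ_apply (X Y : so ι ℝ) : traceFormₗ X Y = traceForm X Y := rfl

lemma traceForm_self_eq_zero {X : so ι ℝ} (h : traceForm X X = 0) : X = 0 := by
  have h1 : (X.1ᵀ * X.1).trace = 0 := by
    rw [so_transpose, neg_mul, trace_neg]
    exact neg_eq_zero.2 h
  have h2 := trace_conjTranspose_mul_self_eq_zero_iff (A := X.1)
  rw [conjTranspose_eq_transpose_of_trivial] at h2
  exact Subtype.ext (h2.1 h1)

lemma traceForm_proj_left (k : Option (Fin 6)) (X Y : so ι ℝ) :
    traceForm (D.proj k X) Y = traceForm (D.proj k X) (D.proj k Y) := by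
  conv_lhs => rw [← D.sum_proj Y]
  rw [← traceFormₗ_apply, map_sum, Finset.sum_eq_single k]
  · rfl
  · exact fun l _ hl => D.traceForm_proj_of_ne hl.symm X Y
  · simp

lemma traceForm_proj_right (k : Option (Fin 6)) (X Y : so ι ℝ) :
    traceForm X (D.proj k Y) = traceForm (D.proj k X) (D.proj k Y) := by
  rw [traceForm_comm, traceForm_proj_left, traceForm_comm]

/-- The map `X ↦ π_l ∘ ad (π_i X) ∘ π_k`. -/
def component (i k l : Fin 6) : so ι ℝ →ₗ[ℝ] so ι ℝ →ₗ[ℝ] so ι ℝ :=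
  ((LieModule.toEnd ℝ (so ι ℝ) (so ι ℝ) : so ι ℝ →ₗ[ℝ] Module.End ℝ (so ι ℝ)).compl₁₂
    (D.proj (some i)) (D.proj (some k))).compr₂ (D.proj (some l))

lemma component_apply (i k l : Fin 6) (X Y : so ι ℝ) :
    D.component i k l X Y = D.proj (some l) ⁅D.proj (some i) X, D.proj (some k) Y⁆ := rfl

/-- The bracket of the contraction, restricted to the isotropy module and extended by zero. -/
def restricted : so ι ℝ →ₗ[ℝ] so ι ℝ →ₗ[ℝ] so ι ℝ :=
  ∑ T ∈ brackets, D.component T.1 T.2.1 T.2.2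

/-- The point of `restricted` is that it annihilates the isotropy algebra in both arguments, so its
traces over 𝔰𝔬 are traces over 𝔪. -/
lemma contracted_eq_restricted {X Y : so ι ℝ} (hX : D.proj none X = 0) (hY : D.proj none Y = 0) :
    D.contracted X Y = D.restricted X Y := by
  refine D.eq_of_proj_eq fun k => ?_
  rcases k with _ | k
  · rw [proj_none_contracted D hX, restricted]
    simp [component_apply, proj_proj, LinearMap.sum_apply]
  · rw [proj_contracted_apply, Fintype.sum_option, restricted]
    simp only [hX, zero_lie, map_zero, ite_self, Finset.sum_const_zero, zero_add,
      Fintype.sum_option, hY, lie_zero, LinearMap.sum_apply, map_sum, component_apply, proj_proj]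
    rw [← Finset.sum_filter_add_sum_filter_not brackets (fun T => T.2.2 = k)]
    rw [← Finset.sum_product', Finset.sum_eq_zero (s := {T ∈ brackets | ¬T.2.2 = k}), add_zero]
    · refine (Finset.sum_bij_ne_zero (fun T _ _ => (T.1, T.2.1)) ?_ ?_ ?_ ?_).symm
      · simp
      · rintro ⟨i, j, l⟩ h₁ - ⟨i', j', l'⟩ h₂ - h
        simp only [Finset.mem_filter] at h₁ h₂
        simp only [Prod.mk.injEq] at h ⊢
        exact ⟨h.1, h.2, h₁.2.trans h₂.2.symm⟩
      · rintro ⟨i, j⟩ - h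
        simp only [ne_eq, ite_eq_right_iff, not_forall] at h
        obtain ⟨h1, h2⟩ := h
        refine ⟨(i, j, k), ?_, ?_, rfl⟩
        · rw [Finset.mem_filter]
          refine ⟨mem_brackets_of_compatible i j k ?_ h1, rfl⟩
          by_contra hc
          exact h2 (D.proj_lie_of_not_compatible hc (D.proj_proj_self _ X) (D.proj_proj_self _ Y))
        · simpa using h2
      · rintro ⟨i, j, l⟩ h₁ -
        simp only [Finset.mem_filter] at h₁
        obtain ⟨h₁, rfl⟩ := h₁
        rw [if_pos rfl, if_pos (deg_of_mem_brackets i j l h₁)]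
    · rintro ⟨i, j, l⟩ h
      simp only [Finset.mem_filter] at h
      rw [if_neg]
      simpa using fun h' => h.2 h'.symm

/-- The adjoint of the bracket with respect to the metric with parameters `t`. -/
def adjoint (t : Fin 6 → ℝ) : so ι ℝ →ₗ[ℝ] so ι ℝ →ₗ[ℝ] so ι ℝ :=
  -∑ T ∈ brackets, (t T.2.2 / t T.2.1) • D.component T.1 T.2.2 T.2.1

/-- The bilinear form with parameters `t`, with respect to the negative of the Killing form. -/
def metricForm (t : Fin 6 → ℝ) : so ι ℝ →ₗ[ℝ] so ι ℝ →ₗ[ℝ] ℝ :=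
  ∑ i, -t i • (killingForm ℝ (so ι ℝ)).compl₁₂ (D.proj (some i)) (D.proj (some i))

lemma metricForm_apply (t : Fin 6 → ℝ) (X Y : so ι ℝ) : D.metricForm t X Y =
    ∑ i, -t i * (((Fintype.card ι : ℝ) - 2) *
      traceForm (D.proj (some i) X) (D.proj (some i) Y)) := by
  simp only [metricForm, LinearMap.sum_apply, LinearMap.smul_apply, LinearMap.compl₁₂_apply,
    killingForm_so, smul_eq_mul, traceForm]

lemma metricForm_comm (t : Fin 6 → ℝ) (X Y : so ι ℝ) :
    D.metricForm t X Y = D.metricForm t Y X := by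
  rw [metricForm_apply, metricForm_apply]
  exact Finset.sum_congr rfl fun i _ => by rw [traceForm_comm]

lemma metricForm_nondegenerate {t : Fin 6 → ℝ} (ht : ∀ i, t i ≠ 0) (hι : 2 < Fintype.card ι)
    {X : so ι ℝ} (hX : D.proj none X = 0) (h : ∀ Y, D.proj none Y = 0 → D.metricForm t X Y = 0) :
    X = 0 := by
  rw [← D.sum_proj X]
  refine Finset.sum_eq_zero fun k _ => ?_
  rcases k with _ | k
  · exact hX
  · have h1 := h (D.proj (some k) X) (D.proj_proj_of_ne (by simp) X)
    rw [metricForm_apply, Finset.sum_eq_single k] at h1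
    · have hι' : (Fintype.card ι : ℝ) - 2 ≠ 0 := by
        have : (2 : ℝ) < Fintype.card ι := by exact_mod_cast hι
        linarith
      rw [proj_proj_self] at h1
      refine traceForm_self_eq_zero ?_
      simpa [ht k, hι'] using h1
    · intro i _ hi
      rw [D.proj_proj_of_ne (k := some i) (l := some k) (by simpa using hi), ← traceFormₗ_apply,
        map_zero]
      simp
    · simp

lemma metricForm_component (t : Fin 6 → ℝ) (i k l : Fin 6) (X Y Z : so ι ℝ) :
    D.metricForm t (D.component i k l X Y) Z = -t l * (((Fintype.card ι : ℝ) - 2) *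
      traceForm ⁅D.proj (some i) X, D.proj (some k) Y⁆ (D.proj (some l) Z)) := by
  rw [metricForm_apply, Finset.sum_eq_single l, component_apply, proj_proj_self,
    ← traceForm_proj_right]
  · intro j _ hj
    rw [component_apply, D.proj_proj_of_ne (k := some j) (l := some l) (by simpa using hj),
      ← traceFormₗ_apply, map_zero]
    simp
  · simp

/-- Invariance of the trace form moves ad X to the other side with a sign, and the quotient t_l/t_k
exchanges the metric parameter of the source for that of the target. -/
lemma metricForm_adjoint {t : Fin 6 → ℝ} (ht : ∀ i, t i ≠ 0) (X Y Z : so ι ℝ) :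
    D.metricForm t (D.adjoint t X Y) Z = D.metricForm t Y (D.restricted X Z) := by
  rw [metricForm_comm D t Y]
  simp only [adjoint, restricted, LinearMap.neg_apply, LinearMap.sum_apply, LinearMap.smul_apply,
    map_neg, map_sum, map_smul, metricForm_component]
  rw [← Finset.sum_neg_distrib]
  refine Finset.sum_congr rfl fun T _ => ?_
  rw [traceForm_lie, smul_eq_mul, traceForm_comm (D.proj (some T.2.2) Y)]
  field_simp [ht T.2.1]

end BlockData
end

/-! ### The Ricci form of the contraction. -/

noncomputable section

namespace BlockData

open Matrix LieAlgebra.Orthogonal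

variable {ι : Type*} [Fintype ι] [DecidableEq ι] (D : BlockData ι)

lemma trace_component_component (i j k k' l l' : Fin 6) (X Y : so ι ℝ) :
    LinearMap.trace ℝ (so ι ℝ) (D.component j l' k' Y * D.component i k l X) =
      if k = k' ∧ l = l' then D.tau k l (D.proj (some i) X) (D.proj (some j) Y) else 0 := by
  have e : D.component j l' k' Y * D.component i k l X =
      (D.proj (some k') ∘ₗ LieAlgebra.ad ℝ (so ι ℝ) (D.proj (some j) Y) ∘ₗ D.proj (some l') ∘ₗ
        D.proj (some l) ∘ₗ LieAlgebra.ad ℝ (so ι ℝ) (D.proj (some i) X)) ∘ₗ D.proj (some k) := rfl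
  have hp (a b : Fin 6) : D.proj (some a) ∘ₗ D.proj (some b) =
      if a = b then D.proj (some a) else 0 := by
    refine LinearMap.ext fun Z => ?_
    rw [LinearMap.comp_apply, proj_proj]
    simp only [Option.some.injEq]
    split_ifs <;> rfl
  rw [e, LinearMap.trace_comp_comm', ← LinearMap.comp_assoc, hp,
    ← LinearMap.comp_assoc _ (D.proj (some l)) (D.proj (some l')), hp]
  by_cases hk : k = k'
  · by_cases hl : l = l'
    · subst hk hl
      simp only [if_true, and_self]
      rfl
    · simp [hl, Ne.symm hl]
  · simp [hk]

/-- Source and target of a contracted bracket determine the acting summand. Hence different summands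
do not mix in tr(ad* ad), and the Ricci form is block diagonal. -/
lemma brackets_unique : ∀ i j k l : Fin 6, (i, k, l) ∈ brackets → (j, k, l) ∈ brackets → i = j := by
  decide

/-- In tr(J J) the component belonging to (i, k, l) pairs only with that of the mirror bracket (k,
i, l). -/
lemma brackets_unique' : ∀ i k l l' : Fin 6, (i, k, l) ∈ brackets → (k, i, l') ∈ brackets →
    l' = l := by
  decide

lemma brackets_symm : ∀ i k l : Fin 6, (i, k, l) ∈ brackets → (k, i, l) ∈ brackets := by
  decide

lemma trace_adjoint_restricted (t : Fin 6 → ℝ) (X Y : so ι ℝ) :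
    LinearMap.trace ℝ (so ι ℝ) (D.adjoint t Y * D.restricted X) =
      -∑ T ∈ brackets, t T.2.2 / t T.2.1 *
        D.tau T.2.1 T.2.2 (D.proj (some T.1) X) (D.proj (some T.1) Y) := by
  have e : D.adjoint t Y * D.restricted X = -∑ T ∈ brackets, ∑ T' ∈ brackets,
      (t T.2.2 / t T.2.1) • (D.component T.1 T.2.2 T.2.1 Y * D.component T'.1 T'.2.1 T'.2.2 X) := by
    simp only [adjoint, restricted, LinearMap.neg_apply, LinearMap.sum_apply,
      LinearMap.smul_apply]
    rw [neg_mul, Finset.sum_mul_sum]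
    simp only [smul_mul_assoc]
  rw [e, map_neg, map_sum]
  congr 1
  refine Finset.sum_congr rfl fun T hT => ?_
  rw [map_sum, Finset.sum_eq_single T]
  · rw [map_smul, trace_component_component, if_pos ⟨rfl, rfl⟩, smul_eq_mul]
  · intro T' hT' hne
    rw [map_smul, trace_component_component, if_neg, smul_zero]
    rintro ⟨h1, h2⟩
    obtain ⟨i, k, l⟩ := T
    obtain ⟨j, k', l'⟩ := T'
    dsimp only at h1 h2
    subst h1 h2
    exact hne (by rw [brackets_unique _ _ _ _ hT' hT])
  · exact fun h => absurd hT h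

lemma adjoint_flip (t : Fin 6 → ℝ) (X : so ι ℝ) : (D.adjoint t).flip X =
    ∑ T ∈ brackets, (t T.2.2 / t T.2.1) • D.component T.2.2 T.1 T.2.1 X := by
  refine LinearMap.ext fun Y => ?_
  rw [LinearMap.flip_apply]
  simp only [adjoint, LinearMap.neg_apply, LinearMap.sum_apply, LinearMap.smul_apply]
  rw [← Finset.sum_neg_distrib]
  refine Finset.sum_congr rfl fun T _ => ?_
  rw [component_apply, component_apply, ← lie_skew, map_neg, smul_neg, neg_neg]

lemma trace_flip_flip (t : Fin 6 → ℝ) (X Y : so ι ℝ) :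
    LinearMap.trace ℝ (so ι ℝ) ((D.adjoint t).flip Y * (D.adjoint t).flip X) =
      ∑ T ∈ brackets, t T.2.2 / t T.2.1 * (t T.2.2 / t T.1) *
        D.tau T.2.1 T.1 (D.proj (some T.2.2) X) (D.proj (some T.2.2) Y) := by
  rw [adjoint_flip, adjoint_flip, Finset.sum_mul_sum, map_sum]
  refine Finset.sum_congr rfl fun T hT => ?_
  rw [map_sum, Finset.sum_eq_single (T.2.1, T.1, T.2.2)]
  · rw [smul_mul_smul_comm, map_smul, trace_component_component, if_pos ⟨rfl, rfl⟩, smul_eq_mul]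
  · intro T' hT' hne
    rw [smul_mul_smul_comm, map_smul, trace_component_component, if_neg, smul_zero]
    rintro ⟨h1, h2⟩
    obtain ⟨i, k, l⟩ := T
    obtain ⟨j, k', l'⟩ := T'
    dsimp only at h1 h2
    subst h1 h2
    exact hne (by rw [brackets_unique' _ _ _ _ hT hT'])
  · exact fun h => absurd (brackets_symm _ _ _ hT) h

/-- The Ricci form of the contraction vanishes. -/
theorem ricci_identity {t : Fin 6 → ℝ} (ht : ∀ i, t i ≠ 0) {K : ℝ}
    (hq : D.q.trace / 2 - 1 = D.p.trace * K) (ho : D.o.trace = D.p.trace * K ^ 2)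
    (h4 : t 4 * t 5 = -(K * t 1 * t 2)) (h3 : t 3 * t 5 ^ 2 = K ^ 2 * t 1 ^ 2 * t 2)
    (X Y : so ι ℝ) :
    2 * LinearMap.trace ℝ (so ι ℝ) (D.adjoint t Y * D.restricted X) +
      LinearMap.trace ℝ (so ι ℝ) ((D.adjoint t).flip Y * (D.adjoint t).flip X) = 0 := by
  have t1 := ht 1
  have t2 := ht 2
  have t5 := ht 5
  -- Equivalently t₄/(t₂t₅) = t₃/(t₄t₅) = −K t₁/t₅² and t₃/(t₁t₂) = K² t₁/t₅². After this
  -- substitution, `hq` and `ho` make the Ricci coefficient of each summand vanish.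
  have e4 : t 4 = -(K * t 1 * t 2) / t 5 := by rw [← h4]; field_simp
  have e3 : t 3 = K ^ 2 * t 1 ^ 2 * t 2 / t 5 ^ 2 := by rw [← h3]; field_simp
  have p (k : Fin 6) (Z : so ι ℝ) := D.proj_proj_self (some k) Z
  rw [trace_adjoint_restricted, trace_flip_flip]
  have hs (F : Fin 6 × Fin 6 × Fin 6 → ℝ) : ∑ T ∈ brackets, F T = F (1, 2, 3) + F (2, 1, 3) +
      F (5, 5, 1) + F (2, 5, 4) + F (5, 2, 4) + F (4, 5, 3) + F (5, 4, 3) := by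
    simp [brackets, Finset.sum_insert]
    ring
  obtain ⟨x4, hx4, hx4b⟩ := D.exists_alt_four (p 4 X)
  obtain ⟨x2, hx2, hx2b, -⟩ := D.exists_alt_two (p 2 X)
  obtain ⟨y2, hy2, hy2b, -⟩ := D.exists_alt_two (p 2 Y)
  obtain ⟨x3, hx3, hx3b, -⟩ := D.exists_alt_three (p 3 X)
  obtain ⟨y3, hy3, hy3b, -⟩ := D.exists_alt_three (p 3 Y)
  have a1 := D.tau_five_four hx2b hy2b
  have a2 := D.tau_five_four hx3b hy3b
  have a3 := D.tau_five_four hy3b hx3b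
  rw [hx2, hy2] at a1
  rw [hx3, hy3] at a2 a3
  rw [traceForm_comm (D.proj (some 3) Y)] at a3
  rw [hs, hs]
  simp only
  rw [D.tau_comm 1 3, D.tau_comm 4 3, D.tau_comm 1 2, D.tau_comm 2 5, D.tau_comm 4 5,
    D.tau_two_three (p 1 X) (p 1 Y), D.tau_three_one (p 2 Y) (p 2 X),
    D.tau_five_one (p 5 X) (p 5 Y), a1, D.tau_two_four (p 5 X) (p 5 Y),
    D.tau_five_three (p 4 X) (p 4 Y), D.tau_three_four (p 5 Y) (p 5 X),
    D.tau_two_one (p 3 X) (p 3 Y), D.tau_two_one (p 3 Y) (p 3 X),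
    D.tau_five_five (p 1 X) (p 1 Y), D.tau_five_two (p 4 X) (p 4 Y),
    D.tau_five_two (p 4 Y) (p 4 X), a2, a3, traceForm_comm (D.proj (some 2) Y),
    traceForm_comm (D.proj (some 5) Y), traceForm_comm (D.proj (some 3) Y),
    traceForm_comm (D.proj (some 4) Y), hq, ho, e4, e3]
  field_simp
  ring

end BlockData
end

/-! ### Transfer of the structure from 𝔪 to a normed coordinate space. -/

noncomputable section

namespace BlockData

open Matrix LieAlgebra.Orthogonal

attribute [local irreducible] proj contracted component adjoint restricted metricForm

variable {ι : Type*} [Fintype ι] [DecidableEq ι] (D : BlockData ι)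
variable {E : Type*} [NormedAddCommGroup E] [NormedSpace ℝ E] 

/-- A bilinear map on a finite-dimensional space as a continuous one. -/
def continuousBilin [FiniteDimensional ℝ E] {F : Type*} [NormedAddCommGroup F] [NormedSpace ℝ F]
    (f : E →ₗ[ℝ] E →ₗ[ℝ] F) : E →L[ℝ] E →L[ℝ] F :=
  LinearMap.toContinuousLinearMap
    ((LinearMap.toContinuousLinearMap : (E →ₗ[ℝ] F) ≃ₗ[ℝ] (E →L[ℝ] F)).toLinearMap ∘ₗ f)

lemma proj_none_sub (X : so ι ℝ) : D.proj none (X - D.proj none X) = 0 := by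
  rw [map_sub, proj_proj_self, sub_self]

variable {W : Submodule ℝ (so ι ℝ)} (c : E ≃ₗ[ℝ] W)

/-- The embedding of the coordinate space in `𝔰𝔬`. -/
def embed : E →ₗ[ℝ] so ι ℝ := W.subtype ∘ₗ c.toLinearMap

variable (hW : ∀ X, X ∈ W ↔ D.proj none X = 0)

/-- The projection of `𝔰𝔬` onto the isotropy module. -/
def projM : so ι ℝ →ₗ[ℝ] so ι ℝ := LinearMap.id - D.proj none

lemma projM_apply (X : so ι ℝ) : D.projM X = X - D.proj none X := rfl

lemma proj_none_projM (X : so ι ℝ) : D.proj none (D.projM X) = 0 := by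
  rw [projM_apply, proj_none_sub]

/-- The projection of `𝔰𝔬` onto the coordinate space along the isotropy algebra. -/
def retract : so ι ℝ →ₗ[ℝ] E where
  toFun X := c.symm ⟨D.projM X, (hW _).2 (D.proj_none_projM X)⟩
  map_add' X Y := by
    rw [← map_add]
    exact congrArg c.symm (Subtype.ext (map_add D.projM X Y))
  map_smul' r X := by
    rw [RingHom.id_apply, ← map_smul]
    exact congrArg c.symm (Subtype.ext (map_smul D.projM r X))

lemma embed_retract (X : so ι ℝ) : embed c (D.retract c hW X) = X - D.proj none X := by
  change ((c (c.symm ⟨D.projM X, (hW _).2 (D.proj_none_projM X)⟩) : W) : so ι ℝ) = _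
  rw [c.apply_symm_apply]
  rfl

lemma embed_retract_of {X : so ι ℝ} (hX : D.proj none X = 0) :
    embed c (D.retract c hW X) = X := by
  rw [embed_retract, hX, sub_zero]

lemma proj_none_embed (hW : ∀ X, X ∈ W ↔ D.proj none X = 0) (u : E) : D.proj none (embed c u) = 0 := (hW _).1 (c u).2

lemma embed_injective : Function.Injective (embed c) :=
  Subtype.val_injective.comp c.injective

/-- The adjoint representation of the isotropy module in the contraction. -/
def coordRep : E →ₗ[ℝ] Module.End ℝ (so ι ℝ) := D.contracted ∘ₗ embed c

lemma coordRep_apply (x : E) : D.coordRep c x = D.contracted (embed c x) := rfl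

lemma coordRep_injective (hW : ∀ X, X ∈ W ↔ D.proj none X = 0) :
     Function.Injective (D.coordRep c) := by
  rw [injective_iff_map_eq_zero]
  intro u hu
  refine embed_injective c ?_
  rw [map_zero]
  refine D.eq_zero_of_contracted_centerSo (D.proj_none_embed c hW u) ?_
  rw [← coordRep_apply, hu, LinearMap.zero_apply]

lemma coordRep_nilpotent (hW : ∀ X, X ∈ W ↔ D.proj none X = 0)
    (w x y z : E) :
    D.coordRep c w * (D.coordRep c x * (D.coordRep c y * D.coordRep c z)) = 0 := by
  refine LinearMap.ext fun Z => ?_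
  have h := D.contracted_nilpotent (D.proj_none_embed c hW w) (D.proj_none_embed c hW x)
    (D.proj_none_embed c hW y) (D.proj_none_embed c hW z) Z
  rw [Module.End.mul_apply, Module.End.mul_apply, Module.End.mul_apply, LinearMap.zero_apply]
  simp only [coordRep_apply]
  rw [h]

variable [FiniteDimensional ℝ E]

/-- The bilinear map on the coordinate space induced by a bilinear map on `𝔰𝔬`. -/
def coordBilin (f : so ι ℝ →ₗ[ℝ] so ι ℝ →ₗ[ℝ] so ι ℝ) : E →L[ℝ] E →L[ℝ] E :=
  continuousBilin ((f.compl₁₂ (embed c) (embed c)).compr₂ (D.retract c hW))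

lemma coordBilin_apply (f : so ι ℝ →ₗ[ℝ] so ι ℝ →ₗ[ℝ] so ι ℝ) (u v : E) :
    D.coordBilin c hW f u v = D.retract c hW (f (embed c u) (embed c v)) := rfl

/-- The bracket of the contraction on the coordinate space. -/
def coordBracket : E →L[ℝ] E →L[ℝ] E := D.coordBilin c hW D.contracted

lemma coordBracket_apply (u v : E) : D.coordBracket c hW u v =
    D.retract c hW (D.contracted (embed c u) (embed c v)) := by
  rw [coordBracket, coordBilin_apply]

lemma embed_coordBracket (u v : E) :
    embed c (D.coordBracket c hW u v) = D.contracted (embed c u) (embed c v) :=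
  D.embed_retract_of c hW (D.proj_none_contracted (D.proj_none_embed c hW u))

lemma coordBracket_skew (u v : E) : D.coordBracket c hW u v = -D.coordBracket c hW v u := by
  refine embed_injective c ?_
  rw [map_neg, embed_coordBracket, embed_coordBracket, contracted_skew]

lemma coordBracket_jacobi (x y z : E) :
    D.coordBracket c hW (D.coordBracket c hW x y) z =
      D.coordBracket c hW x (D.coordBracket c hW y z) -
        D.coordBracket c hW y (D.coordBracket c hW x z) := by
  refine embed_injective c ?_
  simp only [map_sub, embed_coordBracket, contracted_jacobi]

lemma coordBracket_nilpotent (w x y z : E) :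
    D.coordBracket c hW w (D.coordBracket c hW x (D.coordBracket c hW y z)) = 0 := by
  refine embed_injective c ?_
  simp only [map_zero, embed_coordBracket]
  exact D.contracted_nilpotent' (D.proj_none_embed c hW w) (D.proj_none_embed c hW x)
    (D.proj_none_embed c hW y) (D.proj_none_embed c hW z)

lemma coordRep_bracket (x y : E) : D.coordRep c (D.coordBracket c hW x y) =
    D.coordRep c x * D.coordRep c y - D.coordRep c y * D.coordRep c x := by
  refine LinearMap.ext fun Z => ?_
  simp only [LinearMap.sub_apply, Module.End.mul_apply, coordRep_apply, embed_coordBracket,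
    contracted_jacobi]

/-- The value of the invariant metric at the base point, on the coordinate space. -/
def coordForm (t : Fin 6 → ℝ) : E →L[ℝ] E →L[ℝ] ℝ :=
  continuousBilin ((D.metricForm t).compl₁₂ (embed c) (embed c))

lemma coordForm_apply (t : Fin 6 → ℝ) (u v : E) :
    D.coordForm c t u v = D.metricForm t (embed c u) (embed c v) := rfl

lemma coordForm_comm (t : Fin 6 → ℝ) (u v : E) :
    D.coordForm c t u v = D.coordForm c t v u := D.metricForm_comm t _ _

lemma coordForm_nondegenerate (hW : ∀ X, X ∈ W ↔ D.proj none X = 0)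
    {t : Fin 6 → ℝ} (ht : ∀ i, t i ≠ 0) (hι : 2 < Fintype.card ι)
    (u : E) (h : ∀ v, D.coordForm c t u v = 0) : u = 0 := by
  refine embed_injective c ?_
  rw [map_zero]
  refine D.metricForm_nondegenerate ht hι (D.proj_none_embed c hW u) fun Y hY => ?_
  have := h (D.retract c hW Y)
  rwa [coordForm_apply, D.embed_retract_of c hW hY] at this

/-- The invariant metric on the contraction, in exponential coordinates. -/
def coordMetric (t : Fin 6 → ℝ) : E → E →L[ℝ] E →L[ℝ] ℝ :=
  PseudoRiemannian.leftInvariantMetric (D.coordForm c t) (D.coordBracket c hW)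

lemma isMetric_coordMetric {t : Fin 6 → ℝ} (ht : ∀ i, t i ≠ 0) (hι : 2 < Fintype.card ι) :
    PseudoRiemannian.IsMetric (D.coordMetric c hW t) :=
  PseudoRiemannian.isMetric_leftInvariantMetric (D.coordForm_comm c t)
    (D.coordForm_nondegenerate c hW ht hι) (D.coordBracket_nilpotent c hW)

lemma proj_none_component (i k l : Fin 6) (X Y : so ι ℝ) :
    D.proj none (D.component i k l X Y) = 0 := by
  rw [component_apply, D.proj_proj_of_ne (by simp)]

lemma component_sub_proj_none (i k l : Fin 6) (X Y : so ι ℝ) :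
    D.component i k l X (Y - D.proj none Y) = D.component i k l X Y := by
  rw [component_apply, map_sub, D.proj_proj_of_ne (k := some k) (l := none) (by simp), sub_zero,
    component_apply]

/-- S and T ignore the component in the isotropy algebra, so restricting them to 𝔪 loses nothing;
the rest is cyclicity of the trace. -/
lemma trace_retract (S T : so ι ℝ →ₗ[ℝ] so ι ℝ) (hS : ∀ X, S (X - D.proj none X) = S X)
    (hT : ∀ X, T (X - D.proj none X) = T X) :
    LinearMap.trace ℝ E ((D.retract c hW ∘ₗ S ∘ₗ embed c) * (D.retract c hW ∘ₗ T ∘ₗ embed c)) =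
      LinearMap.trace ℝ (so ι ℝ) (S * T) := by
  have e : (D.retract c hW ∘ₗ S ∘ₗ embed c) * (D.retract c hW ∘ₗ T ∘ₗ embed c) =
      D.retract c hW ∘ₗ (S ∘ₗ T ∘ₗ embed c) := by
    refine LinearMap.ext fun u => ?_
    change D.retract c hW (S (embed c (D.retract c hW (T (embed c u))))) = _
    rw [embed_retract, hS]
    rfl
  rw [e, LinearMap.trace_comp_comm']
  congr 1
  refine LinearMap.ext fun X => ?_
  change S (T (embed c (D.retract c hW X))) = S (T X)
  rw [embed_retract, hT]

lemma adjoint_sub_proj_none (t : Fin 6 → ℝ) (X Y : so ι ℝ) :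
    D.adjoint t X (Y - D.proj none Y) = D.adjoint t X Y := by
  simp only [adjoint, LinearMap.neg_apply, LinearMap.sum_apply, LinearMap.smul_apply,
    component_sub_proj_none]

lemma adjoint_flip_sub_proj_none (t : Fin 6 → ℝ) (X Y : so ι ℝ) :
    (D.adjoint t).flip X (Y - D.proj none Y) = (D.adjoint t).flip X Y := by
  simp only [adjoint_flip, LinearMap.sum_apply, LinearMap.smul_apply, component_sub_proj_none]

lemma restricted_sub_proj_none (X Y : so ι ℝ) :
    D.restricted X (Y - D.proj none Y) = D.restricted X Y := by
  simp only [restricted, LinearMap.sum_apply, component_sub_proj_none]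

lemma proj_none_adjoint (t : Fin 6 → ℝ) (X Y : so ι ℝ) : D.proj none (D.adjoint t X Y) = 0 := by
  simp only [adjoint, LinearMap.neg_apply, LinearMap.sum_apply, LinearMap.smul_apply, map_neg,
    map_sum, map_smul, proj_none_component, smul_zero, Finset.sum_const_zero, neg_zero]

lemma coordBilin_toLinearMap (f : so ι ℝ →ₗ[ℝ] so ι ℝ →ₗ[ℝ] so ι ℝ) (u : E) :
    (D.coordBilin c hW f u).toLinearMap = D.retract c hW ∘ₗ f (embed c u) ∘ₗ embed c := rfl

lemma coordBilin_flip_toLinearMap (f : so ι ℝ →ₗ[ℝ] so ι ℝ →ₗ[ℝ] so ι ℝ) (u : E) :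
    ((D.coordBilin c hW f).flip u).toLinearMap =
      D.retract c hW ∘ₗ f.flip (embed c u) ∘ₗ embed c := rfl

lemma coordBracket_toLinearMap (u : E) : (D.coordBracket c hW u).toLinearMap =
    D.retract c hW ∘ₗ D.restricted (embed c u) ∘ₗ embed c := by
  refine LinearMap.ext fun z => ?_
  rw [ContinuousLinearMap.coe_coe, coordBracket_apply, LinearMap.comp_apply, LinearMap.comp_apply,
    contracted_eq_restricted D (D.proj_none_embed c hW u) (D.proj_none_embed c hW z)]

lemma ricci_coord {t : Fin 6 → ℝ} (ht : ∀ i, t i ≠ 0)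
    {K : ℝ} (hq : D.q.trace / 2 - 1 = D.p.trace * K) (ho : D.o.trace = D.p.trace * K ^ 2)
    (h4 : t 4 * t 5 = -(K * t 1 * t 2)) (h3 : t 3 * t 5 ^ 2 = K ^ 2 * t 1 ^ 2 * t 2) (x y : E) :
    2 * LinearMap.trace ℝ E ((D.coordBilin c hW (D.adjoint t) y).toLinearMap *
        (D.coordBracket c hW x).toLinearMap) +
      LinearMap.trace ℝ E (((D.coordBilin c hW (D.adjoint t)).flip y).toLinearMap *
        ((D.coordBilin c hW (D.adjoint t)).flip x).toLinearMap) = 0 := by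
  have h := D.ricci_identity ht hq ho h4 h3 (embed c x) (embed c y)
  have h1 := D.trace_retract c hW (D.adjoint t (embed c y)) (D.restricted (embed c x))
    (D.adjoint_sub_proj_none t _) (D.restricted_sub_proj_none _)
  have h2 := D.trace_retract c hW ((D.adjoint t).flip (embed c y)) ((D.adjoint t).flip (embed c x))
    (D.adjoint_flip_sub_proj_none t _) (D.adjoint_flip_sub_proj_none t _)
  rw [coordBilin_toLinearMap, coordBracket_toLinearMap, coordBilin_flip_toLinearMap,
    coordBilin_flip_toLinearMap, h1, h2, h]

theorem isRicciFlat_coordMetric {t : Fin 6 → ℝ} (ht : ∀ i, t i ≠ 0) (hι : 2 < Fintype.card ι)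
    {K : ℝ} (hq : D.q.trace / 2 - 1 = D.p.trace * K) (ho : D.o.trace = D.p.trace * K ^ 2)
    (h4 : t 4 * t 5 = -(K * t 1 * t 2)) (h3 : t 3 * t 5 ^ 2 = K ^ 2 * t 1 ^ 2 * t 2) :
    PseudoRiemannian.IsRicciFlat (D.coordMetric c hW t) := by
  refine PseudoRiemannian.isRicciFlat_leftInvariantMetric (D.coordForm_comm c t)
    (D.coordForm_nondegenerate c hW ht hι) (D.coordBracket_skew c hW)
    (D.coordBracket_jacobi c hW) (D.coordBracket_nilpotent c hW)
    (D.coordBilin c hW (D.adjoint t)) ?_ ?_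
  · intro x y z
    rw [coordForm_apply, coordForm_apply, coordBilin_apply,
      D.embed_retract_of c hW (D.proj_none_adjoint t _ _),
      embed_coordBracket, metricForm_adjoint D ht, contracted_eq_restricted D
      (D.proj_none_embed c hW x) (D.proj_none_embed c hW z)]
  · intro x y
    exact D.ricci_coord c hW ht hq ho h4 h3 _ _

end BlockData
end

/-! ### The flag manifold as block data, symmetries of the T-roots, and the contracted bracket. -/

noncomputable section

namespace BlockData

open Matrix LieAlgebra.Orthogonal

variable {ι : Type*} [Fintype ι] [DecidableEq ι] (D : BlockData ι)

/-- Exchange of the two complex summands. -/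
def swap : BlockData ι where
  p := D.q
  q := D.p
  o := D.o
  I := D.J
  J := D.I
  pp := D.qq
  qq := D.pp
  pq := D.qp
  qp := D.pq
  o_eq := by rw [D.o_eq, sub_right_comm]
  II := D.JJ
  JJ := D.II
  pI := D.qJ
  Ip := D.Jq
  qJ := D.pI
  Jq := D.Ip
  pT := D.qT
  qT := D.pT
  IT := D.JT
  JT := D.IT

lemma proj_lie_eq_sum (k : Option (Fin 6)) (X Y : so ι ℝ) :
    D.proj k ⁅X, Y⁆ = ∑ i, ∑ j, D.proj k ⁅D.proj i X, D.proj j Y⁆ := by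
  nth_rewrite 1 [← D.sum_proj X, ← D.sum_proj Y]
  rw [sum_lie, map_sum]
  simp only [lie_sum, map_sum]

lemma center_flip (a b : ℝ) : D.flip.center a (-b) = D.center a b := by
  simp [center, flip]

lemma center_swap (a b : ℝ) : D.swap.center b a = D.center a b := by
  simp [center, swap, add_comm]

/-- b ↦ −b exchanges the roots a − b and a + b and fixes the others up to sign. Only squares of
roots enter the definition of the summands. -/
lemma root_flip (a b : ℝ) (k : Fin 6) :
    root a (-b) (some k) ^ 2 = root a b (some (Equiv.swap 2 3 k)) ^ 2 := by
  have h : root a b (some (Equiv.swap 2 3 k)) = root a b (some (![0, 1, 3, 2, 4, 5] k)) := by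
    congr 2
    revert k
    decide
  rw [h]
  fin_cases k <;> simp [root]
  ring

lemma root_swap (a b : ℝ) (k : Fin 6) : root b a (some k) ^ 2 =
    root a b (some ((Equiv.swap 0 1 * Equiv.swap 4 5 : Equiv.Perm (Fin 6)) k)) ^ 2 := by
  have h : root a b (some ((Equiv.swap 0 1 * Equiv.swap 4 5 : Equiv.Perm (Fin 6)) k)) =
      root a b (some (![1, 0, 2, 3, 5, 4] k)) := by
    congr 2
    revert k
    decide
  rw [h]
  fin_cases k <;> simp [root] <;> ring

end BlockData

namespace Flag

open Matrix BlockData LieAlgebra.Orthogonal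

variable {n₁ n₂ n₃ : ℕ}

lemma one_kronecker_neg_one {n : ℕ} :
    (1 : Matrix (Fin n) (Fin n) ℝ) ⊗ₖ (-1 : Matrix (Fin 2) (Fin 2) ℝ) = -1 := by
  rw [← neg_one_smul ℝ (1 : Matrix (Fin 2) (Fin 2) ℝ), kronecker_smul, one_kronecker_one,
    neg_one_smul]

lemma transpose_one_kronecker {n : ℕ} :
    ((1 : Matrix (Fin n) (Fin n) ℝ) ⊗ₖ (!![0, -1; 1, 0] : Matrix (Fin 2) (Fin 2) ℝ))ᵀ =
      -((1 : Matrix (Fin n) (Fin n) ℝ) ⊗ₖ !![0, -1; 1, 0]) := by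
  have : (!![0, -1; 1, 0] : Matrix (Fin 2) (Fin 2) ℝ)ᵀ = (-1 : ℝ) • !![0, -1; 1, 0] := by
    ext i j; fin_cases i <;> fin_cases j <;> simp
  rw [← kroneckerMap_transpose, this, kronecker_smul, transpose_one, neg_one_smul]

lemma trace_fromBlocks_eq {m n : Type*} [Fintype m] [Fintype n] (A : Matrix m m ℝ)
    (B : Matrix m n ℝ) (C : Matrix n m ℝ) (D : Matrix n n ℝ) :
    (fromBlocks A B C D).trace = A.trace + D.trace := by
  simp [trace]

/-- The splitting `ℂ^n₁ ⊕ ℂ^n₂ ⊕ ℝ^(2n₃+1)`. -/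
def blockData (n₁ n₂ n₃ : ℕ) : BlockData (Idx n₁ n₂ n₃) where
  p := fromBlocks 1 0 0 0
  q := fromBlocks 0 0 0 (fromBlocks 1 0 0 0)
  o := 1 - fromBlocks 1 0 0 0 - fromBlocks 0 0 0 (fromBlocks 1 0 0 0)
  I := central n₁ n₂ n₃ 1 0
  J := central n₁ n₂ n₃ 0 1
  pp := by simp [fromBlocks_multiply]
  qq := by simp [fromBlocks_multiply]
  pq := by simp [fromBlocks_multiply]
  qp := by simp [fromBlocks_multiply]
  o_eq := rfl
  II := by
    have : (!![0, -1; 1, 0] * !![0, -1; 1, 0] : Matrix (Fin 2) (Fin 2) ℝ) = -1 := by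
      ext i j; fin_cases i <;> fin_cases j <;> simp
    simp [central, fromBlocks_multiply, ← mul_kronecker_mul, this, fromBlocks_neg]
    exact one_kronecker_neg_one
  JJ := by
    have : (!![0, -1; 1, 0] * !![0, -1; 1, 0] : Matrix (Fin 2) (Fin 2) ℝ) = -1 := by
      ext i j; fin_cases i <;> fin_cases j <;> simp
    simp [central, fromBlocks_multiply, ← mul_kronecker_mul, this, fromBlocks_neg]
    exact one_kronecker_neg_one
  pI := by simp [central, fromBlocks_multiply]
  Ip := by simp [central, fromBlocks_multiply]
  qJ := by simp [central, fromBlocks_multiply]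
  Jq := by simp [central, fromBlocks_multiply]
  pT := by simp [fromBlocks_transpose]
  qT := by simp [fromBlocks_transpose]
  IT := by
    simp [central, fromBlocks_transpose, fromBlocks_neg]
    exact transpose_one_kronecker
  JT := by
    simp [central, fromBlocks_transpose, fromBlocks_neg]
    exact transpose_one_kronecker

lemma trace_p : (blockData n₁ n₂ n₃).p.trace = 2 * n₁ := by
  simp [blockData, trace_fromBlocks_eq, mul_comm]

lemma trace_q : (blockData n₁ n₂ n₃).q.trace = 2 * n₂ := by
  simp [blockData, trace_fromBlocks_eq, mul_comm]

lemma trace_o : (blockData n₁ n₂ n₃).o.trace = 2 * n₃ + 1 := by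
  have h := trace_p (n₁ := n₁) (n₂ := n₂) (n₃ := n₃)
  have h' := trace_q (n₁ := n₁) (n₂ := n₂) (n₃ := n₃)
  rw [BlockData.o_eq, trace_sub, trace_sub, h, h', trace_one]
  simp
  ring

/-- The splitting `D` is adapted to the flag manifold: its centre is the centre of the isotropy
algebra, and the roots of `D` are the T-roots, numbered by `σ`. -/
structure IsAdapted (D : BlockData (Idx n₁ n₂ n₃)) (σ : Equiv.Perm (Fin 6)) : Prop where
  center_of_central : ∀ a b : ℝ, ∃ a' b' : ℝ, central n₁ n₂ n₃ a b = D.center a' b' ∧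
    ∀ k, ((tRoot (σ k)).1 * a + (tRoot (σ k)).2 * b) ^ 2 = root a' b' (some k) ^ 2
  central_of_center : ∀ a' b' : ℝ, ∃ a b : ℝ, D.center a' b' = central n₁ n₂ n₃ a b ∧
    ∀ k, ((tRoot (σ k)).1 * a + (tRoot (σ k)).2 * b) ^ 2 = root a' b' (some k) ^ 2

lemma central_eq (a b : ℝ) : central n₁ n₂ n₃ a b = (blockData n₁ n₂ n₃).center a b := by
  simp [center, blockData, central, fromBlocks_add, fromBlocks_smul]

lemma tRoot_eq (a b : ℝ) (k : Fin 6) :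
    (tRoot k).1 * a + (tRoot k).2 * b = root a b (some k) := by
  fin_cases k <;> simp [tRoot, root]
  ring

lemma isAdapted_blockData : IsAdapted (blockData n₁ n₂ n₃) 1 where
  center_of_central a b := ⟨a, b, central_eq a b, fun k => by
    rw [Equiv.Perm.one_apply, tRoot_eq]⟩
  central_of_center a b := ⟨a, b, (central_eq a b).symm, fun k => by
    rw [Equiv.Perm.one_apply, tRoot_eq]⟩

/-- Together with `IsAdapted.swap`, this produces adapted splittings for which each of the four
forms becomes `deg`. -/
lemma IsAdapted.flip {D : BlockData (Idx n₁ n₂ n₃)} {σ : Equiv.Perm (Fin 6)}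
    (h : IsAdapted D σ) : IsAdapted D.flip (σ * Equiv.swap 2 3) where
  center_of_central a b := by
    obtain ⟨a', b', h1, h2⟩ := h.center_of_central a b
    exact ⟨a', -b', by rw [h1, center_flip], fun k => by rw [root_flip, ← h2]; rfl⟩
  central_of_center a' b' := by
    obtain ⟨a, b, h1, h2⟩ := h.central_of_center a' (-b')
    refine ⟨a, b, by rw [← h1, ← D.center_flip, neg_neg], fun k => ?_⟩
    rw [← neg_neg b', root_flip, ← h2]
    rfl

lemma IsAdapted.swap {D : BlockData (Idx n₁ n₂ n₃)} {σ : Equiv.Perm (Fin 6)}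
    (h : IsAdapted D σ) : IsAdapted D.swap (σ * (Equiv.swap 0 1 * Equiv.swap 4 5)) where
  center_of_central a b := by
    obtain ⟨a', b', h1, h2⟩ := h.center_of_central a b
    exact ⟨b', a', by rw [h1, center_swap], fun k => by rw [root_swap, ← h2]; rfl⟩
  central_of_center a' b' := by
    obtain ⟨a, b, h1, h2⟩ := h.central_of_center b' a'
    refine ⟨a, b, by rw [← h1, ← D.center_swap], fun k => ?_⟩
    rw [root_swap, ← h2]
    rfl

namespace IsAdapted

variable {D : BlockData (Idx n₁ n₂ n₃)} {σ : Equiv.Perm (Fin 6)} {f : Fin 6 → ℤ}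

lemma mem_𝔪 (h : IsAdapted D σ) (k : Fin 6) (X : 𝔤 n₁ n₂ n₃) :
    X ∈ 𝔪 n₁ n₂ n₃ (σ k) ↔ D.proj (some k) X = X := by
  rw [proj_eq_self_iff_root]
  constructor
  · intro hX a b
    obtain ⟨a', b', h1, h2⟩ := h.central_of_center a b
    have h3 := hX a' b'
    rw [h2, ← h1] at h3
    exact Subtype.ext h3
  · intro hX a b
    obtain ⟨a', b', h1, h2⟩ := h.center_of_central a b
    have h3 := congrArg Subtype.val (hX a' b')
    rw [h2, h1]
    exact h3

lemma mem_𝔥 (h : IsAdapted D σ) (X : 𝔤 n₁ n₂ n₃) : X ∈ 𝔥 n₁ n₂ n₃ ↔ D.proj none X = X := by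
  rw [proj_none_eq_self_iff]
  constructor
  · intro hX a b
    obtain ⟨a', b', h1, -⟩ := h.central_of_center a b
    have h3 := hX a' b'
    rw [← h1] at h3
    exact Subtype.ext h3
  · intro hX a b
    obtain ⟨a', b', h1, -⟩ := h.center_of_central a b
    rw [h1]
    exact congrArg Subtype.val (hX a' b')

lemma proj_mem (h : IsAdapted D σ) (k : Fin 6) (X : 𝔤 n₁ n₂ n₃) : D.proj (some k) X ∈ 𝔪 n₁ n₂ n₃ (σ k) :=
  (h.mem_𝔪 k _).2 (D.proj_proj_self _ _)

lemma mem_𝔪sum (h : IsAdapted D σ) (X : 𝔤 n₁ n₂ n₃) : X ∈ 𝔪sum n₁ n₂ n₃ ↔ D.proj none X = 0 := by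
  constructor
  · intro hX
    have : 𝔪sum n₁ n₂ n₃ ≤ LinearMap.ker (D.proj none) := by
      refine iSup_le fun j Y hY => ?_
      obtain ⟨k, rfl⟩ := σ.surjective j
      rw [LinearMap.mem_ker, ← (h.mem_𝔪 k Y).1 hY, D.proj_proj_of_ne (by simp)]
    exact this hX
  · intro hX
    rw [← D.sum_proj X, Fintype.sum_option, hX, zero_add]
    exact Submodule.sum_mem _ fun k _ =>
      Submodule.mem_iSup_of_mem (σ k) (h.proj_mem k X)

lemma mem_gradedPiece (h : IsAdapted D σ) (a : ℤ) (X : 𝔤 n₁ n₂ n₃) (hX : X ∈ gradedPiece n₁ n₂ n₃ f a)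
    (hf : ∀ k, f (σ k) = deg (some k)) (k : Option (Fin 6)) (hk : deg k ≠ a) :
    D.proj k X = 0 := by
  have : gradedPiece n₁ n₂ n₃ f a ≤ LinearMap.ker (D.proj k) := by
    refine sup_le (iSup_le fun ha Y hY => ?_) (iSup_le fun j => iSup_le fun hj Y hY => ?_)
    · rw [LinearMap.mem_ker, ← (h.mem_𝔥 Y).1 hY, D.proj_proj_of_ne]
      rintro rfl
      exact hk ha.symm
    · obtain ⟨l, rfl⟩ := σ.surjective j
      rw [LinearMap.mem_ker, ← (h.mem_𝔪 l Y).1 hY, D.proj_proj_of_ne]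
      rintro rfl
      exact hk (by rw [← hj, hf])
  exact this hX

lemma mem_gradedPiece_of (h : IsAdapted D σ) (a : ℤ) (X : 𝔤 n₁ n₂ n₃) (hf : ∀ k, f (σ k) = deg (some k))
    (hX : ∀ k, deg k ≠ a → D.proj k X = 0) : X ∈ gradedPiece n₁ n₂ n₃ f a := by
  rw [← D.sum_proj X]
  refine Submodule.sum_mem _ fun k _ => ?_
  by_cases hk : deg k = a
  · rcases k with _ | k
    · refine Submodule.mem_sup_left (Submodule.mem_iSup_of_mem hk.symm ?_)
      exact (h.mem_𝔥 _).2 (D.proj_proj_self _ _)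
    · refine Submodule.mem_sup_right (Submodule.mem_iSup_of_mem (σ k)
        (Submodule.mem_iSup_of_mem ?_ (h.proj_mem k X)))
      rw [hf, hk]
  · rw [hX k hk]
    exact Submodule.zero_mem _

lemma mem_filtration_of (h : IsAdapted D σ) (a : ℤ) (X : 𝔤 n₁ n₂ n₃) (hf : ∀ k, f (σ k) = deg (some k))
    (hX : ∀ k, a < deg k → D.proj k X = 0) : X ∈ filtration n₁ n₂ n₃ f a := by
  rw [← D.sum_proj X]
  refine Submodule.sum_mem _ fun k _ => ?_
  by_cases hk : deg k ≤ a
  · rcases k with _ | k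
    · refine Submodule.mem_sup_left (Submodule.mem_iSup_of_mem hk ?_)
      exact (h.mem_𝔥 _).2 (D.proj_proj_self _ _)
    · refine Submodule.mem_sup_right (Submodule.mem_iSup_of_mem (σ k)
        (Submodule.mem_iSup_of_mem ?_ (h.proj_mem k X)))
      rw [hf]
      exact hk
  · rw [hX k (not_le.1 hk)]
    exact Submodule.zero_mem _

/-- The contracted bracket of the splitting is the bracket of the Inönü-Wigner contraction. -/
theorem isContractedBracket (h : IsAdapted D σ) (hf : ∀ k, f (σ k) = deg (some k)) :
    IsContractedBracket n₁ n₂ n₃ f D.contracted := by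
  intro a b X hX Y hY
  have hX' := h.mem_gradedPiece a X hX hf
  have hY' := h.mem_gradedPiece b Y hY hf
  have key (k : Option (Fin 6)) : D.proj k (D.contracted X Y) =
      if deg k = a + b then D.proj k ⁅X, Y⁆ else 0 := by
    have e : D.proj k ⁅X, Y⁆ = ∑ i, ∑ j, D.proj k ⁅D.proj i X, D.proj j Y⁆ :=
      D.proj_lie_eq_sum k X Y
    rw [proj_contracted_apply, e]
    split_ifs with hk
    · refine Finset.sum_congr rfl fun i _ => Finset.sum_congr rfl fun j _ => ?_
      by_cases hi : deg i = a
      · by_cases hj : deg j = b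
        · rw [if_pos (by rw [hi, hj, hk])]
        · rw [hY' j hj, lie_zero, map_zero, ite_self]
      · rw [hX' i hi, zero_lie, map_zero, ite_self]
    · refine Finset.sum_eq_zero fun i _ => Finset.sum_eq_zero fun j _ => ?_
      by_cases hi : deg i = a
      · by_cases hj : deg j = b
        · rw [if_neg (by rw [hi, hj]; exact fun h' => hk h'.symm)]
        · rw [hY' j hj, lie_zero, map_zero, ite_self]
      · rw [hX' i hi, zero_lie, map_zero, ite_self]
  refine ⟨h.mem_gradedPiece_of _ _ hf fun k hk => by rw [key, if_neg hk],
    h.mem_filtration_of _ _ hf fun k hk => ?_⟩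
  rw [map_sub, key]
  split_ifs with hk'
  · rw [sub_self]
  · rw [sub_zero]
    have e : D.proj k ⁅X, Y⁆ = ∑ i, ∑ j, D.proj k ⁅D.proj i X, D.proj j Y⁆ :=
      D.proj_lie_eq_sum k X Y
    rw [e]
    refine Finset.sum_eq_zero fun i _ => Finset.sum_eq_zero fun j _ => ?_
    by_cases hi : deg i = a
    · by_cases hj : deg j = b
      -- Here deg k > a + b − 1 and deg k ≠ a + b, so the degree exceeds a + b and the filtration
      -- property applies.
      · exact D.proj_lie_of_deg_lt (by omega) (D.proj_proj_self _ _) (D.proj_proj_self _ _)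
      · rw [hY' j hj, lie_zero, map_zero]
    · rw [hX' i hi, zero_lie, map_zero]

end IsAdapted

end Flag
end

/-! ### The face of the Newton polytope. -/

noncomputable section

/-- The face of a convex hull on which a linear form attains its maximum is spanned by the
generators which it contains. -/
lemma face_convexHull {E : Type*} [AddCommGroup E] [Module ℝ E] {S S₀ : Set E} (φ : E →ₗ[ℝ] ℝ)
    (hS : S₀ ⊆ S) (hne : S₀.Nonempty) (hφ : ∀ x ∈ S, φ x ≤ 0) (h₀ : ∀ x ∈ S₀, φ x = 0)
    (h : ∀ x ∈ S, φ x = 0 → x ∈ S₀) :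
    {x ∈ convexHull ℝ S | ∀ y ∈ convexHull ℝ S, φ y ≤ φ x} = convexHull ℝ S₀ := by
  -- This convex set contains S, hence the hull of S. In a convex combination with φ = 0, each point
  -- of nonzero weight must itself have φ = 0.
  have hC : Convex ℝ {x | φ x ≤ 0 ∧ (φ x = 0 → x ∈ convexHull ℝ S₀)} := by
    rintro x ⟨hx, hx'⟩ y ⟨hy, hy'⟩ a b ha hb hab
    have e : φ (a • x + b • y) = a * φ x + b * φ y := by simp
    have h1 : a * φ x ≤ 0 := mul_nonpos_of_nonneg_of_nonpos ha hx
    have h2 : b * φ y ≤ 0 := mul_nonpos_of_nonneg_of_nonpos hb hy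
    refine ⟨by rw [e]; linarith, fun h0 => ?_⟩
    rw [e] at h0
    rcases mul_eq_zero.1 (show a * φ x = 0 by linarith) with h3 | h3
    · subst h3
      obtain rfl : b = 1 := by linarith
      simpa using hy' (by linarith)
    · rcases mul_eq_zero.1 (show b * φ y = 0 by linarith) with h4 | h4
      · subst h4
        obtain rfl : a = 1 := by linarith
        simpa using hx' h3
      · exact convex_convexHull ℝ S₀ (hx' h3) (hy' h4) ha hb hab
  have hSC : convexHull ℝ S ⊆ {x | φ x ≤ 0 ∧ (φ x = 0 → x ∈ convexHull ℝ S₀)} :=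
    convexHull_min (fun x hx => ⟨hφ x hx, fun h0 => subset_convexHull ℝ S₀ (h x hx h0)⟩) hC
  have hK : convexHull ℝ S₀ ⊆ {x | φ x = 0} := by
    refine convexHull_min h₀ fun x hx y hy a b _ _ _ => ?_
    change φ (a • x + b • y) = 0
    rw [map_add, map_smul, map_smul, show φ x = 0 from hx, show φ y = 0 from hy]
    simp
  obtain ⟨s, hs⟩ := hne
  refine Set.Subset.antisymm ?_ fun x hx => ⟨convexHull_mono hS hx, fun y hy => ?_⟩
  · rintro x ⟨hx, hx'⟩
    refine (hSC hx).2 (le_antisymm (hSC hx).1 ?_)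
    rw [← h₀ s hs]
    exact hx' s (subset_convexHull ℝ S (hS hs))
  · rw [show φ x = 0 from hK hx]
    exact (hSC hy).1

namespace BlockData

open Matrix LieAlgebra.Orthogonal

variable {ι : Type*} [Fintype ι] [DecidableEq ι] (D : BlockData ι)

lemma traceForm_zero_left (X : so ι ℝ) : traceForm 0 X = 0 := by simp [traceForm]

/-- A nonzero structure constant means that π_l ∘ ad X ∘ π_k is not zero. As the trace form is
definite, a nonzero value pairs nontrivially with itself, which provides a triple. -/
lemma exists_traceForm_ne_zero {k l : Fin 6} {X : so ι ℝ} (h : D.tau k l X X ≠ 0) :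
    ∃ V, traceForm (D.proj (some l) ⁅X, D.proj (some k) V⁆) ⁅X, D.proj (some k) V⁆ ≠ 0 := by
  by_contra! hV
  refine h ?_
  have e : D.proj (some l) ∘ₗ (LieAlgebra.ad ℝ (so ι ℝ) X).comp (D.proj (some k)) = 0 := by
    refine LinearMap.ext fun V => ?_
    refine traceForm_self_eq_zero ?_
    have := hV V
    rw [← D.proj_proj_self, traceForm_proj_left, D.proj_proj_self] at this
    exact this
  have e2 : D.proj (some k) = D.proj (some k) ∘ₗ D.proj (some k) :=
    LinearMap.ext fun V => (D.proj_proj_self _ V).symm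
  rw [tau, e2, LinearMap.comp_assoc, LinearMap.trace_comp_comm']
  simp only [LinearMap.comp_assoc]
  rw [e]
  simp

/-- If the summand were zero, the map M ↦ q M o would vanish, although its trace is tr q · tr o. -/
lemma exists_ne_zero_five (hq : D.q.trace ≠ 0) (ho : D.o.trace ≠ 0) :
    ∃ X, D.proj (some 5) X = X ∧ X ≠ 0 := by
  by_contra! hX
  have h0 (M : Matrix ι ι ℝ) : sandwich D.q D.o M = 0 := by
    have h1 := hX (D.proj (some 5) (skewPart (D.q * M * D.o))) (D.proj_proj_self _ _)
    have h2 := congrArg (fun Y : so ι ℝ => (2 : ℝ) • (D.q * Y.1 * D.o)) h1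
    simp only [coe_proj, coe_skewPart] at h2
    simp [matProj, sandwich_apply, mul_sub, mul_add, sub_mul, add_mul, mul_assoc] at h2
    rw [sandwich_apply]
    simpa [← mul_assoc] using h2
  have := trace_sandwich D.q D.o
  rw [show sandwich D.q D.o = 0 from LinearMap.ext h0, map_zero] at this
  exact mul_ne_zero hq ho this.symm

end BlockData

namespace Flag

open Matrix BlockData LieAlgebra.Orthogonal

variable {n₁ n₂ n₃ : ℕ}

lemma two_lt_card (h₃ : 1 < n₃) : 2 < Fintype.card (Idx n₁ n₂ n₃) := by
  simp only [Fintype.card_sum, Fintype.card_prod, Fintype.card_fin]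
  omega

lemma killingForm_eq (X Y : 𝔤 n₁ n₂ n₃) : killingForm ℝ (𝔤 n₁ n₂ n₃) X Y =
    ((Fintype.card (Idx n₁ n₂ n₃) : ℝ) - 2) * traceForm X Y := killingForm_so X Y

namespace IsAdapted

variable {D : BlockData (Idx n₁ n₂ n₃)} {σ : Equiv.Perm (Fin 6)} {f : Fin 6 → ℤ}

lemma isTriple_of_tau (h : IsAdapted D σ) (h₃ : 1 < n₃) {i k l : Fin 6} {X : 𝔤 n₁ n₂ n₃}
    (hX : D.proj (some i) X = X) (hτ : D.tau k l X X ≠ 0) :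
    IsTriple n₁ n₂ n₃ (σ l) (σ i) (σ k) := by
  obtain ⟨V, hV⟩ := D.exists_traceForm_ne_zero hτ
  refine ⟨D.proj (some l) ⁅X, D.proj (some k) V⁆, h.proj_mem l _, X, (h.mem_𝔪 i X).2 hX, _, h.proj_mem k V, ?_⟩
  rw [killingForm_eq]
  refine mul_ne_zero ?_ hV
  have := two_lt_card (n₁ := n₁) (n₂ := n₂) h₃
  rw [sub_ne_zero]
  exact_mod_cast this.ne'

lemma compatible_of_isTriple (h : IsAdapted D σ) {i j k : Fin 6}
    (ht : IsTriple n₁ n₂ n₃ (σ i) (σ j) (σ k)) :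
    Compatible (some j) (some k) (some i) := by
  obtain ⟨X, hX, Y, hY, Z, hZ, hB⟩ := ht
  by_contra hc
  refine hB ?_
  have h0 := D.proj_lie_of_not_compatible hc ((h.mem_𝔪 _ _).1 hY) ((h.mem_𝔪 _ _).1 hZ)
  rw [killingForm_eq, ← (h.mem_𝔪 _ _).1 hX, traceForm_proj_left, h0]
  simp [traceForm]

lemma isTriples (h : IsAdapted D σ) (h₃ : 1 < n₃) (hp : D.p.trace ≠ 0)
    (hq : D.q.trace / 2 - 1 ≠ 0) (hq' : D.q.trace ≠ 0) (ho : D.o.trace ≠ 0) :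
    IsTriple n₁ n₂ n₃ (σ 3) (σ 1) (σ 2) ∧ IsTriple n₁ n₂ n₃ (σ 1) (σ 5) (σ 5) ∧
      IsTriple n₁ n₂ n₃ (σ 4) (σ 5) (σ 2) ∧ IsTriple n₁ n₂ n₃ (σ 3) (σ 5) (σ 4) := by
  obtain ⟨X, hX, hX0⟩ := D.exists_ne_zero_five hq' ho
  have hXX : traceForm X X ≠ 0 := fun h' => hX0 (traceForm_self_eq_zero h')
  have h51 : D.tau 5 1 X X ≠ 0 := by
    rw [D.tau_five_one hX hX]
    exact mul_ne_zero (div_ne_zero hq two_ne_zero) hXX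
  refine ⟨?_, h.isTriple_of_tau h₃ hX h51, h.isTriple_of_tau h₃ hX ?_,
    h.isTriple_of_tau h₃ hX ?_⟩
  -- A nonzero element of summand 1 is needed; it is obtained as a component of a bracket of
  -- elements of summand 5.
  · obtain ⟨V, hV⟩ := D.exists_traceForm_ne_zero h51
    set Y := D.proj (some 1) ⁅X, D.proj (some 5) V⁆ with hY
    have hY1 : D.proj (some 1) Y = Y := D.proj_proj_self _ _
    refine h.isTriple_of_tau h₃ hY1 ?_
    rw [D.tau_two_three hY1 hY1]
    refine mul_ne_zero (div_ne_zero hp two_ne_zero) fun h' => hV ?_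
    rw [traceForm_self_eq_zero h']
    simp [traceForm]
  · rw [D.tau_two_four hX hX]
    exact mul_ne_zero (div_ne_zero hp four_ne_zero) hXX
  · rw [D.tau_comm, D.tau_three_four hX hX]
    exact mul_ne_zero (div_ne_zero hp four_ne_zero) hXX

/-- The face of the Newton polytope is a parallelogram. -/
theorem isParallelogram_face (h : IsAdapted D σ) (hf : ∀ k, f (σ k) = deg (some k))
    (h₃ : 1 < n₃) (hp : D.p.trace ≠ 0) (hq : D.q.trace / 2 - 1 ≠ 0) (hq' : D.q.trace ≠ 0)
    (ho : D.o.trace ≠ 0) : IsParallelogram (face n₁ n₂ n₃ f) := by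
  set e : Fin 6 → Fin 6 → ℝ := fun k => Pi.single (σ k) 1 with he
  have he' (k l : Fin 6) : e k (σ l) = if l = k then 1 else 0 := by
    simp [he, Pi.single_apply]
  have hd : ∀ i : Fin 6, 0 < deg (some i) := by decide
  obtain ⟨t1, t2, t3, t4⟩ := h.isTriples h₃ hp hq hq' ho
  refine ⟨e 3 - e 1 - e 2, e 4 - e 5 - e 3 + e 1, e 1 + e 2 - e 4 - e 5, ?_, ?_⟩
  · rw [LinearIndependent.pair_iff]
    intro a b hab
    -- Coordinate 3 occurs only in the first edge vector and coordinate 2 only in the second.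
    have h3 := congrFun hab (σ 3)
    have h2 := congrFun hab (σ 2)
    simp [he'] at h2 h3
    exact ⟨h3, h2⟩
  · set φ : (Fin 6 → ℝ) →ₗ[ℝ] ℝ := ∑ i, (f i : ℝ) • LinearMap.proj i with hφ
    have hφa (x : Fin 6 → ℝ) : φ x = ∑ i, (f i : ℝ) * x i := by simp [hφ]
    have hφe (k : Fin 6) : φ (e k) = (deg (some k) : ℝ) := by
      rw [hφa, he, Finset.sum_eq_single (σ k)]
      · simp [hf]
      · intro j _ hj
        simp [hj]
      · simp
    have hset : ({e 3 - e 1 - e 2, e 3 - e 1 - e 2 + (e 4 - e 5 - e 3 + e 1),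
        e 3 - e 1 - e 2 + (e 1 + e 2 - e 4 - e 5),
        e 3 - e 1 - e 2 + (e 4 - e 5 - e 3 + e 1) + (e 1 + e 2 - e 4 - e 5)} :
        Set (Fin 6 → ℝ)) =
        {e 3 - e 1 - e 2, e 4 - e 5 - e 2, e 3 - e 5 - e 4, e 1 - e 5 - e 5} := by
      congr 1
      rw [show e 3 - e 1 - e 2 + (e 4 - e 5 - e 3 + e 1) = e 4 - e 5 - e 2 by abel,
        show e 3 - e 1 - e 2 + (e 1 + e 2 - e 4 - e 5) = e 3 - e 5 - e 4 by abel,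
        show e 4 - e 5 - e 2 + (e 1 + e 2 - e 4 - e 5) = e 1 - e 5 - e 5 by abel]
    rw [hset, face, newtonPolytope]
    simp only [← hφa]
    -- The maximum of φ is 0: the points −e_i have negative value, and a triple has value at most 0
    -- by the filtration property, with equality exactly for the contracted brackets.
    refine face_convexHull φ ?_ ⟨_, Or.inl rfl⟩ ?_ ?_ ?_
    · rintro x (rfl | rfl | rfl | rfl)
      · exact Or.inr ⟨_, _, _, t1, rfl⟩
      · exact Or.inr ⟨_, _, _, t3, rfl⟩
      · exact Or.inr ⟨_, _, _, t4, rfl⟩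
      · exact Or.inr ⟨_, _, _, t2, rfl⟩
    · rintro x (⟨i, rfl⟩ | ⟨i, j, k, ht, rfl⟩)
      · obtain ⟨i, rfl⟩ := σ.surjective i
        change φ (-e i) ≤ 0
        rw [map_neg, hφe]
        simpa using (hd i).le
      · obtain ⟨i, rfl⟩ := σ.surjective i
        obtain ⟨j, rfl⟩ := σ.surjective j
        obtain ⟨k, rfl⟩ := σ.surjective k
        change φ (e i - e j - e k) ≤ 0
        have := deg_le_of_compatible _ _ _ (h.compatible_of_isTriple ht)
        rw [map_sub, map_sub, hφe, hφe, hφe, sub_sub, sub_nonpos]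
        exact_mod_cast this
    · rintro x (rfl | rfl | rfl | rfl) <;> simp only [map_sub, hφe]
      · exact_mod_cast (by decide : deg (some 3) - deg (some 1) - deg (some 2) = 0)
      · exact_mod_cast (by decide : deg (some 4) - deg (some 5) - deg (some 2) = 0)
      · exact_mod_cast (by decide : deg (some 3) - deg (some 5) - deg (some 4) = 0)
      · exact_mod_cast (by decide : deg (some 1) - deg (some 5) - deg (some 5) = 0)
    · rintro x (⟨i, rfl⟩ | ⟨i, j, k, ht, rfl⟩) hx
      · obtain ⟨i, rfl⟩ := σ.surjective i
        change φ (-e i) = 0 at hx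
        rw [map_neg, hφe, neg_eq_zero] at hx
        exact absurd hx (by exact_mod_cast (hd i).ne')
      · obtain ⟨i, rfl⟩ := σ.surjective i
        obtain ⟨j, rfl⟩ := σ.surjective j
        obtain ⟨k, rfl⟩ := σ.surjective k
        change φ (e i - e j - e k) = 0 at hx
        rw [map_sub, map_sub, hφe, hφe, hφe, sub_sub, sub_eq_zero] at hx
        have hb := mem_brackets_of_compatible j k i (h.compatible_of_isTriple ht)
          (by exact_mod_cast hx.symm)
        change e i - e j - e k ∈ _
        simp only [brackets, Finset.mem_insert, Finset.mem_singleton, Prod.mk.injEq] at hb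
        rcases hb with ⟨rfl, rfl, rfl⟩ | ⟨rfl, rfl, rfl⟩ | ⟨rfl, rfl, rfl⟩ | ⟨rfl, rfl, rfl⟩ |
          ⟨rfl, rfl, rfl⟩ | ⟨rfl, rfl, rfl⟩ | ⟨rfl, rfl, rfl⟩
        · exact Or.inl rfl
        · exact Or.inl (sub_right_comm _ _ _)
        · exact Or.inr (Or.inr (Or.inr rfl))
        · exact Or.inr (Or.inl (sub_right_comm _ _ _))
        · exact Or.inr (Or.inl rfl)
        · exact Or.inr (Or.inr (Or.inl (sub_right_comm _ _ _)))
        · exact Or.inr (Or.inr (Or.inl rfl))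

end IsAdapted

end Flag
end

/-! ### Isotropy automorphisms and invariance of the metric. -/

noncomputable section

lemma NilpotentExp.exp3_intertwine {R : Type*} [Ring R] [Algebra ℝ R] {u a b : R}
    (h : u * a = b * u) : u * exp3 a = exp3 b * u := by
  have h2 : u * (a * a) = b * b * u := by rw [← mul_assoc, h, mul_assoc, h, mul_assoc]
  have h3 : u * (a * (a * a)) = b * (b * b) * u := by
    rw [← mul_assoc, h, mul_assoc, h2]; simp only [mul_assoc]
  simp only [exp3, mul_add, add_mul, mul_smul_comm, smul_mul_assoc, h, h2, h3, mul_one, one_mul]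

/-- For nilpotent A, exp A − 1 is A times an invertible operator. Here the invertibility is made
explicit by applying A twice, then once. -/
lemma NilpotentExp.eq_zero_of_exp3_apply {V : Type*} [AddCommGroup V] [Module ℝ V]
    {A : Module.End ℝ V} (hA : A * (A * (A * A)) = 0) {Z : V} (h : exp3 A Z = Z) : A Z = 0 := by
  have hA4 : A (A (A (A Z))) = 0 := by
    have := congrArg (fun T : Module.End ℝ V => T Z) hA
    exact this
  have e : A Z + (1 / 2 : ℝ) • A (A Z) + (1 / 6 : ℝ) • A (A (A Z)) = 0 := by
    have h' : Z + A Z + (1 / 2 : ℝ) • A (A Z) + (1 / 6 : ℝ) • A (A (A Z)) = Z := h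
    have := sub_eq_zero.2 h'
    rw [← this]
    abel
  have e2 := congrArg (fun V => A (A V)) e
  simp only [map_add, map_smul, hA4, map_zero, smul_zero, add_zero] at e2
  have e1 := congrArg (fun V => A V) e
  simp only [map_add, map_smul, e2, map_zero, smul_zero, add_zero] at e1
  simpa [e1, e2] using e

lemma PseudoRiemannian.maurerCartan_comm {E : Type*} [NormedAddCommGroup E] [NormedSpace ℝ E]
    {br : E →L[ℝ] E →L[ℝ] E} (L : E →ₗ[ℝ] E) (hL : ∀ x y, br (L x) (L y) = L (br x y)) (x u : E) :
    maurerCartan br (L x) (L u) = L (maurerCartan br x u) := by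
  change L u - (1 / 2 : ℝ) • br (L x) (L u) + (1 / 6 : ℝ) • br (L x) (br (L x) (L u)) =
    L (u - (1 / 2 : ℝ) • br x u + (1 / 6 : ℝ) • br x (br x u))
  simp only [hL, map_add, map_sub, map_smul]

/-- A left-invariant metric is invariant under the composition of a translation and an isometric
automorphism. -/
lemma NilpotentExp.leftInvariantMetric_invariant {E : Type*} [NormedAddCommGroup E]
    [NormedSpace ℝ E] [FiniteDimensional ℝ E] {br : E →L[ℝ] E →L[ℝ] E} {B : E →L[ℝ] E →L[ℝ] ℝ}
    (L : E →ₗ[ℝ] E)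
    (h : ∀ z x u, PseudoRiemannian.maurerCartan br (bch br z x) (fderiv ℝ (bch br z) x u) =
      PseudoRiemannian.maurerCartan br x u)
    (hL : ∀ x y, br (L x) (L y) = L (br x y)) (hB : ∀ x y, B (L x) (L y) = B x y) (z x v w : E) :
    PseudoRiemannian.leftInvariantMetric B br (bch br z (L x))
      (fderiv ℝ (fun y => bch br z (L y)) x v) (fderiv ℝ (fun y => bch br z (L y)) x w) =
      PseudoRiemannian.leftInvariantMetric B br x v w := by
  have hfd (y : E) : fderiv ℝ (fun y => bch br z (L y)) x y =
      fderiv ℝ (bch br z) (L x) (L y) := by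
    have hd : DifferentiableAt ℝ (bch br z) (L x) :=
      ((contDiff_bch contDiff_const contDiff_id).differentiable (by simp)) _
    have := hd.hasFDerivAt.comp x (LinearMap.toContinuousLinearMap L).hasFDerivAt
    change fderiv ℝ (bch br z ∘ L) x y = _
    rw [this.fderiv]
    rfl
  rw [hfd, hfd, PseudoRiemannian.leftInvariantMetric_apply,
    PseudoRiemannian.leftInvariantMetric_apply, h, h, PseudoRiemannian.maurerCartan_comm L hL,
    PseudoRiemannian.maurerCartan_comm L hL, hB]

namespace BlockData

open Matrix LieAlgebra.Orthogonal NilpotentExp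

attribute [local irreducible] proj contracted retract coordBilin coordBracket coordRep coordForm
  metricForm traceForm coordMetric

variable {ι : Type*} [Fintype ι] [DecidableEq ι] (D : BlockData ι)

/-- The linear map `u` preserves the whole structure of the contraction. -/
structure IsAutomorphism (u : so ι ℝ →ₗ[ℝ] so ι ℝ) : Prop where
  proj : ∀ k X, D.proj k (u X) = u (D.proj k X)
  contracted : ∀ X Y, D.contracted (u X) (u Y) = u (D.contracted X Y)
  traceForm : ∀ X Y, traceForm (u X) (u Y) = traceForm X Y
  center : ∀ a b, u (D.centerSo a b) = D.centerSo a b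

lemma isAutomorphism_of_conj {k l : Matrix ι ι ℝ} {u : so ι ℝ →ₗ[ℝ] so ι ℝ}
    (hk : ∀ a b, Commute k (D.center a b)) (hl : ∀ a b, Commute l (D.center a b))
    (hlk : l * k = 1) (hu : ∀ X, (u X : Matrix ι ι ℝ) = k * X * l) : D.IsAutomorphism u := by
  have hI : D.center 1 0 = D.I := by simp [BlockData.center]
  have hJ : D.center 0 1 = D.J := by simp [BlockData.center]
  have h1 := hk 1 0
  have h2 := hk 0 1
  have h3 := hl 1 0
  have h4 := hl 0 1
  rw [hI] at h1 h3
  rw [hJ] at h2 h4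
  refine ⟨D.proj_conj u h1 h2 h3 h4 hu, D.contracted_conj u h1 h2 h3 h4 hlk hu,
    fun X Y => by rw [traceForm, traceForm, trace_conj u hlk hu], fun a b => Subtype.ext ?_⟩
  rw [hu]
  change k * D.center a b * l = D.center a b
  rw [mul_assoc, ← (hl a b).eq, ← mul_assoc, mul_eq_one_comm.1 hlk, one_mul]

variable {E : Type*} [NormedAddCommGroup E] [NormedSpace ℝ E] {W : Submodule ℝ (so ι ℝ)}
  (c : E ≃ₗ[ℝ] W) (hW : ∀ X, X ∈ W ↔ D.proj none X = 0)

lemma coordRep_pow_four (hW : ∀ X, X ∈ W ↔ D.proj none X = 0) (x : E) :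
    D.coordRep c x * (D.coordRep c x * (D.coordRep c x * D.coordRep c x)) = 0 :=
  D.coordRep_nilpotent c hW x x x x

/-- An exponential which fixes the centre is trivial. -/
lemma eq_zero_of_exp3_centerSo (hW : ∀ X, X ∈ W ↔ D.proj none X = 0) {x : E}
    (h : exp3 (D.coordRep c x) (D.centerSo 10 3) = D.centerSo 10 3) : x = 0 := by
  refine embed_injective c ?_
  rw [map_zero]
  refine D.eq_zero_of_contracted_centerSo (D.proj_none_embed c hW x) ?_
  rw [← coordRep_apply]
  exact eq_zero_of_exp3_apply (D.coordRep_pow_four c hW x) h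

/-- The linear map on the coordinate space induced by `u`. -/
def coordAut (u : so ι ℝ →ₗ[ℝ] so ι ℝ) : E →ₗ[ℝ] E := D.retract c hW ∘ₗ u ∘ₗ embed c

variable {D}

lemma IsAutomorphism.embed_coordAut {u : so ι ℝ →ₗ[ℝ] so ι ℝ} (hu : D.IsAutomorphism u) (x : E) :
    embed c (D.coordAut c hW u x) = u (embed c x) := by
  rw [coordAut, LinearMap.comp_apply, LinearMap.comp_apply, D.embed_retract_of c hW]
  rw [hu.proj, D.proj_none_embed c hW, map_zero]

lemma IsAutomorphism.mul_coordRep {u : so ι ℝ →ₗ[ℝ] so ι ℝ} (hu : D.IsAutomorphism u) (x : E) :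
    (show Module.End ℝ (so ι ℝ) from u) * D.coordRep c x =
      D.coordRep c (D.coordAut c hW u x) * (show Module.End ℝ (so ι ℝ) from u) := by
  refine LinearMap.ext fun Z => ?_
  rw [Module.End.mul_apply, Module.End.mul_apply, coordRep_apply, coordRep_apply,
    hu.embed_coordAut c hW, hu.contracted]

variable [FiniteDimensional ℝ E]

lemma IsAutomorphism.coordBracket_coordAut {u : so ι ℝ →ₗ[ℝ] so ι ℝ} (hu : D.IsAutomorphism u)
    (x y : E) : D.coordBracket c hW (D.coordAut c hW u x) (D.coordAut c hW u y) =
      D.coordAut c hW u (D.coordBracket c hW x y) := by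
  refine embed_injective c ?_
  rw [embed_coordBracket, hu.embed_coordAut, hu.embed_coordAut, hu.embed_coordAut,
    embed_coordBracket, hu.contracted]

lemma IsAutomorphism.coordForm_coordAut {u : so ι ℝ →ₗ[ℝ] so ι ℝ} (hu : D.IsAutomorphism u)
    (t : Fin 6 → ℝ) (x y : E) :
    D.coordForm c t (D.coordAut c hW u x) (D.coordAut c hW u y) = D.coordForm c t x y := by
  rw [coordForm_apply, coordForm_apply, hu.embed_coordAut, hu.embed_coordAut, metricForm_apply,
    metricForm_apply]
  refine Finset.sum_congr rfl fun k _ => ?_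
  rw [hu.proj, hu.proj, hu.traceForm]

/-- The metric is invariant under affine maps built from a translation and an automorphism. -/
lemma IsAutomorphism.coordMetric_invariant {u : so ι ℝ →ₗ[ℝ] so ι ℝ} (hu : D.IsAutomorphism u)
    (t : Fin 6 → ℝ) (z x v w : E) :
    D.coordMetric c hW t (bch (D.coordBracket c hW) z (D.coordAut c hW u x))
      (fderiv ℝ (fun y => bch (D.coordBracket c hW) z (D.coordAut c hW u y)) x v)
      (fderiv ℝ (fun y => bch (D.coordBracket c hW) z (D.coordAut c hW u y)) x w) =
      D.coordMetric c hW t x v w := by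
  have h1 := maurerCartan_fderiv_bch (D.coordBracket_skew c hW) (D.coordRep_injective c hW)
      (D.coordRep_bracket c hW) (D.coordRep_nilpotent c hW)
  rw [coordMetric]
  exact leftInvariantMetric_invariant (D.coordAut c hW u) h1
    (hu.coordBracket_coordAut c hW) (hu.coordForm_coordAut c hW t) z x v w

variable (D)

lemma coordMetric_zero (t : Fin 6 → ℝ) (v w : E) :
    D.coordMetric c hW t 0 v w = D.metricForm t (embed c v) (embed c w) := by
  have h (y : E) : PseudoRiemannian.maurerCartan (D.coordBracket c hW) 0 y = y := by
    simp [PseudoRiemannian.maurerCartan]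
  rw [coordMetric, PseudoRiemannian.leftInvariantMetric_apply, h, h, coordForm_apply]

end BlockData
end

/-! ### The contracted group, the global chart and the invariant metric on it. -/

noncomputable section

/-- By Cayley-Hamilton the power A^(dim V) vanishes, so the cut-off after dim V is harmless even in
small dimension, where it comes before the cubic term. Both sums agree with a longer one. -/
lemma NilpotentExp.sum_eq_exp3 {V : Type*} [AddCommGroup V] [Module ℝ V] [FiniteDimensional ℝ V]
    {A : Module.End ℝ V} (hA : A * (A * (A * A)) = 0) :
    ∑ k ∈ Finset.range (Module.finrank ℝ V + 1), ((k.factorial : ℝ)⁻¹ • A ^ k) = exp3 A := by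
  have h4 : A ^ 4 = 0 := by
    rw [← hA]
    simp only [pow_succ, pow_zero, one_mul, mul_assoc]
  have hN : A ^ Module.finrank ℝ V = 0 := by
    have h := LinearMap.aeval_self_charpoly A
    rwa [IsNilpotent.charpoly_eq_X_pow_finrank ⟨4, h4⟩, map_pow, Polynomial.aeval_X] at h
  have e1 (n : ℕ) (hn : ∀ k, n ≤ k → A ^ k = 0) (m : ℕ) (hm : n ≤ m) :
      ∑ k ∈ Finset.range n, ((k.factorial : ℝ)⁻¹ • A ^ k) =
        ∑ k ∈ Finset.range m, ((k.factorial : ℝ)⁻¹ • A ^ k) := by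
    refine Finset.sum_subset (Finset.range_mono hm) fun k _ hk => ?_
    rw [hn k (by simpa using hk), smul_zero]
  rw [e1 _ (fun k hk => pow_eq_zero_of_le ((Nat.le_succ _).trans hk) hN)
    (Module.finrank ℝ V + 1 + 4) (by omega),
    ← e1 4 (fun k hk => pow_eq_zero_of_le hk h4) _ (by omega)]
  simp only [Finset.sum_range_succ, Finset.sum_range_zero, Nat.factorial, pow_succ, pow_zero,
    one_mul, exp3, mul_assoc]
  norm_num

namespace Flag

open Matrix BlockData LieAlgebra.Orthogonal NilpotentExp

attribute [local irreducible] BlockData.proj BlockData.contracted BlockData.retract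
  BlockData.coordBilin BlockData.coordBracket BlockData.coordRep BlockData.coordForm
  BlockData.metricForm BlockData.traceForm BlockData.coordMetric BlockData.coordAut

variable {n₁ n₂ n₃ : ℕ}

lemma val_expAd {β : 𝔤 n₁ n₂ n₃ →ₗ[ℝ] 𝔤 n₁ n₂ n₃ →ₗ[ℝ] 𝔤 n₁ n₂ n₃} {X : 𝔤 n₁ n₂ n₃}
    (h : (β X : Module.End ℝ (𝔤 n₁ n₂ n₃)) * ((β X : Module.End ℝ (𝔤 n₁ n₂ n₃)) *
      ((β X : Module.End ℝ (𝔤 n₁ n₂ n₃)) * (β X : Module.End ℝ (𝔤 n₁ n₂ n₃)))) = 0) :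
    (expAd β X).1 = exp3 (β X : Module.End ℝ (𝔤 n₁ n₂ n₃)) := by
  have e : expEnd β X = exp3 (β X : Module.End ℝ (𝔤 n₁ n₂ n₃)) := sum_eq_exp3 h
  generalize (β X : Module.End ℝ (𝔤 n₁ n₂ n₃)) = A at h e
  have h1 : exp3 (-A) * exp3 A = 1 := exp3_neg_mul_exp3 h
  have h2 : exp3 A * exp3 (-A) = 1 := by
    have := exp3_neg_mul_exp3 (a := -A) (by simpa using h)
    rwa [neg_neg] at this
  have hu : IsUnit (expEnd β X) := by
    rw [e]
    exact ⟨⟨_, _, h2, h1⟩, rfl⟩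
  rw [expAd, dif_pos hu, IsUnit.unit_spec, e]

variable {E : Type*} [NormedAddCommGroup E] [NormedSpace ℝ E]

lemma embed_apply (c : E ≃ₗ[ℝ] 𝔪sum n₁ n₂ n₃) (x : E) :
    embed c x = (c x : 𝔤 n₁ n₂ n₃) := rfl

namespace IsAdapted

variable {D : BlockData (Idx n₁ n₂ n₃)} {σ : Equiv.Perm (Fin 6)}

lemma isAutomorphism (h : IsAdapted D σ) {u : (Module.End ℝ (𝔤 n₁ n₂ n₃))ˣ}
    (hu : u ∈ isotropy n₁ n₂ n₃) : D.IsAutomorphism u.1 := by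
  obtain ⟨k, hk, hkc, hku⟩ := hu
  have hk1 : star k * k = 1 :=
    (mem_orthogonalGroup_iff' _ _).1 (mem_specialOrthogonalGroup_iff.1 hk).1
  have hk2 : k * star k = 1 := mul_eq_one_comm.1 hk1
  have hc : ∀ a b, Commute k (D.center a b) := fun a b => by
    obtain ⟨a', b', h1, -⟩ := h.central_of_center a b
    rw [h1]
    exact hkc a' b'
  refine D.isAutomorphism_of_conj hc (fun a b => ?_) hk1 hku
  calc star k * D.center a b = star k * (D.center a b * k) * star k := by
        rw [mul_assoc, mul_assoc, hk2, mul_one]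
    _ = D.center a b * star k := by rw [← (hc a b).eq, ← mul_assoc, hk1, one_mul]

variable (c : E ≃ₗ[ℝ] 𝔪sum n₁ n₂ n₃)

lemma coe_expAd (h : IsAdapted D σ) (x : E) :
    (expAd D.contracted (c x : 𝔤 n₁ n₂ n₃)).1 = exp3 (D.coordRep c x) := by
  have h4 := D.coordRep_pow_four c h.mem_𝔪sum x
  rw [coordRep_apply, embed_apply] at h4 ⊢
  exact val_expAd h4

/-- The action of the isotropy group in exponential coordinates. -/
def act (h : IsAdapted D σ) (u : (Module.End ℝ (𝔤 n₁ n₂ n₃))ˣ) :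
    E →ₗ[ℝ] E := D.coordAut c h.mem_𝔪sum u.1

lemma coe_act (h : IsAdapted D σ) {u : (Module.End ℝ (𝔤 n₁ n₂ n₃))ˣ}
    (hu : u ∈ isotropy n₁ n₂ n₃) (x : E) :
    (c (h.act c u x) : 𝔤 n₁ n₂ n₃) = u.1 (c x) :=
  (h.isAutomorphism hu).embed_coordAut c h.mem_𝔪sum x

lemma expAd_injective (h : IsAdapted D σ) {x y : E}
    (hxy : expAd D.contracted (c x : 𝔤 n₁ n₂ n₃) = expAd D.contracted (c y : 𝔤 n₁ n₂ n₃)) :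
    x = y := by
  have e := congrArg Units.val hxy
  rw [h.coe_expAd, h.coe_expAd] at e
  exact D.coordRep_injective c h.mem_𝔪sum (exp3_injective
    (D.coordRep_pow_four c h.mem_𝔪sum x) (D.coordRep_pow_four c h.mem_𝔪sum y) e)

lemma expAd_zero (h : IsAdapted D σ) :
    expAd D.contracted (c 0 : 𝔤 n₁ n₂ n₃) = 1 := by
  refine Units.ext ?_
  rw [h.coe_expAd, map_zero, exp3_zero, Units.val_one]

lemma expAd_inv (h : IsAdapted D σ) (x : E) :
    (expAd D.contracted (c x : 𝔤 n₁ n₂ n₃))⁻¹ = expAd D.contracted (c (-x) : 𝔤 n₁ n₂ n₃) := by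
  rw [inv_eq_iff_mul_eq_one]
  refine mul_eq_one_comm.1 (Units.ext ?_)
  rw [Units.val_mul, h.coe_expAd, h.coe_expAd, map_neg, Units.val_one]
  exact exp3_neg_mul_exp3 (D.coordRep_pow_four c h.mem_𝔪sum x)

/-- H acts by automorphisms of the contracted bracket, hence normalizes exp(𝔪). -/
lemma mul_expAd (h : IsAdapted D σ) {u : (Module.End ℝ (𝔤 n₁ n₂ n₃))ˣ}
    (hu : u ∈ isotropy n₁ n₂ n₃) (x : E) :
    u * expAd D.contracted (c x : 𝔤 n₁ n₂ n₃) =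
      expAd D.contracted (c (h.act c u x) : 𝔤 n₁ n₂ n₃) * u := by
  refine Units.ext ?_
  rw [Units.val_mul, Units.val_mul, h.coe_expAd, h.coe_expAd]
  exact exp3_intertwine ((h.isAutomorphism hu).mul_coordRep c h.mem_𝔪sum x)

/-- H fixes the regular element of its centre, whereas exp x fixes it only for x = 0. -/
lemma eq_zero_of_expAd_mem (h : IsAdapted D σ) {x : E}
    (hx : expAd D.contracted (c x : 𝔤 n₁ n₂ n₃) ∈ isotropy n₁ n₂ n₃) : x = 0 := by
  have h1 := (h.isAutomorphism hx).center 10 3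
  rw [h.coe_expAd] at h1
  exact D.eq_zero_of_exp3_centerSo c h.mem_𝔪sum h1

variable [FiniteDimensional ℝ E]

/-- The multiplication of the nilpotent group in exponential coordinates. -/
def mul (h : IsAdapted D σ) (x y : E) : E :=
  bch (D.coordBracket c h.mem_𝔪sum) x y

lemma expAd_mul (h : IsAdapted D σ) (x y : E) :
    expAd D.contracted (c x : 𝔤 n₁ n₂ n₃) * expAd D.contracted (c y : 𝔤 n₁ n₂ n₃) =
      expAd D.contracted (c (h.mul c x y) : 𝔤 n₁ n₂ n₃) := by
  refine Units.ext ?_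
  rw [Units.val_mul, h.coe_expAd, h.coe_expAd, h.coe_expAd, mul]
  exact (exp3_bch (D.coordRep_bracket c h.mem_𝔪sum) (D.coordRep_nilpotent c h.mem_𝔪sum) x y).symm

/-- Every element of the contracted group is the product of an exponential and an element of the
isotropy group. -/
lemma exists_eq_expAd_mul (h : IsAdapted D σ) {γ : (Module.End ℝ (𝔤 n₁ n₂ n₃))ˣ}
    (hγ : γ ∈ contractedGroup D.contracted) :
    ∃ z, ∃ u ∈ isotropy n₁ n₂ n₃, γ = expAd D.contracted (c z : 𝔤 n₁ n₂ n₃) * u := by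
  -- The products exp(z)u form a subgroup because exp(𝔪) is closed under multiplication and
  -- normalized by H; it contains the generators.
  let K : Subgroup (Module.End ℝ (𝔤 n₁ n₂ n₃))ˣ :=
    { carrier := {γ | ∃ z, ∃ u ∈ isotropy n₁ n₂ n₃,
        γ = expAd D.contracted (c z : 𝔤 n₁ n₂ n₃) * u}
      mul_mem' := by
        rintro _ _ ⟨z, u, hu, rfl⟩ ⟨w, v, hv, rfl⟩
        refine ⟨h.mul c z (h.act c u w), u * v, mul_mem hu hv, ?_⟩
        rw [← h.expAd_mul c, mul_assoc, ← mul_assoc u, h.mul_expAd c hu]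
        simp only [mul_assoc]
      one_mem' := ⟨0, 1, one_mem _, by rw [h.expAd_zero, mul_one]⟩
      inv_mem' := by
        rintro _ ⟨z, u, hu, rfl⟩
        refine ⟨h.act c u⁻¹ (-z), u⁻¹, inv_mem hu, ?_⟩
        rw [_root_.mul_inv_rev, h.expAd_inv, h.mul_expAd c (inv_mem hu)] }
  have hK : contractedGroup D.contracted ≤ K := by
    refine sup_le (fun u hu => ⟨0, u, hu, by rw [h.expAd_zero, one_mul]⟩)
      ((Subgroup.closure_le K).2 ?_)
    rintro _ ⟨X, hX, rfl⟩
    refine ⟨c.symm ⟨X, hX⟩, 1, one_mem _, ?_⟩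
    rw [c.apply_symm_apply, mul_one]
  exact hK hγ

lemma mul_expAd_of_eq (h : IsAdapted D σ) {γ u : (Module.End ℝ (𝔤 n₁ n₂ n₃))ˣ}
    (hu : u ∈ isotropy n₁ n₂ n₃) {z : E} (hγ : γ = expAd D.contracted (c z : 𝔤 n₁ n₂ n₃) * u)
    (x : E) : γ * expAd D.contracted (c x : 𝔤 n₁ n₂ n₃) =
      expAd D.contracted (c (h.mul c z (h.act c u x)) : 𝔤 n₁ n₂ n₃) * u := by
  rw [hγ, mul_assoc, h.mul_expAd c hu, ← mul_assoc, h.expAd_mul]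

lemma contDiff_mul (h : IsAdapted D σ) {F : Type*} [NormedAddCommGroup F] [NormedSpace ℝ F]
    {f g : F → E} (hf : ContDiff ℝ ∞ f) (hg : ContDiff ℝ ∞ g) :
    ContDiff ℝ ∞ fun q => h.mul c (f q) (g q) := contDiff_bch hf hg

lemma contDiff_act (h : IsAdapted D σ) (u : (Module.End ℝ (𝔤 n₁ n₂ n₃))ˣ) :
    ContDiff ℝ ∞ (h.act c u) := (LinearMap.toContinuousLinearMap (h.act c u)).contDiff

lemma zero_mul (h : IsAdapted D σ) (x : E) : h.mul c 0 x = x := by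
  simp [mul, bch]

/-- The invariant metric on the contraction whose parameters, in the numbering of the splitting,
are `t ∘ σ`. -/
def metric (h : IsAdapted D σ) (t : Fin 6 → ℝ) : E → E →L[ℝ] E →L[ℝ] ℝ :=
  D.coordMetric c h.mem_𝔪sum (t ∘ σ)

lemma isMetric_metric (h : IsAdapted D σ) (h₃ : 1 < n₃) {t : Fin 6 → ℝ} (ht : ∀ i, t i ≠ 0) :
    PseudoRiemannian.IsMetric (h.metric c t) :=
  D.isMetric_coordMetric c h.mem_𝔪sum (fun i => ht (σ i)) (two_lt_card h₃)

lemma metric_invariant (h : IsAdapted D σ) (t : Fin 6 → ℝ) {u : (Module.End ℝ (𝔤 n₁ n₂ n₃))ˣ}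
    (hu : u ∈ isotropy n₁ n₂ n₃) (z x v w : E) :
    h.metric c t (h.mul c z (h.act c u x)) (fderiv ℝ (fun y => h.mul c z (h.act c u y)) x v)
      (fderiv ℝ (fun y => h.mul c z (h.act c u y)) x w) = h.metric c t x v w :=
  (h.isAutomorphism hu).coordMetric_invariant c h.mem_𝔪sum _ z x v w

lemma metric_zero (h : IsAdapted D σ) (t : Fin 6 → ℝ) (i j : Fin 6) (v w : E)
    (hv : (c v : 𝔤 n₁ n₂ n₃) ∈ 𝔪 n₁ n₂ n₃ i) (hw : (c w : 𝔤 n₁ n₂ n₃) ∈ 𝔪 n₁ n₂ n₃ j) :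
    h.metric c t 0 v w =
      if i = j then t i * -(killingForm ℝ (𝔤 n₁ n₂ n₃) (c v) (c w)) else 0 := by
  obtain ⟨i, rfl⟩ := σ.surjective i
  obtain ⟨j, rfl⟩ := σ.surjective j
  have hv' := (h.mem_𝔪 i _).1 hv
  have hw' := (h.mem_𝔪 j _).1 hw
  rw [metric, coordMetric_zero, metricForm_apply, killingForm_eq, embed_apply, embed_apply]
  generalize (c v : 𝔤 n₁ n₂ n₃) = X at hv'
  generalize (c w : 𝔤 n₁ n₂ n₃) = Y at hw'
  rw [Finset.sum_eq_single i]
  · by_cases hij : i = j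
    · subst hij
      rw [hv', hw', if_pos rfl, Function.comp_apply]
      ring
    · rw [← hw', D.proj_proj_of_ne (by simpa using hij), if_neg (fun e => hij (σ.injective e)), traceForm_comm, traceForm_zero_left]
      simp
  · intro k _ hk
    rw [← hv', D.proj_proj_of_ne (by simpa using hk), traceForm_zero_left]
    simp
  · simp

theorem isRicciFlat_metric (h : IsAdapted D σ) (h₃ : 1 < n₃) {t : Fin 6 → ℝ} (ht : ∀ i, t i ≠ 0)
    {K : ℝ} (hq : D.q.trace / 2 - 1 = D.p.trace * K) (ho : D.o.trace = D.p.trace * K ^ 2)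
    (h4 : t (σ 4) * t (σ 5) = -(K * t (σ 1) * t (σ 2)))
    (h3 : t (σ 3) * t (σ 5) ^ 2 = K ^ 2 * t (σ 1) ^ 2 * t (σ 2)) :
    PseudoRiemannian.IsRicciFlat (h.metric c t) :=
  D.isRicciFlat_coordMetric c h.mem_𝔪sum (t := t ∘ σ) (fun i => ht (σ i)) (two_lt_card h₃) hq ho
    h4 h3

attribute [local irreducible] expAd mul act metric

variable (c : Euc n₁ n₂ n₃ ≃ₗ[ℝ] 𝔪sum n₁ n₂ n₃)

lemma bijective_expMap (h : IsAdapted D σ) : Function.Bijective (expMap D.contracted c) := by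
  constructor
  · intro x y hxy
    have h1 := QuotientGroup.eq.1 hxy
    rw [Subgroup.mem_subgroupOf] at h1
    change (expAd D.contracted (c x : 𝔤 n₁ n₂ n₃))⁻¹ *
      expAd D.contracted (c y : 𝔤 n₁ n₂ n₃) ∈ isotropy n₁ n₂ n₃ at h1
    have h2 := h1
    rw [h.expAd_inv, h.expAd_mul] at h2
    have h3 := h.eq_zero_of_expAd_mem c h2
    have h4 : (expAd D.contracted (c x : 𝔤 n₁ n₂ n₃))⁻¹ *
      expAd D.contracted (c y : 𝔤 n₁ n₂ n₃) = 1 := by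
      rw [h.expAd_inv, h.expAd_mul, h3, h.expAd_zero]
    exact h.expAd_injective c (inv_mul_eq_one.1 h4)
  · intro q
    obtain ⟨γ, rfl⟩ := QuotientGroup.mk_surjective q
    obtain ⟨z, u, hu, hγ⟩ := h.exists_eq_expAd_mul c γ.2
    refine ⟨z, QuotientGroup.eq.2 ?_⟩
    rw [Subgroup.mem_subgroupOf]
    change (expAd D.contracted (c z : 𝔤 n₁ n₂ n₃))⁻¹ * γ.1 ∈ _
    rw [hγ, inv_mul_cancel_left]
    exact hu

/-- In the chart, exp(z)u acts by the linear map u followed by left translation by z. Smoothness,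
linearity of the isotropy action and invariance of the metric are all read off from this. -/
lemma translation_eq (h : IsAdapted D σ) {γ : contractedGroup D.contracted} {z : Euc n₁ n₂ n₃}
    {u : (Module.End ℝ (𝔤 n₁ n₂ n₃))ˣ} (hu : u ∈ isotropy n₁ n₂ n₃)
    (hγ : γ.1 = expAd D.contracted (c z : 𝔤 n₁ n₂ n₃) * u) (x : Euc n₁ n₂ n₃) :
    translation D.contracted c γ x = h.mul c z (h.act c u x) := by
  have e : (QuotientGroup.mk (γ * expG D.contracted (c x)) : Contraction D.contracted) =
      expMap D.contracted c (h.mul c z (h.act c u x)) := by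
    refine (QuotientGroup.eq.2 ?_).symm
    rw [Subgroup.mem_subgroupOf]
    change (expAd D.contracted (c (h.mul c z (h.act c u x)) : 𝔤 n₁ n₂ n₃))⁻¹ *
      (γ.1 * expAd D.contracted (c x : 𝔤 n₁ n₂ n₃)) ∈ _
    have e := h.mul_expAd_of_eq c hu hγ x
    rw [e, inv_mul_cancel_left]
    exact hu
  rw [translation, e]
  exact Function.leftInverse_invFun (h.bijective_expMap c).1 _

theorem isGlobalChart (h : IsAdapted D σ) : IsGlobalChart D.contracted c where
  bijective := h.bijective_expMap c
  smooth γ := by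
    obtain ⟨z, u, hu, hγ⟩ := h.exists_eq_expAd_mul c γ.2
    have hL := h.contDiff_act c u
    have e (q : Euc n₁ n₂ n₃ × Euc n₁ n₂ n₃) :
        translation D.contracted c (γ * expG D.contracted (c q.1)) q.2 =
          h.mul c (h.mul c z (h.act c u q.1)) (h.act c u q.2) := by
      have e := h.mul_expAd_of_eq c hu hγ q.1
      exact h.translation_eq c (γ := γ * expG D.contracted (c q.1)) hu e q.2
    simp only [e]
    exact h.contDiff_mul c (h.contDiff_mul c contDiff_const (hL.comp contDiff_fst))
      (hL.comp contDiff_snd)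
  linear γ hγ x := by
    rw [h.translation_eq c hγ (z := 0) (by rw [h.expAd_zero, one_mul]), h.zero_mul,
      h.coe_act c hγ x]

theorem isInvariantMetric (h : IsAdapted D σ) (h₃ : 1 < n₃) {t : Fin 6 → ℝ} (ht : ∀ i, t i ≠ 0) :
    IsInvariantMetric D.contracted c t (h.metric c t) where
  isMetric := h.isMetric_metric c h₃ ht
  invariant γ x v w := by
    obtain ⟨z, u, hu, hγ⟩ := h.exists_eq_expAd_mul c γ.2
    rw [show translation D.contracted c γ = fun y => h.mul c z (h.act c u y) from
      funext fun y => h.translation_eq c hu hγ y]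
    exact h.metric_invariant c t hu z x v w
  value := h.metric_zero c t

end IsAdapted

end Flag
end

/-! ### Conclusion for the four faces. -/

noncomputable section

namespace Flag

open BlockData

variable {n₁ n₂ n₃ : ℕ}

/-- Here p and q are the complex dimensions of the first and second complex summands of D, and K =
(q − 1)/(2p). The numerical hypothesis is precisely tr o = tr p · K². -/
theorem IsAdapted.contractionIsRicciFlat {D : BlockData (Idx n₁ n₂ n₃)} {σ : Equiv.Perm (Fin 6)}
    (h : IsAdapted D σ) {f : Fin 6 → ℤ} (hf : ∀ k, f (σ k) = deg (some k)) (h₃ : 1 < n₃)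
    {p q : ℕ} (hp : 1 < p) (hq : 1 < q) (hDp : D.p.trace = 2 * p) (hDq : D.q.trace = 2 * q)
    (hDo : D.o.trace = 2 * n₃ + 1) (hpq : 2 * (p : ℤ) * (2 * n₃ + 1) = ((q : ℤ) - 1) ^ 2)
    {T : Set (Fin 6 → ℝ)} (hT : ∀ t ∈ T, (∀ i, t i ≠ 0) ∧
      t (σ 4) * t (σ 5) = -(((q : ℝ) - 1) / (2 * p) * t (σ 1) * t (σ 2)) ∧
      t (σ 3) * t (σ 5) ^ 2 = (((q : ℝ) - 1) / (2 * p)) ^ 2 * t (σ 1) ^ 2 * t (σ 2)) :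
    ContractionIsRicciFlat n₁ n₂ n₃ f T := by
  have hp' : (1 : ℝ) < p := by exact_mod_cast hp
  have hq' : (1 : ℝ) < q := by exact_mod_cast hq
  have hpq' : 2 * (p : ℝ) * (2 * n₃ + 1) = ((q : ℝ) - 1) ^ 2 := by exact_mod_cast hpq
  have hKq : D.q.trace / 2 - 1 = D.p.trace * (((q : ℝ) - 1) / (2 * p)) := by
    rw [hDp, hDq]
    field_simp
  have hKo : D.o.trace = D.p.trace * (((q : ℝ) - 1) / (2 * p)) ^ 2 := by
    rw [hDp, hDo]
    field_simp
    linarith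
  refine ⟨h.isParallelogram_face hf h₃ ?_ ?_ ?_ ?_, D.contracted, h.isContractedBracket hf,
    fun c => ⟨h.isGlobalChart c, fun t ht => ?_⟩⟩
  · rw [hDp]
    positivity
  · rw [hDq]
    linarith
  · rw [hDq]
    positivity
  · rw [hDo]
    positivity
  · obtain ⟨h0, h4, h3⟩ := hT t ht
    exact ⟨h.metric c t, h.isInvariantMetric c h₃ h0, h.isRicciFlat_metric c h₃ h0 hKq hKo h4 h3⟩

end Flag

theorem mainTheorem2 (n₁ n₂ n₃ : ℕ) (h₁ : 1 < n₁) (h₂ : 1 < n₂) (h₃ : 1 < n₃) :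
    (2 * (n₁ : ℤ) * (2 * n₃ + 1) = ((n₂ : ℤ) - 1) ^ 2 →
      Flag.ContractionIsRicciFlat n₁ n₂ n₃ ![4, 2, 2, 4, 3, 1]
        {t | ∃ t₁ t₂ t₃ : ℝ, 0 < t₁ ∧ 0 < t₂ ∧ 0 < t₃ ∧
          t = ![t₁, t₂, t₃, ((n₂ : ℝ) - 1) ^ 2 / (4 * (n₁ : ℝ) ^ 2) * t₂ ^ 2 * t₃,
            ((n₂ : ℝ) - 1) / (2 * (n₁ : ℝ)) * t₂ * t₃, -1]} ∧
      Flag.ContractionIsRicciFlat n₁ n₂ n₃ ![4, 2, 4, 2, 3, 1]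
        {t | ∃ t₁ t₂ t₃ : ℝ, 0 < t₁ ∧ 0 < t₂ ∧ 0 < t₃ ∧
          t = ![t₁, t₂, t₃, 4 * (n₁ : ℝ) ^ 2 / ((n₂ : ℝ) - 1) ^ 2 * (t₂ ^ 2)⁻¹ * t₃,
            2 * (n₁ : ℝ) / ((n₂ : ℝ) - 1) * t₂⁻¹ * t₃, -1]}) ∧
    (2 * (n₂ : ℤ) * (2 * n₃ + 1) = ((n₁ : ℤ) - 1) ^ 2 →
      Flag.ContractionIsRicciFlat n₁ n₂ n₃ ![2, 4, 2, 4, 1, 3]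
        {t | ∃ t₁ t₂ t₃ : ℝ, 0 < t₁ ∧ 0 < t₂ ∧ 0 < t₃ ∧
          t = ![t₁, t₂, t₃, t₃⁻¹, ((n₁ : ℝ) - 1) / (2 * (n₂ : ℝ)) * t₁ * t₃, -1]} ∧
      Flag.ContractionIsRicciFlat n₁ n₂ n₃ ![2, 4, 4, 2, 1, 3]
        {t | ∃ t₁ t₂ t₃ : ℝ, 0 < t₁ ∧ 0 < t₂ ∧ 0 < t₃ ∧
          t = ![t₁, t₂, t₃, t₃⁻¹, ((n₁ : ℝ) - 1) / (2 * (n₂ : ℝ)) * t₁ * t₃⁻¹, -1]}) := by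
  have h₁' : (0 : ℝ) < (n₁ : ℝ) - 1 := by
    rw [sub_pos]
    exact_mod_cast h₁
  have h₂' : (0 : ℝ) < (n₂ : ℝ) - 1 := by
    rw [sub_pos]
    exact_mod_cast h₂
  have h₁'' : (0 : ℝ) < n₁ := by linarith
  have h₂'' : (0 : ℝ) < n₂ := by linarith
  have h := Flag.isAdapted_blockData (n₁ := n₁) (n₂ := n₂) (n₃ := n₃)
  refine ⟨fun e => ⟨?_, ?_⟩, fun e => ⟨?_, ?_⟩⟩
  · refine h.contractionIsRicciFlat (by decide) h₃ h₁ h₂ Flag.trace_p Flag.trace_q Flag.trace_o e ?_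
    rintro t ⟨t₁, t₂, t₃, ht₁, ht₂, ht₃, rfl⟩
    refine ⟨fun i => ?_, ?_, ?_⟩
    · fin_cases i <;> simp <;> (repeat' constructor) <;> positivity
    · simp [Equiv.Perm.one_apply]
    · simp [Equiv.Perm.one_apply, div_pow, mul_pow]
      norm_num
  -- Reversing the complex structure of ℂ^n₂ exchanges the third and fourth entries of the form.
  · refine h.flip.contractionIsRicciFlat (by decide) h₃ h₁ h₂ Flag.trace_p Flag.trace_q
      Flag.trace_o e ?_
    rintro t ⟨t₁, t₂, t₃, ht₁, ht₂, ht₃, rfl⟩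
    have hσ : ∀ k, (1 * Equiv.swap 2 3 : Equiv.Perm (Fin 6)) k = ![0, 1, 3, 2, 4, 5] k := by decide
    simp only [hσ]
    refine ⟨fun i => ?_, ?_, ?_⟩
    · fin_cases i <;> simp <;> (repeat' constructor) <;> positivity
    · simp
      field_simp
      norm_num
    · simp
      field_simp
      norm_num
  -- Exchanging the complex summands exchanges the indices 0, 1 and 4, 5. The parameter −1 now
  -- belongs to the summand in the role of 4 instead of 5, which changes the shape of the family.
  · refine h.swap.contractionIsRicciFlat (by decide) h₃ h₂ h₁ Flag.trace_q Flag.trace_p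
      Flag.trace_o e ?_
    rintro t ⟨t₁, t₂, t₃, ht₁, ht₂, ht₃, rfl⟩
    have hσ : ∀ k, (1 * (Equiv.swap 0 1 * Equiv.swap 4 5) : Equiv.Perm (Fin 6)) k =
      ![1, 0, 2, 3, 5, 4] k := by decide
    simp only [hσ]
    refine ⟨fun i => ?_, ?_, ?_⟩
    · fin_cases i <;> simp <;> (repeat' constructor) <;> positivity
    · simp
    · simp
      field_simp
  · refine h.swap.flip.contractionIsRicciFlat (by decide) h₃ h₂ h₁ Flag.trace_q Flag.trace_p
      Flag.trace_o e ?_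
    rintro t ⟨t₁, t₂, t₃, ht₁, ht₂, ht₃, rfl⟩
    have hσ : ∀ k, (1 * (Equiv.swap 0 1 * Equiv.swap 4 5) * Equiv.swap 2 3 : Equiv.Perm (Fin 6)) k =
      ![1, 0, 3, 2, 5, 4] k := by decide
    simp only [hσ]
    refine ⟨fun i => ?_, ?_, ?_⟩
    · fin_cases i <;> simp <;> (repeat' constructor) <;> positivity
    · simp
    · simp
      field_simp

end
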